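/- Let $k$ be a field, let $A$ be a right-noetherian $k$-algebra and $B$ a left-noetherian $k$-algebra (associative, unital), and let $D={}_BD_A$ be a dualizing complex, that is, an object of the derived category $\mathsf D(B\otimes_k A^{\mathrm{op}})$ of $B$-left-$A$-right-modules such that 1. the cohomology of $D$ is bounded, and each $\mathrm H^i(D)$ is finitely generated both over $B$ and over $A^{\mathrm{op}}$; 2. the injective dimensions $\operatorname{id}_B D$ and $\operatorname{id}_{A^{\mathrm{op}}}D$ are finite, where $\operatorname{id}_R X\le n$ means that $X$ is isomorphic in $\mathsf D(R)$ to a bounded complex of injective $R$-left-modules vanishing in cohomological degrees $>n$; 3. the canonical morphisms $A\to \mathrm{RHom}_B(D,D)$ in $\mathsf D(A\otimes_k A^{\mathrm{op}})$ and $B\to \mathrm{RHom}_{A^{\mathrm{op}}}(D,D)$ in $\mathsf D(B\otimes_k B^{\mathrm{op}})$ are isomorphisms. Let $M$ be an $A$-left-module of finite flat dimension. Then $M$ has finite projective dimension. More precisely, if $M\neq 0$, then $\inf\{\,i \mid \mathrm H^i(D\otimes^{\mathrm L}_A M)\neq 0\,\}$ and $\operatorname{id}_B D$ are integers (the infimum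 is attained), and $$0\le \operatorname{pd}_A M \;\le\; -\inf\{\,i \mid \mathrm H^i(D\otimes^{\mathrm L}_A M)\neq 0\,\}+\operatorname{id}_B D .$$ -/

import Mathlib

open CategoryTheory Limits
open scoped TensorProduct MulOpposite

universe w v u

noncomputable section

namespace DualizingFlat

/-! ### Tensor products over a noncommutative ring -/

section Tensor

variable (B : Type w) (A : Type u) [Ring B] [Ring A]

/-- The subgroup of `N ⊗[ℤ] M` generated by the elements `n a ⊗ m - n ⊗ a m`
(as a left `B`-submodule, `N` being a `B`-left-`A`-right-module). -/
def balancedRelations (N M : Type u) [AddCommGroup N] [Module B N] [Module Aᵐᵒᵖ N]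
    [AddCommGroup M] [Module A M] : Submodule B (N ⊗[ℤ] M) :=
  Submodule.span B
    {x | ∃ (n : N) (a : A) (m : M), x = (MulOpposite.op a • n) ⊗ₜ[ℤ] m - n ⊗ₜ[ℤ] (a • m)}

/-- The tensor product `N ⊗_A M` of a `B`-left-`A`-right-module `N` and a left `A`-module `M`,
as a left `B`-module. For `B = ℤ` it is the usual abelian group `N ⊗_A M`. -/
abbrev BalancedTensor (N M : Type u) [AddCommGroup N] [Module B N] [Module Aᵐᵒᵖ N]
    [AddCommGroup M] [Module A M] : Type u :=
  (N ⊗[ℤ] M) ⧸ balancedRelations B A N M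

variable {N N' M M' : Type u} [AddCommGroup N] [Module B N] [Module Aᵐᵒᵖ N]
  [AddCommGroup N'] [Module B N'] [Module Aᵐᵒᵖ N'] [AddCommGroup M] [Module A M]
  [AddCommGroup M'] [Module A M']

/-- The map `f ⊗ g : N ⊗_A M → N' ⊗_A M'`. -/
def BalancedTensor.map (f : N →ₗ[B] N')
    (hf : ∀ (a : A) (n : N), f (MulOpposite.op a • n) = MulOpposite.op a • f n)
    (g : M →ₗ[A] M') : BalancedTensor B A N M →ₗ[B] BalancedTensor B A N' M' :=
  Submodule.mapQ _ _
    (TensorProduct.AlgebraTensorModule.map f g.toAddMonoidHom.toIntLinearMap) (by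
      refine Submodule.span_le.2 ?_
      rintro _ ⟨n, a, m, rfl⟩
      refine Submodule.subset_span ⟨f n, a, g m, ?_⟩
      simp [hf])

@[simp]
lemma BalancedTensor.map_mk_tmul (f : N →ₗ[B] N')
    (hf : ∀ (a : A) (n : N), f (MulOpposite.op a • n) = MulOpposite.op a • f n)
    (g : M →ₗ[A] M') (n : N) (m : M) :
    BalancedTensor.map B A f hf g (Submodule.Quotient.mk (n ⊗ₜ[ℤ] m)) =
      Submodule.Quotient.mk (f n ⊗ₜ[ℤ] g m) := rfl

variable {B A} in
lemma BalancedTensor.hom_ext {P : Type u} [AddCommGroup P] [Module B P]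
    {φ ψ : BalancedTensor B A N M →ₗ[B] P}
    (h : ∀ (n : N) (m : M), φ (Submodule.Quotient.mk (n ⊗ₜ[ℤ] m)) =
      ψ (Submodule.Quotient.mk (n ⊗ₜ[ℤ] m))) : φ = ψ := by
  refine Submodule.linearMap_qext _ (LinearMap.ext fun x => ?_)
  induction x using TensorProduct.induction_on with
  | zero => simp
  | tmul n m => exact h n m
  | add x y hx hy => rw [map_add, map_add, hx, hy]

end Tensor

/-! ### Flat dimension of left modules -/

section Flat

variable {A : Type u} [Ring A]

/-- A left `A`-module `M` is flat if `- ⊗_A M` preserves injections of right `A`-modules. -/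
def IsFlat (M : ModuleCat.{u} A) : Prop :=
  ∀ (N N' : Type u) [AddCommGroup N] [AddCommGroup N'] [Module Aᵐᵒᵖ N] [Module Aᵐᵒᵖ N']
    (f : N →ₗ[Aᵐᵒᵖ] N'), Function.Injective f →
      Function.Injective (BalancedTensor.map ℤ A f.toAddMonoidHom.toIntLinearMap
        (fun a n => f.map_smul (MulOpposite.op a) n) (LinearMap.id : M →ₗ[A] M))

/-- `fd M < ∞`: there is a resolution `0 → F_n → ⋯ → F_0 → M → 0` by flat modules. -/
def HasFiniteFlatDimension (M : ModuleCat.{u} A) : Prop :=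
  ∃ (n : ℕ) (F : ChainComplex (ModuleCat.{u} A) ℕ)
    (π : F ⟶ (ChainComplex.single₀ (ModuleCat.{u} A)).obj M),
    QuasiIso π ∧ (∀ i, IsFlat (F.X i)) ∧ ∀ i, n < i → IsZero (F.X i)

end Flat

/-! ### Injective dimension of complexes -/

/-- `id_R X ≤ n`: the complex `X` is isomorphic in the derived category to a bounded complex of
injective modules which vanishes in cohomological degrees `> n`. (Since the target is a bounded
below complex of injectives, such an isomorphism is the image of a quasi-isomorphism `X ⟶ I`.) -/
def InjDimLE {R : Type u} [Ring R] (X : CochainComplex (ModuleCat.{u} R) ℤ) (n : ℤ) : Prop :=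
  ∃ (I : CochainComplex (ModuleCat.{u} R) ℤ) (ι : X ⟶ I) (a : ℤ),
    QuasiIso ι ∧ (∀ i, Injective (I.X i)) ∧ I.IsStrictlyGE a ∧ I.IsStrictlyLE n

/-! ### Bimodules

For `k`-algebras `R` and `S`, a module over `R ⊗[k] S` is an abelian group with commuting
`k`-linear actions of `R` and `S`. A `B`-left-`A`-right-module is a module over `B ⊗[k] Aᵐᵒᵖ`. -/

section Bimodule

variable (k : Type v) [Field k] (R S : Type u) [Ring R] [Ring S] [Algebra k R] [Algebra k S]

/-- Forget the action of `S`. -/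
abbrev resLeft : ModuleCat.{u} (R ⊗[k] S) ⥤ ModuleCat.{u} R :=
  ModuleCat.restrictScalars (Algebra.TensorProduct.includeLeftRingHom : R →+* R ⊗[k] S)

/-- Forget the action of `R`. -/
abbrev resRight : ModuleCat.{u} (R ⊗[k] S) ⥤ ModuleCat.{u} S :=
  ModuleCat.restrictScalars
    (Algebra.TensorProduct.includeRight : S →ₐ[k] R ⊗[k] S).toRingHom

/-- View an `R ⊗[k] S`-module as an `S ⊗[k] R`-module. -/
abbrev swapBimodule : ModuleCat.{u} (R ⊗[k] S) ⥤ ModuleCat.{u} (S ⊗[k] R) :=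
  ModuleCat.restrictScalars
    (Algebra.TensorProduct.comm k S R : S ⊗[k] R →ₐ[k] R ⊗[k] S).toRingHom

/-- The complex `X` of `R ⊗[k] S`-modules, viewed as a complex of `R`-modules. -/
abbrev resLeftComplex (X : CochainComplex (ModuleCat.{u} (R ⊗[k] S)) ℤ) :
    CochainComplex (ModuleCat.{u} R) ℤ :=
  ((resLeft k R S).mapHomologicalComplex _).obj X

/-- The complex `X` of `R ⊗[k] S`-modules, viewed as a complex of `S`-modules. -/
abbrev resRightComplex (X : CochainComplex (ModuleCat.{u} (R ⊗[k] S)) ℤ) :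
    CochainComplex (ModuleCat.{u} S) ℤ :=
  ((resRight k R S).mapHomologicalComplex _).obj X

/-- The complex `X` of `R ⊗[k] S`-modules, viewed as a complex of `S ⊗[k] R`-modules. -/
abbrev swapComplex (X : CochainComplex (ModuleCat.{u} (R ⊗[k] S)) ℤ) :
    CochainComplex (ModuleCat.{u} (S ⊗[k] R)) ℤ :=
  ((swapBimodule k R S).mapHomologicalComplex _).obj X

/-- The action of `s : S` on an `R ⊗[k] S`-module, as an `R`-linear endomorphism. -/
def actLinear (s : S) (N : ModuleCat.{u} (R ⊗[k] S)) :
    (resLeft k R S).obj N →ₗ[R] (resLeft k R S).obj N where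
  toFun x := (((1 : R) ⊗ₜ[k] s : R ⊗[k] S) • (x : N) : N)
  map_add' x y := smul_add (M := R ⊗[k] S) (A := N) _ x y
  map_smul' r x := by
    change (((1 : R) ⊗ₜ[k] s : R ⊗[k] S) • ((r ⊗ₜ[k] (1 : S) : R ⊗[k] S) • (x : N) : N) : N) =
      ((r ⊗ₜ[k] (1 : S) : R ⊗[k] S) • (((1 : R) ⊗ₜ[k] s : R ⊗[k] S) • (x : N) : N) : N)
    rw [smul_smul, smul_smul]
    simp

/-- The action of `s : S` on `R ⊗[k] S`-modules, as a natural `R`-linear endomorphism. -/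
def actNat (s : S) : resLeft k R S ⟶ resLeft k R S where
  app N := ModuleCat.ofHom (X := (resLeft k R S).obj N) (Y := (resLeft k R S).obj N)
    (actLinear k R S s N)
  naturality N N' f := by
    ext x
    exact (f.hom.map_smul ((1 : R) ⊗ₜ[k] s) x).symm

lemma actNat_one_app (N : ModuleCat.{u} (R ⊗[k] S)) : (actNat k R S 1).app N = 𝟙 _ := by
  ext x
  exact one_smul (R ⊗[k] S) (x : N)

lemma actNat_mul_app (s t : S) (N : ModuleCat.{u} (R ⊗[k] S)) :
    (actNat k R S (s * t)).app N = (actNat k R S t).app N ≫ (actNat k R S s).app N := by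
  ext x
  change (((1 : R) ⊗ₜ[k] (s * t) : R ⊗[k] S) • (x : N) : N) =
    (((1 : R) ⊗ₜ[k] s : R ⊗[k] S) • (((1 : R) ⊗ₜ[k] t : R ⊗[k] S) • (x : N) : N) : N)
  rw [smul_smul]
  simp

lemma actNat_add_app (s t : S) (N : ModuleCat.{u} (R ⊗[k] S)) :
    (actNat k R S (s + t)).app N = (actNat k R S s).app N + (actNat k R S t).app N := by
  ext x
  change (((1 : R) ⊗ₜ[k] (s + t) : R ⊗[k] S) • (x : N) : N) =
    (((1 : R) ⊗ₜ[k] s : R ⊗[k] S) • (x : N) : N) + (((1 : R) ⊗ₜ[k] t : R ⊗[k] S) • (x : N) : N)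
  rw [TensorProduct.tmul_add, add_smul]

/-- The action of scalars from `k` commutes with all `R`-linear maps. -/
lemma actNat_algebraMap_comm (c : k) (N N' : ModuleCat.{u} (R ⊗[k] S))
    (f : (resLeft k R S).obj N ⟶ (resLeft k R S).obj N') :
    (actNat k R S (algebraMap k S c)).app N ≫ f =
      f ≫ (actNat k R S (algebraMap k S c)).app N' := by
  have key : ((1 : R) ⊗ₜ[k] algebraMap k S c : R ⊗[k] S) = (algebraMap k R c) ⊗ₜ[k] (1 : S) := by
    simp [Algebra.algebraMap_eq_smul_one, TensorProduct.smul_tmul]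
  ext x
  change f.hom (((1 : R) ⊗ₜ[k] algebraMap k S c : R ⊗[k] S) • (x : N) : N) =
    (((1 : R) ⊗ₜ[k] algebraMap k S c : R ⊗[k] S) • (f.hom x : N') : N')
  rw [key]
  exact f.hom.map_smul (algebraMap k R c) x

/-- The action of `s : S` on a complex of `R ⊗[k] S`-modules, by chain maps of complexes of
`R`-modules. -/
def actHom (X : CochainComplex (ModuleCat.{u} (R ⊗[k] S)) ℤ) (s : S) :
    resLeftComplex k R S X ⟶ resLeftComplex k R S X :=
  (NatTrans.mapHomologicalComplex (actNat k R S s) _).app X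

/-! ### The complex `Hom_R(X, X)` of `S`-bimodules -/

variable {k R S}

/-- The degree `n` part `∏_p Hom_R(X^p, X^{p+n})` of `Hom_R(X, X)`. -/
def EndCochain (X : CochainComplex (ModuleCat.{u} (R ⊗[k] S)) ℤ) (n : ℤ) : Type u :=
  CochainComplex.HomComplex.Cochain (resLeftComplex k R S X) (resLeftComplex k R S X) n

namespace EndCochain

open CochainComplex.HomComplex

variable (X : CochainComplex (ModuleCat.{u} (R ⊗[k] S)) ℤ) (n : ℤ)

instance : AddCommGroup (EndCochain X n) :=
  inferInstanceAs (AddCommGroup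
    (Cochain (resLeftComplex k R S X) (resLeftComplex k R S X) n))

variable {X n}

/-- The component `X^p ⟶ X^q` of an element of `Hom_R(X, X)` of degree `n`, where `p + n = q`. -/
def v (z : EndCochain X n) (p q : ℤ) (hpq : p + n = q) :
    (resLeft k R S).obj (X.X p) ⟶ (resLeft k R S).obj (X.X q) :=
  Cochain.v z p q hpq

@[ext]
lemma ext {z z' : EndCochain X n} (h : ∀ p q hpq, z.v p q hpq = z'.v p q hpq) : z = z' :=
  Cochain.ext _ _ h

lemma add_v (z z' : EndCochain X n) (p q : ℤ) (hpq : p + n = q) :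
    (z + z').v p q hpq = z.v p q hpq + z'.v p q hpq := rfl

lemma zero_v (p q : ℤ) (hpq : p + n = q) : (0 : EndCochain X n).v p q hpq = 0 := rfl

/-- `S` acts on the left of `Hom_R(X, X)` through its action on the target. -/
instance : SMul S (EndCochain X n) where
  smul s z := Cochain.comp z (Cochain.ofHom (actHom k R S X s)) (add_zero n)

/-- `S` acts on the right of `Hom_R(X, X)` through its action on the source. -/
instance : SMul Sᵐᵒᵖ (EndCochain X n) where
  smul s z := Cochain.comp (Cochain.ofHom (actHom k R S X s.unop)) z (zero_add n)

lemma smul_v (s : S) (z : EndCochain X n) (p q : ℤ) (hpq : p + n = q) :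
    (s • z).v p q hpq = z.v p q hpq ≫ (actNat k R S s).app (X.X q) :=
  Cochain.comp_zero_cochain_v _ _ _ _ _

lemma op_smul_v (s : Sᵐᵒᵖ) (z : EndCochain X n) (p q : ℤ) (hpq : p + n = q) :
    (s • z).v p q hpq = (actNat k R S s.unop).app (X.X p) ≫ z.v p q hpq :=
  Cochain.zero_cochain_comp_v _ _ _ _ _

lemma actNat_zero_app (N : ModuleCat.{u} (R ⊗[k] S)) : (actNat k R S 0).app N = 0 := by
  have := actNat_add_app k R S 0 0 N
  simpa using this

instance : Module S (EndCochain X n) where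
  one_smul z := by ext1 p q h; rw [smul_v, actNat_one_app, Category.comp_id]
  mul_smul s t z := by
    ext1 p q h; rw [smul_v, smul_v, smul_v, actNat_mul_app, Category.assoc]
  smul_zero s := by ext1 p q h; rw [smul_v, zero_v, zero_comp]
  smul_add s z z' := by
    ext1 p q h; rw [smul_v, add_v, add_v, smul_v, smul_v, Preadditive.add_comp]
  add_smul s t z := by
    ext1 p q h; rw [smul_v, add_v, smul_v, smul_v, actNat_add_app, Preadditive.comp_add]
  zero_smul z := by ext1 p q h; rw [smul_v, zero_v, actNat_zero_app, comp_zero]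

instance : Module Sᵐᵒᵖ (EndCochain X n) where
  one_smul z := by
    ext1 p q h; rw [op_smul_v, MulOpposite.unop_one, actNat_one_app, Category.id_comp]
  mul_smul s t z := by
    ext1 p q h
    rw [op_smul_v, op_smul_v, op_smul_v, MulOpposite.unop_mul, actNat_mul_app, Category.assoc]
  smul_zero s := by ext1 p q h; rw [op_smul_v, zero_v, comp_zero]
  smul_add s z z' := by
    ext1 p q h; rw [op_smul_v, add_v, add_v, op_smul_v, op_smul_v, Preadditive.comp_add]
  add_smul s t z := by
    ext1 p q h
    rw [op_smul_v, add_v, op_smul_v, op_smul_v, MulOpposite.unop_add, actNat_add_app,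
      Preadditive.add_comp]
  zero_smul z := by
    ext1 p q h; rw [op_smul_v, zero_v, MulOpposite.unop_zero, actNat_zero_app, zero_comp]

instance : Module k (EndCochain X n) := Module.compHom _ (algebraMap k S)

lemma k_smul_def (c : k) (z : EndCochain X n) : c • z = algebraMap k S c • z := rfl

instance : IsScalarTower k S (EndCochain X n) where
  smul_assoc c s z := by rw [k_smul_def, Algebra.smul_def, mul_smul]

lemma op_algebraMap_smul (c : k) (z : EndCochain X n) :
    algebraMap k Sᵐᵒᵖ c • z = c • z := by
  ext1 p q h
  rw [k_smul_def, smul_v, op_smul_v]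
  exact actNat_algebraMap_comm k R S c _ _ _

instance : IsScalarTower k Sᵐᵒᵖ (EndCochain X n) where
  smul_assoc c s z := by rw [← op_algebraMap_smul, Algebra.smul_def, mul_smul]

instance : SMulCommClass S Sᵐᵒᵖ (EndCochain X n) where
  smul_comm s t z := by
    ext1 p q h; rw [smul_v, op_smul_v, op_smul_v, smul_v, Category.assoc]

/-- `Hom_R(X, X)` in degree `n` as an `S`-bimodule: `((s ⊗ t) z)(x) = s z(t x)`. -/
instance : Module (S ⊗[k] Sᵐᵒᵖ) (EndCochain X n) := TensorProduct.Algebra.module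

lemma tmul_smul (s : S) (t : Sᵐᵒᵖ) (z : EndCochain X n) :
    (s ⊗ₜ[k] t) • z = s • t • z := rfl

/-- The differential of `Hom_R(X, X)`, with components
`z ↦ d ∘ z - (-1)^n z ∘ d` for `m = n + 1`. -/
def diff (n m : ℤ) (z : EndCochain X n) : EndCochain X m := δ n m z

lemma diff_add (n m : ℤ) (z z' : EndCochain X n) :
    diff n m (z + z') = diff n m z + diff n m z' := δ_add _ _ _ _

lemma diff_shape (n m : ℤ) (h : ¬ n + 1 = m) (z : EndCochain X n) : diff n m z = 0 :=
  δ_shape _ _ h _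

lemma diff_diff (n m l : ℤ) (z : EndCochain X n) : diff m l (diff n m z) = 0 :=
  δ_δ _ _ _ _

lemma diff_smul (n m : ℤ) (s : S) (z : EndCochain X n) : diff n m (s • z) = s • diff n m z :=
  δ_comp_ofHom _ _ _

lemma diff_op_smul (n m : ℤ) (s : Sᵐᵒᵖ) (z : EndCochain X n) :
    diff n m (s • z) = s • diff n m z :=
  δ_ofHom_comp _ _ _

/-- The differential of `Hom_R(X, X)` is a map of `S`-bimodules. -/
def diffLinear (X : CochainComplex (ModuleCat.{u} (R ⊗[k] S)) ℤ) (n m : ℤ) :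
    EndCochain X n →ₗ[S ⊗[k] Sᵐᵒᵖ] EndCochain X m where
  toFun := diff n m
  map_add' := diff_add n m
  map_smul' a z := by
    rw [RingHom.id_apply]
    induction a using TensorProduct.induction_on with
    | zero =>
      have h := diff_add n m (0 : EndCochain X n) 0
      rw [add_zero, left_eq_add] at h
      exact (congrArg (diff n m) (zero_smul (S ⊗[k] Sᵐᵒᵖ) z)).trans
        (h.trans (zero_smul (S ⊗[k] Sᵐᵒᵖ) (diff n m z)).symm)
    | add a b ha hb => rw [add_smul, add_smul, diff_add, ha, hb]
    | tmul s t => rw [tmul_smul, tmul_smul, diff_smul, diff_op_smul]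

/-- The endomorphism `x ↦ s x` of `X` for `s : S`, as an element of `Hom_R(X, X)` of degree `0`. -/
def homothety (X : CochainComplex (ModuleCat.{u} (R ⊗[k] S)) ℤ) (s : S) : EndCochain X 0 :=
  Cochain.ofHom (actHom k R S X s)

lemma ext₀ {z z' : EndCochain X 0}
    (h : ∀ p, z.v p p (add_zero p) = z'.v p p (add_zero p)) : z = z' :=
  Cochain.ext₀ _ _ h

lemma homothety_v_self (s : S) (p : ℤ) :
    (homothety X s).v p p (add_zero p) = (actNat k R S s).app (X.X p) :=
  Cochain.ofHom_v _ _

lemma diff_homothety (s : S) (m : ℤ) : diff 0 m (homothety X s) = 0 :=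
  δ_ofHom _

end EndCochain

variable (k S) in
/-- The algebra `S` as a bimodule over itself: `(s ⊗ t) x = s x t`. -/
abbrev selfBimodule : Module (S ⊗[k] Sᵐᵒᵖ) S := TensorProduct.Algebra.module

variable (k S) in
/-- The `S`-bimodule `S`. -/
def regularBimodule : ModuleCat.{u} (S ⊗[k] Sᵐᵒᵖ) :=
  letI := selfBimodule k S
  ModuleCat.of (S ⊗[k] Sᵐᵒᵖ) S

/-- The complex of `S`-bimodules `Hom_R(X, X)`. -/
def endComplex (X : CochainComplex (ModuleCat.{u} (R ⊗[k] S)) ℤ) :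
    CochainComplex (ModuleCat.{u} (S ⊗[k] Sᵐᵒᵖ)) ℤ where
  X n := ModuleCat.of _ (EndCochain X n)
  d n m := ModuleCat.ofHom (EndCochain.diffLinear X n m)
  shape n m h := by
    refine ModuleCat.hom_ext (LinearMap.ext fun z => ?_)
    exact EndCochain.diff_shape n m h z
  d_comp_d' n m l _ _ := by
    refine ModuleCat.hom_ext (LinearMap.ext fun z => ?_)
    exact EndCochain.diff_diff n m l z

/-- The map of `S`-bimodules from `S` to the degree `0` part of `Hom_R(X, X)`, `s ↦ (x ↦ s x)`. -/
def homothetyLinear (X : CochainComplex (ModuleCat.{u} (R ⊗[k] S)) ℤ) :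
    letI := selfBimodule k S
    S →ₗ[S ⊗[k] Sᵐᵒᵖ] EndCochain X 0 :=
  letI := selfBimodule k S
  { toFun := EndCochain.homothety X
    map_add' := fun s t => by
      refine EndCochain.ext₀ fun p => ?_
      rw [EndCochain.add_v, EndCochain.homothety_v_self, EndCochain.homothety_v_self,
        EndCochain.homothety_v_self, actNat_add_app]
    map_smul' := fun a x => by
      rw [RingHom.id_apply]
      have hadd : ∀ s t : S, EndCochain.homothety X (s + t) =
          EndCochain.homothety X s + EndCochain.homothety X t := fun s t => by
        refine EndCochain.ext₀ fun p => ?_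
        rw [EndCochain.add_v, EndCochain.homothety_v_self, EndCochain.homothety_v_self,
          EndCochain.homothety_v_self, actNat_add_app]
      induction a using TensorProduct.induction_on with
      | zero =>
        have h := hadd 0 0
        rw [add_zero, left_eq_add] at h
        exact (congrArg (EndCochain.homothety X) (zero_smul (S ⊗[k] Sᵐᵒᵖ) x)).trans
          (h.trans (zero_smul (S ⊗[k] Sᵐᵒᵖ) (EndCochain.homothety X x)).symm)
      | add a b ha hb => rw [add_smul, add_smul, hadd, ha, hb]
      | tmul s t =>
        have h1 : (s ⊗ₜ[k] t : S ⊗[k] Sᵐᵒᵖ) • x = s * (x * t.unop) := rfl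
        rw [h1, EndCochain.tmul_smul]
        refine EndCochain.ext₀ fun p => ?_
        rw [EndCochain.smul_v, EndCochain.op_smul_v, EndCochain.homothety_v_self,
          EndCochain.homothety_v_self, actNat_mul_app, actNat_mul_app] }

/-- The canonical chain map of complexes of `S`-bimodules `S ⟶ Hom_R(X, X)`. -/
def homothetyMap (X : CochainComplex (ModuleCat.{u} (R ⊗[k] S)) ℤ) :
    (HomologicalComplex.single _ (ComplexShape.up ℤ) 0).obj (regularBimodule k S) ⟶
      endComplex X :=
  letI := selfBimodule k S
  HomologicalComplex.mkHomFromSingle (ModuleCat.ofHom (homothetyLinear X)) (fun m _ => by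
    refine ModuleCat.hom_ext (LinearMap.ext fun s => ?_)
    exact EndCochain.diff_homothety (S := S) s m)

/-- The canonical morphism `S ⟶ RHom_R(D, D)` in the derived category of `S`-bimodules is an
isomorphism. Here `RHom_R(D, D)` is computed as `Hom_R(I, I)`, where `D ⟶ I` is a left-bounded
injective resolution over `R ⊗[k] S`; the terms of `I` are then injective over `R`. -/
def HomothetyIsIso (D : CochainComplex (ModuleCat.{u} (R ⊗[k] S)) ℤ) : Prop :=
  ∃ (I : CochainComplex (ModuleCat.{u} (R ⊗[k] S)) ℤ) (ι : D ⟶ I) (a : ℤ),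
    QuasiIso ι ∧ (∀ i, Injective (I.X i)) ∧ I.IsStrictlyGE a ∧ QuasiIso (homothetyMap I)


end Bimodule

/-! ### Dualizing complexes -/

section Dualizing

variable (k : Type v) [Field k] (A B : Type u) [Ring A] [Ring B] [Algebra k A] [Algebra k B]

/-- `D`, a complex of `B`-left-`A`-right-modules representing an object of the derived category
`D(B ⊗[k] Aᵐᵒᵖ)`, is a dualizing complex. -/
structure IsDualizingComplex (D : CochainComplex (ModuleCat.{u} (B ⊗[k] Aᵐᵒᵖ)) ℤ) : Prop where
  /-- The cohomology is bounded. -/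
  bounded : ∃ a b : ℤ, ∀ i, (i < a ∨ b < i) → IsZero (D.homology i)
  /-- The cohomology is finitely generated over `B`. -/
  finite_left : ∀ i, Module.Finite B ((resLeft k B Aᵐᵒᵖ).obj (D.homology i))
  /-- The cohomology is finitely generated over `Aᵐᵒᵖ`. -/
  finite_right : ∀ i, Module.Finite Aᵐᵒᵖ ((resRight k B Aᵐᵒᵖ).obj (D.homology i))
  /-- The injective dimension over `B` is finite. -/
  injDim_left : ∃ n, InjDimLE (resLeftComplex k B Aᵐᵒᵖ D) n
  /-- The injective dimension over `Aᵐᵒᵖ` is finite. -/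
  injDim_right : ∃ n, InjDimLE (resRightComplex k B Aᵐᵒᵖ D) n
  /-- The canonical morphism `A ⟶ RHom_B(D, D)` is an isomorphism. (Right multiplications are an
  action of `Aᵐᵒᵖ`; as bimodules over `Aᵐᵒᵖ` and over `A` are the same, so are the maps
  `Aᵐᵒᵖ ⟶ RHom_B(D, D)` and `A ⟶ RHom_B(D, D)`.) -/
  homothety_right : HomothetyIsIso (R := B) (S := Aᵐᵒᵖ) D
  /-- The canonical morphism `B ⟶ RHom_{Aᵐᵒᵖ}(D, D)` is an isomorphism. -/
  homothety_left : HomothetyIsIso (R := Aᵐᵒᵖ) (S := B) (swapComplex k B Aᵐᵒᵖ D)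

end Dualizing

/-! ### The derived tensor product -/

section DerivedTensor

variable (k : Type v) [Field k] (A B : Type u) [Ring A] [Ring B] [Algebra k A] [Algebra k B]

variable {k A B} in
/-- The action of `B` on a `B`-left-`A`-right-module. -/
abbrev leftAction (N : ModuleCat.{u} (B ⊗[k] Aᵐᵒᵖ)) : Module B N :=
  Module.compHom N (Algebra.TensorProduct.includeLeftRingHom : B →+* B ⊗[k] Aᵐᵒᵖ)

variable {k A B} in
/-- The right action of `A` on a `B`-left-`A`-right-module. -/
abbrev rightAction (N : ModuleCat.{u} (B ⊗[k] Aᵐᵒᵖ)) : Module Aᵐᵒᵖ N :=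
  Module.compHom N (Algebra.TensorProduct.includeRight : Aᵐᵒᵖ →ₐ[k] B ⊗[k] Aᵐᵒᵖ).toRingHom

attribute [local instance] leftAction rightAction

/-- The functor `(N, M) ↦ N ⊗_A M` from `B`-left-`A`-right-modules and left `A`-modules to
left `B`-modules. -/
def tensorFunctor : ModuleCat.{u} (B ⊗[k] Aᵐᵒᵖ) ⥤ ModuleCat.{u} A ⥤ ModuleCat.{u} B where
  obj N :=
    { obj := fun M => ModuleCat.of B (BalancedTensor B A N M)
      map := fun g => ModuleCat.ofHom
        (BalancedTensor.map B A LinearMap.id (fun _ _ => rfl) g.hom)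
      map_id := fun M => by
        ext1
        exact BalancedTensor.hom_ext fun n m => rfl
      map_comp := fun g g' => by
        ext1
        exact BalancedTensor.hom_ext fun n m => rfl }
  map {N N'} f :=
    { app := fun M => ModuleCat.ofHom (BalancedTensor.map B A
        { toFun := f.hom
          map_add' := f.hom.map_add
          map_smul' := fun b n => f.hom.map_smul (b ⊗ₜ[k] (1 : Aᵐᵒᵖ)) n }
        (fun a n => f.hom.map_smul ((1 : B) ⊗ₜ[k] MulOpposite.op a) n) LinearMap.id)
      naturality := fun M M' g => by
        ext1
        exact BalancedTensor.hom_ext fun n m => rfl }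
  map_id N := by
    ext M : 3
    exact BalancedTensor.hom_ext fun n m => rfl
  map_comp {N N' N''} f g := by
    ext M : 3
    exact BalancedTensor.hom_ext fun n m => rfl

instance : (tensorFunctor k A B).Additive where
  map_add {N N' f g} := by
    ext M : 3
    refine BalancedTensor.hom_ext fun n m => ?_
    exact congrArg (Submodule.Quotient.mk (p := balancedRelations B A N' M))
      (TensorProduct.add_tmul (f.hom n) (g.hom n) m)

instance (N : ModuleCat.{u} (B ⊗[k] Aᵐᵒᵖ)) : ((tensorFunctor k A B).obj N).Additive where
  map_add {M M' f g} := by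
    ext1
    refine BalancedTensor.hom_ext fun n m => ?_
    exact congrArg (Submodule.Quotient.mk (p := balancedRelations B A N M'))
      (TensorProduct.tmul_add n (f.hom m) (g.hom m))

variable {k A B} in
/-- `D ⊗ᴸ_A M`, a complex of left `B`-modules: the total complex (with direct sums) of
`D ⊗_A P`, where `P` is a projective resolution of the left `A`-module `M`. -/
def derivedTensor (D : CochainComplex (ModuleCat.{u} (B ⊗[k] Aᵐᵒᵖ)) ℤ) (M : ModuleCat.{u} A) :
    CochainComplex (ModuleCat.{u} B) ℤ :=
  HomologicalComplex.mapBifunctor D (projectiveResolution M).cochainComplex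
    (tensorFunctor k A B) (ComplexShape.up ℤ)

end DerivedTensor

end DualizingFlat

/-! For a flat left `A`-module `N` the canonical map `N ⟶ RHom_B(D, D ⊗_A N)` is an isomorphism.
Indeed, the cohomology of `D` is bounded and finitely generated over the noetherian ring `B`, so in
the first argument `D` can be replaced, over `B`, by a bounded complex of finitely generated
modules. Tensor evaluation then identifies the target with `RHom_B(D, D) ⊗_A N`, and `RHom_B(D, D) ≅
A`. This is `exists_quasiIso_homComplex`.

By adjunction, `Ext^n_A(M, N)` is therefore the cohomology in degree `n` of `RHom_B(D ⊗ᴸ_A M, D ⊗_A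
N)`. If `id_B D ≤ d`, truncating an injective bimodule resolution of `D` at `d` gives a bounded
complex `T` of bimodules that are injective over `B`. The terms of `T ⊗_A N` are again injective
over `B`, because `B` is noetherian and `N` is flat. So if `D ⊗ᴸ_A M` has no cohomology below `m`,
then `Ext^n_A(M, N) = 0` for every `n > d - m` and every flat `N` (`homVanish_single`,
`IsDualizingComplex.subsingleton_ext`).

Such an `m` exists when `M` is flat or has finite projective dimension: for `J` injective over `B`,
`RHom_B(D ⊗ᴸ_A M, J)` is `RHom_A(M, Hom_B(T, J))`. Here `Hom_B(T, J)` is bounded, and in high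
degrees there is no `Ext` from `M` to its terms (`exactAt_totalTensor`).

Hence for flat `F` there is one `s` with `Ext^n_A(F, N) = 0` for all `n > s` and all flat `N`. All
syzygies of `F` are flat, so the presentation of the `s`-th syzygy splits and `pd F ≤ s`. A finite
flat resolution then gives `pd M < ∞`. Finally, if `pd M = p`, some projective `P` has `Ext^p_A(M,
P) ≠ 0`; as `P` is flat, `p ≤ d - m`. -/

namespace DualizingFlat

open CochainComplex HomComplex Abelian

/-! ### Elementwise description of homology in module categories -/

section Elements

variable {R : Type v} [Ring R] {ι : Type*} {c : ComplexShape ι}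

lemma exists_cycle (K : HomologicalComplex (ModuleCat.{u} R) c) {i j : ι} (hij : c.next i = j)
    (x : K.X i) (hx : K.d i j x = 0) : ∃ y : K.cycles i, K.iCycles i y = x := by
  subst hij
  have h := ShortComplex.exact_of_f_is_kernel
    (ShortComplex.mk (K.iCycles i) (K.d i (c.next i)) (by simp)) (K.cyclesIsKernel i _ rfl)
  exact (ShortComplex.moduleCat_exact_iff _).1 h x hx

lemma iCycles_injective (K : HomologicalComplex (ModuleCat.{u} R) c) (i : ι) :
    Function.Injective (K.iCycles i) :=
  (ModuleCat.mono_iff_injective _).1 inferInstance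

lemma d_iCycles_apply (K : HomologicalComplex (ModuleCat.{u} R) c) (i j : ι) (x : K.cycles i) :
    K.d i j (K.iCycles i x) = 0 := by
  rw [← ConcreteCategory.comp_apply, K.iCycles_d]; rfl

lemma homologyπ_eq_zero_iff (K : HomologicalComplex (ModuleCat.{u} R) c) {i j : ι}
    (hij : c.prev j = i) (x : K.cycles j) :
    K.homologyπ j x = 0 ↔ ∃ y : K.X i, K.d i j y = K.iCycles j x := by
  have h := ShortComplex.exact_of_g_is_cokernel
    (ShortComplex.mk (K.toCycles i j) (K.homologyπ j) (by simp)) (K.homologyIsCokernel i j hij)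
  have h' : K.homologyπ j x = 0 ↔ ∃ y, K.toCycles i j y = x := by
    refine ⟨(ShortComplex.moduleCat_exact_iff _).1 h x, ?_⟩
    rintro ⟨y, rfl⟩
    rw [← ConcreteCategory.comp_apply, K.toCycles_comp_homologyπ]; rfl
  rw [h']
  refine exists_congr fun y => ?_
  rw [← K.toCycles_i i j, ConcreteCategory.comp_apply]
  exact (iCycles_injective K j).eq_iff.symm

lemma homologyπ_surjective (K : HomologicalComplex (ModuleCat.{u} R) c) (j : ι) :
    Function.Surjective (K.homologyπ j) :=
  (ModuleCat.epi_iff_surjective _).1 inferInstance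

lemma exactAt_iff_elements (K : HomologicalComplex (ModuleCat.{u} R) c) {i j k : ι}
    (hij : c.prev j = i) (hjk : c.next j = k) :
    K.ExactAt j ↔ ∀ x : K.X j, K.d j k x = 0 → ∃ y : K.X i, K.d i j y = x := by
  rw [K.exactAt_iff' i j k hij hjk]
  exact ShortComplex.moduleCat_exact_iff _

/-- A map of complexes of modules is a quasi-isomorphism if and only if it is injective and
surjective on classes of cocycles. -/
lemma quasiIso_iff_elements {K L : CochainComplex (ModuleCat.{u} R) ℤ} (φ : K ⟶ L) :
    QuasiIso φ ↔ ∀ n : ℤ,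
      (∀ x : K.X n, K.d n (n + 1) x = 0 →
        (∃ y : L.X (n - 1), L.d (n - 1) n y = φ.f n x) →
          ∃ y : K.X (n - 1), K.d (n - 1) n y = x) ∧
      (∀ x : L.X n, L.d n (n + 1) x = 0 →
        ∃ (z : K.X n) (y : L.X (n - 1)), K.d n (n + 1) z = 0 ∧
          x = φ.f n z + L.d (n - 1) n y) := by
  have hn (n : ℤ) : (ComplexShape.up ℤ).next n = n + 1 := by simp
  have hp (n : ℤ) : (ComplexShape.up ℤ).prev n = n - 1 := by simp
  have hmap (n : ℤ) (x : K.cycles n) :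
      HomologicalComplex.homologyMap φ n (K.homologyπ n x) =
        L.homologyπ n (HomologicalComplex.cyclesMap φ n x) := by
    rw [← ConcreteCategory.comp_apply, ← ConcreteCategory.comp_apply,
      HomologicalComplex.homologyπ_naturality]
  have hcyc (n : ℤ) (x : K.cycles n) :
      L.iCycles n (HomologicalComplex.cyclesMap φ n x) = φ.f n (K.iCycles n x) := by
    rw [← ConcreteCategory.comp_apply, ← ConcreteCategory.comp_apply,
      HomologicalComplex.cyclesMap_i]
  rw [quasiIso_iff]
  refine forall_congr' fun n => ?_
  rw [quasiIsoAt_iff_isIso_homologyMap, ConcreteCategory.isIso_iff_bijective]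
  refine and_congr ⟨fun h x hx => ?_, fun h => ?_⟩ ⟨fun h x hx => ?_, fun h => ?_⟩
  · obtain ⟨x, rfl⟩ := exists_cycle K (hn n) x hx
    rintro ⟨y, hy⟩
    refine (homologyπ_eq_zero_iff K (hp n) x).1 (h ?_)
    rw [map_zero, hmap, homologyπ_eq_zero_iff L (hp n)]
    exact ⟨y, by rw [hy, hcyc]⟩
  · refine (injective_iff_map_eq_zero _).2 fun a ha => ?_
    obtain ⟨x, rfl⟩ := homologyπ_surjective K n a
    rw [hmap, homologyπ_eq_zero_iff L (hp n)] at ha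
    obtain ⟨y, hy⟩ := ha
    rw [homologyπ_eq_zero_iff K (hp n)]
    exact h _ (d_iCycles_apply K _ _ x) ⟨y, by rw [hy, hcyc]⟩
  · obtain ⟨x, rfl⟩ := exists_cycle L (hn n) x hx
    obtain ⟨a, ha⟩ := h (L.homologyπ n x)
    obtain ⟨z, rfl⟩ := homologyπ_surjective K n a
    rw [hmap, eq_comm, ← sub_eq_zero, ← map_sub, homologyπ_eq_zero_iff L (hp n)] at ha
    obtain ⟨y, hy⟩ := ha
    refine ⟨K.iCycles n z, y, d_iCycles_apply K _ _ z, ?_⟩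
    rw [hy, map_sub, hcyc]
    abel
  · intro a
    obtain ⟨x, rfl⟩ := homologyπ_surjective L n a
    obtain ⟨z, y, hz, hx⟩ := h _ (d_iCycles_apply L n (n + 1) x)
    obtain ⟨z, rfl⟩ := exists_cycle K (hn n) z hz
    refine ⟨K.homologyπ n z, ?_⟩
    rw [hmap, eq_comm, ← sub_eq_zero, ← map_sub, homologyπ_eq_zero_iff L (hp n)]
    exact ⟨y, by rw [map_sub, hcyc, hx]; abel⟩

end Elements

/-! ### Vanishing of the cohomology of complexes of homomorphisms -/

section HomVanish

variable {C : Type u} [Category.{v} C] [Abelian C]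

/-- Every cocycle of degree `n` from `K` to `L` is a coboundary. -/
def HomVanish (K L : CochainComplex C ℤ) (n : ℤ) : Prop :=
  ∀ z : Cochain K L n, δ n (n + 1) z = 0 → ∃ w : Cochain K L (n - 1), δ (n - 1) n w = z

lemma HomVanish.exists_δ_eq {K L : CochainComplex C ℤ} {n : ℤ} (h : HomVanish K L n) {m p : ℤ}
    (hm : m + 1 = n) (hp : n + 1 = p) (z : Cochain K L n) (hz : δ n p z = 0) :
    ∃ w : Cochain K L m, δ m n w = z := by
  obtain rfl : m = n - 1 := by lia
  subst hp
  exact h z hz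

/-- A cocycle of degree `n` is, after shifting, a chain map to `L⟦n⟧`, and a null-homotopy of that
map unshifts to a primitive. -/
lemma homVanish_of_homotopy {K L : CochainComplex C ℤ} (n : ℤ)
    (h : ∀ φ : K ⟶ L⟦n⟧, Nonempty (Homotopy φ 0)) : HomVanish K L n := fun z hz => by
  obtain ⟨φ, hφ⟩ := (Cocycle.equivHom ..).surjective
    ((Cocycle.mk z _ rfl hz).rightShift n 0 (zero_add n))
  obtain ⟨h⟩ := h φ
  obtain ⟨f, hf⟩ := Cochain.equivHomotopy _ _ h
  have hφ' : Cochain.ofHom φ = z.rightShift n 0 (zero_add n) := congrArg Subtype.val hφ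
  rw [Cochain.ofHom_zero, add_zero, hφ'] at hf
  -- Shifting commutes with `δ` only up to the sign `(-1)^n`, which the witness compensates.
  refine ⟨n.negOnePow • Cochain.rightUnshift f (n - 1) (by lia), ?_⟩
  apply (Cochain.rightShiftAddEquiv K L n n 0 (by simp)).injective
  change Cochain.rightShift _ n 0 (zero_add n) = Cochain.rightShift z n 0 (zero_add n)
  rw [hf, δ_units_smul, Cochain.rightShift_units_smul,
    Cochain.δ_rightUnshift _ _ _ _ 0 (by simp), Cochain.rightShift_units_smul,
    Cochain.rightShift_rightUnshift, smul_smul]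
  simp

lemma acyclic_shift {L : CochainComplex C ℤ} (hL : L.Acyclic) (n : ℤ) : (L⟦n⟧).Acyclic := by
  rw [← HomotopyCategory.quotient_obj_mem_subcategoryAcyclic_iff_acyclic] at hL ⊢
  exact ObjectProperty.prop_of_iso _
    (((HomotopyCategory.quotient C (.up ℤ)).commShiftIso n).symm.app L)
    ((HomotopyCategory.subcategoryAcyclic C).le_shift n _ hL)

lemma homVanish_of_isKProjective {K L : CochainComplex C ℤ} [K.IsKProjective] (hL : L.Acyclic)
    (n : ℤ) : HomVanish K L n :=
  homVanish_of_homotopy n fun φ => IsKProjective.nonempty_homotopy_zero φ (acyclic_shift hL n)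

/-- Quasi-isomorphisms are the maps whose cone lies in the triangulated subcategory of acyclic
complexes. -/
lemma acyclic_mappingCone {K L : CochainComplex C ℤ} (f : K ⟶ L) [QuasiIso f] :
    (mappingCone f).Acyclic := by
  rw [← HomotopyCategory.quotient_obj_mem_subcategoryAcyclic_iff_acyclic]
  refine ((HomotopyCategory.subcategoryAcyclic C).trW_iff_of_distinguished _
    (HomotopyCategory.mappingCone_triangleh_distinguished f)).1 ?_
  rw [← HomotopyCategory.quasiIso_eq_trW_subcategoryAcyclic]
  exact (HomotopyCategory.quotient_map_mem_quasiIso_iff f).2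
    ((HomologicalComplex.mem_quasiIso_iff _).2 inferInstance)

lemma exists_eq_liftCochain {K E E' : CochainComplex C ℤ} (f : E ⟶ E') {n m : ℤ}
    (h : n + 1 = m) (u : Cochain K (mappingCone f) n) :
    ∃ (α : Cochain K E m) (β : Cochain K E' n), u = mappingCone.liftCochain f α β h :=
  ⟨u.comp (mappingCone.fst f).1 h, u.comp (mappingCone.snd f) (add_zero _),
    (mappingCone.ext_cochain_to_iff f n m h).2 ⟨by simp, by simp⟩⟩

/-- A quasi-isomorphism `E ⟶ E'` whose cone receives no maps from `K` up to homotopy induces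
isomorphisms on the cohomology of `Hom(K, E)` and `Hom(K, E')`. -/
lemma homVanish_iff_of_mappingCone {K E E' : CochainComplex C ℤ} (f : E ⟶ E')
    (h : ∀ n, HomVanish K (mappingCone f) n) (n : ℤ) : HomVanish K E n ↔ HomVanish K E' n := by
  constructor
  · intro hE z hz
    obtain ⟨u, hu⟩ := h n (z.comp (Cochain.ofHom (mappingCone.inr f)) (add_zero n))
      (by rw [δ_comp_ofHom, hz, Cochain.zero_comp])
    -- The components of the primitive satisfy `δ α = 0` and `z = δ β + f ∘ α`; the hypothesis on
    -- `E` makes `α` a coboundary.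
    obtain ⟨α, β, rfl⟩ := exists_eq_liftCochain f (show n - 1 + 1 = n by lia) u
    rw [mappingCone.δ_liftCochain _ _ _ _ (n + 1) rfl,
      mappingCone.ext_cochain_to_iff f n (n + 1) rfl] at hu
    obtain ⟨h₁, h₂⟩ := hu
    obtain ⟨w, rfl⟩ := hE α (by simpa using h₁)
    refine ⟨β + w.comp (Cochain.ofHom f) (add_zero _), ?_⟩
    rw [δ_add, δ_comp_ofHom]
    simpa using h₂
  · intro hE' z hz
    obtain ⟨w', hw'⟩ := hE' (z.comp (Cochain.ofHom f) (add_zero n))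
      (by rw [δ_comp_ofHom, hz, Cochain.zero_comp])
    -- The pair `(z, -w')` is a cocycle of degree `n - 1` with values in the cone; the `E`-component
    -- of a primitive bounds `-z`.
    obtain ⟨u, hu⟩ := (h (n - 1)).exists_δ_eq (show n - 2 + 1 = n - 1 by lia)
      (show n - 1 + 1 = n by lia) (mappingCone.liftCochain f z (-w') (by lia)) (by
      rw [mappingCone.δ_liftCochain _ _ _ _ (n + 1) (by lia), hz, δ_neg, hw']
      simp)
    obtain ⟨α, β, rfl⟩ := exists_eq_liftCochain f (show n - 2 + 1 = n - 1 by lia) u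
    rw [mappingCone.δ_liftCochain _ _ _ _ n (by lia),
      mappingCone.ext_cochain_to_iff f (n - 1) n (by lia)] at hu
    exact ⟨-α, by simpa using hu.1⟩

lemma homVanish_iff_of_isKProjective {K E E' : CochainComplex C ℤ} [K.IsKProjective]
    (f : E ⟶ E') [QuasiIso f] (n : ℤ) : HomVanish K E n ↔ HomVanish K E' n :=
  homVanish_iff_of_mappingCone f
    (fun _ => homVanish_of_isKProjective (acyclic_mappingCone f) _) n

lemma HomVanish.of_homotopyEquiv {K E E' : CochainComplex C ℤ} {n : ℤ} (h : HomVanish K E n)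
    (e : HomotopyEquiv E E') : HomVanish K E' n := fun z hz => by
  obtain ⟨w, hw⟩ := h (z.comp (Cochain.ofHom e.inv) (add_zero n))
    (by rw [δ_comp_ofHom, hz, Cochain.zero_comp])
  have hH := δ_ofHomotopy e.homotopyInvHomId
  refine ⟨w.comp (Cochain.ofHom e.hom) (add_zero _) -
    z.comp (Cochain.ofHomotopy e.homotopyInvHomId) (by lia), ?_⟩
  rw [δ_sub, δ_comp_ofHom, hw, δ_comp z _ _ (n + 1) 0 n (by lia) rfl (by lia), hz, hH]
  simp

/-- Since `K` is arbitrary (it will be a total tensor product), the comparison has to come from the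
targets: a quasi-isomorphism of K-injective complexes is a homotopy equivalence. -/
lemma HomVanish.of_quasiIso {K E E' : CochainComplex C ℤ} {n : ℤ} (h : HomVanish K E n)
    [E.IsKInjective] [E'.IsKInjective] (f : E ⟶ E') [hf : QuasiIso f] : HomVanish K E' n := by
  obtain ⟨e, -⟩ := (IsKInjective.quasiIso_iff f).1 hf
  exact h.of_homotopyEquiv e

lemma exists_eq_descCochain {K K' L : CochainComplex C ℤ} (s : K' ⟶ K) {n m : ℤ}
    (h : m + 1 = n) (u : Cochain (mappingCone s) L n) :
    ∃ (α : Cochain K' L m) (β : Cochain K L n), u = mappingCone.descCochain s α β h :=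
  ⟨(mappingCone.inl s).comp u (by lia), (Cochain.ofHom (mappingCone.inr s)).comp u (zero_add n),
    (mappingCone.ext_cochain_from_iff s m n h).2 ⟨by simp, by simp⟩⟩

/-- Extension and uniqueness up to coboundaries of cocycles along a quasi-isomorphism, with
values in a K-injective complex. -/
lemma exists_extension_of_quasiIso {K K' L : CochainComplex C ℤ} [L.IsKInjective] (s : K' ⟶ K)
    [QuasiIso s] (n : ℤ) (z : Cochain K' L n) (hz : δ n (n + 1) z = 0) :
    ∃ (y : Cochain K L n) (w : Cochain K' L (n - 1)), δ n (n + 1) y = 0 ∧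
      z = (Cochain.ofHom s).comp y (zero_add n) + δ (n - 1) n w := by
  obtain ⟨m, hm⟩ : ∃ m, 1 + n = m := ⟨_, rfl⟩
  -- Composed with the projection of the cone to `K'`, `z` is a cocycle on an acyclic complex, hence
  -- a coboundary. The two components of a primitive are the correction `w` and, up to sign, the
  -- extension `y`.
  obtain ⟨u, hu⟩ := IsKInjective.eq_δ_of_cocycle (L := L)
    (Cocycle.mk ((mappingCone.fst s).1.comp z hm) (m + 1) rfl
      (by rw [δ_comp _ _ _ 2 (n + 1) _ (by lia) (by lia) rfl, hz]; simp))
    (acyclic_mappingCone s) n (by lia)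
  obtain ⟨w, y, rfl⟩ := exists_eq_descCochain s (show n - 1 + 1 = n by lia) u
  obtain rfl : m = n + 1 := by lia
  rw [mappingCone.δ_descCochain _ _ _ _ (n + 1) (by lia)] at hu
  obtain ⟨h₁, h₂⟩ := (mappingCone.ext_cochain_from_iff s n (n + 1) (by lia)).1 hu
  have h₂' : δ n (n + 1) y = 0 := by simpa using h₂
  have h₁' : δ (n - 1) n w + (n + 1).negOnePow • (Cochain.ofHom s).comp y (zero_add n) = z := by
    simpa using h₁
  refine ⟨(n + 1).negOnePow • y, w, ?_, ?_⟩
  · rw [δ_units_smul, h₂', smul_zero]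
  · rw [Cochain.comp_units_smul, ← h₁', add_comm]

/-- The cochain `w` and a signed `z` glue to a cocycle on the acyclic cone of `s`; the `K`-component
of a primitive bounds `z` up to sign. -/
lemma exists_δ_eq_of_quasiIso {K K' L : CochainComplex C ℤ} [L.IsKInjective] (s : K' ⟶ K)
    [QuasiIso s] (n : ℤ) (z : Cochain K L n) (hz : δ n (n + 1) z = 0) (w : Cochain K' L (n - 1))
    (hw : δ (n - 1) n w = (Cochain.ofHom s).comp z (zero_add n)) :
    ∃ y : Cochain K L (n - 1), δ (n - 1) n y = z := by
  obtain ⟨u, hu⟩ := IsKInjective.eq_δ_of_cocycle (L := L)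
    (Cocycle.mk (mappingCone.descCochain s w (n.negOnePow • z) (by lia)) (n + 1) rfl
      (by rw [mappingCone.δ_descCochain _ _ _ _ _ rfl, hw]; simp [hz, smul_smul, Int.negOnePow_succ]))
    (acyclic_mappingCone s) (n - 1) (by lia)
  obtain ⟨w', y, rfl⟩ := exists_eq_descCochain s (show n - 2 + 1 = n - 1 by lia) u
  rw [mappingCone.δ_descCochain _ _ _ _ n (by lia)] at hu
  obtain ⟨-, h₂⟩ := (mappingCone.ext_cochain_from_iff s (n - 1) n (by lia)).1 hu
  refine ⟨n.negOnePow • y, ?_⟩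
  have h₃ : δ (n - 1) n y = n.negOnePow • z := by simpa using h₂
  rw [δ_units_smul, h₃, smul_smul]
  simp

end HomVanish

/-! ### Null-homotopies into bounded below complexes -/

section NullHomotopy

variable {C : Type u} [Category.{v} C] [Preadditive C]

/-- Inductive step: `α` is a null-homotopy up to degree `n`. The defect `u` in degree `n + 1` is
killed by the incoming differential of `K`, hence factors through the outgoing one; the factor is a
new component of the homotopy and leaves lower degrees untouched. -/
lemma exists_eqUpTo_of_extension {K L : CochainComplex C ℤ}
    (f : K ⟶ L) (α : Cochain K L (-1)) (n m : ℤ) (hnm : n + 1 = m)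
    (hK : ∀ u : K.X m ⟶ L.X m, K.d (m - 1) m ≫ u = 0 →
      ∃ v : K.X (m + 1) ⟶ L.X m, K.d m (m + 1) ≫ v = u)
    (hα : (δ (-1) 0 α).EqUpTo (Cochain.ofHom f) n) :
    ∃ (h : K.X (n + 2) ⟶ L.X (n + 1)),
      (δ (-1) 0 (α + Cochain.single h (-1))).EqUpTo (Cochain.ofHom f) m := by
  subst hnm
  let u := f.f (n + 1) - α.v (n + 1) n (by lia) ≫ L.d n (n + 1) -
    K.d (n + 1) (n + 2) ≫ α.v (n + 2) (n + 1) (by lia)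
  have hu : K.d n (n + 1) ≫ u = 0 := by
    have eq := hα n n (add_zero n) (by rfl)
    simp only [δ_v (-1) 0 (neg_add_cancel 1) α n n (add_zero _) (n - 1) (n + 1)
      (by lia) (by lia), Int.negOnePow_zero, one_smul, Cochain.ofHom_v] at eq
    simp only [u, Preadditive.comp_sub, HomologicalComplex.d_comp_d_assoc, zero_comp,
      ← f.comm, ← eq, Preadditive.add_comp, Category.assoc, L.d_comp_d, comp_zero, zero_add,
      sub_self]
  obtain ⟨β, hβ⟩ : ∃ (β : K.X (n + 2) ⟶ L.X (n + 1)), K.d (n + 1) (n + 2) ≫ β = u := by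
    obtain ⟨m, hm⟩ : ∃ m, m = n + 2 := ⟨_, rfl⟩
    obtain rfl : m = n + 1 + 1 := by lia
    rw [← hm]
    refine hK u ?_
    rwa [show n + 1 - 1 = n by lia]
  refine ⟨β, ?_⟩
  intro p q hpq hp
  obtain rfl : p = q := by lia
  obtain hp | rfl := hp.lt_or_eq
  · rw [δ_add, Cochain.add_v, hα p p (by lia) (by lia), add_eq_left,
      δ_v (-1) 0 (neg_add_cancel 1) _ p p hpq (p - 1) (p + 1) rfl rfl,
      Cochain.single_v_eq_zero _ _ _ _ _ (by lia),
      Cochain.single_v_eq_zero _ _ _ _ _ (by lia)]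
    simp
  · rw [δ_v (-1) 0 (neg_add_cancel 1) _ (n + 1) (n + 1) (by lia) n (n + 2)
      (by lia) (by lia), Cochain.add_v,
      Cochain.single_v_eq_zero _ _ _ _ _ (by lia)]
    simp [hβ, u]

open Cochain.InductionUp in
/-- A map `K ⟶ L` to a bounded below complex is null-homotopic if for every `p` the complex
`Hom(K, L^p)` is exact in degree `p`. -/
lemma nonempty_homotopy_zero_of_extension {K L : CochainComplex C ℤ} (f : K ⟶ L) (d : ℤ)
    [L.IsStrictlyGE d]
    (hK : ∀ (m : ℤ) (u : K.X m ⟶ L.X m), K.d (m - 1) m ≫ u = 0 →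
      ∃ v : K.X (m + 1) ⟶ L.X m, K.d m (m + 1) ≫ v = u) :
    Nonempty (Homotopy f 0) := by
  -- Stage `n` is a null-homotopy up to degree `n + d - 1`. Stage `0` may be zero because `L`
  -- vanishes below `d`.
  let X (n : ℕ) : Set (Cochain K L (-1)) :=
    Set.ofPred (fun α => (δ (-1) 0 α).EqUpTo (Cochain.ofHom f) (n + d - 1))
  let x₀ : X 0 := ⟨0, fun p q hpq hp ↦
    IsZero.eq_of_tgt (L.isZero_of_isStrictlyGE d _ (by lia)) _ _⟩
  let φ (n : ℕ) (α : X n) : X (n + 1) :=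
    ⟨_, (exists_eqUpTo_of_extension f α.1 (n + d - 1) ((n + 1 : ℕ) + d - 1)
      (by lia) (hK _) α.2).choose_spec⟩
  have hφ (k : ℕ) (x : X k) : (φ k x).1.EqUpTo x.1 (d + k) := fun p q hpq hp => by
    dsimp [φ]
    rw [add_eq_left, Cochain.single_v_eq_zero _ _ _ _ _ (by lia)]
  refine ⟨(Cochain.equivHomotopy f 0).symm ⟨limitSequence φ hφ x₀, ?_⟩⟩
  rw [Cochain.ofHom_zero, add_zero]
  ext n
  -- From this stage on, the components with source in degrees `n` and `n + 1` no longer change.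
  let k₀ := (n - d + 1).toNat
  rw [← (sequence φ x₀ k₀).2 n n (add_zero n) (by lia),
    δ_v (-1) 0 (neg_add_cancel 1) _ n n (by lia) (n - 1) (n + 1) rfl (by lia),
    δ_v (-1) 0 (neg_add_cancel 1) _ n n (by lia) (n - 1) (n + 1) rfl (by lia),
    limitSequence_eqUpTo φ hφ x₀ k₀ n (n - 1) (by lia) (by lia),
    limitSequence_eqUpTo φ hφ x₀ k₀ (n + 1) n (by lia) (by lia)]

end NullHomotopy

/-! ### Vanishing by extending maps degree by degree -/

section

variable {C : Type u} [Category.{v} C] [Abelian C]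

/-- If `L` is bounded below and `Hom(K, L^q)` is exact in degree `p` for all `p + n = q`, then
the degree `n` cohomology of `Hom(K, L)` vanishes. -/
lemma homVanish_of_extension {K L : CochainComplex C ℤ} (n d : ℤ) [L.IsStrictlyGE d]
    (hK : ∀ (p q : ℤ) (_ : p + n = q) (u : K.X p ⟶ L.X q), K.d (p - 1) p ≫ u = 0 →
      ∃ v : K.X (p + 1) ⟶ L.X q, K.d p (p + 1) ≫ v = u) : HomVanish K L n := by
  refine homVanish_of_homotopy n fun φ => ?_
  have : (L⟦n⟧).IsStrictlyGE (d - n) := L.isStrictlyGE_shift d n _ (by lia)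
  exact nonempty_homotopy_zero_of_extension φ (d - n) fun m => hK m (m + n) rfl

end

/-! ### Exactness properties of balanced tensor products -/

namespace BalancedTensor

section

variable (B : Type w) (A : Type u) [Ring B] [Ring A]
variable {N N' N'' M M' M'' : Type u} [AddCommGroup N] [Module B N] [Module Aᵐᵒᵖ N]
  [AddCommGroup N'] [Module B N'] [Module Aᵐᵒᵖ N'] [AddCommGroup N''] [Module B N'']
  [Module Aᵐᵒᵖ N''] [AddCommGroup M] [Module A M] [AddCommGroup M'] [Module A M']
  [AddCommGroup M''] [Module A M'']

/-- The pure tensor `n ⊗ m` in `N ⊗_A M`. -/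
def tmul (n : N) (m : M) : BalancedTensor B A N M := Submodule.Quotient.mk (n ⊗ₜ[ℤ] m)

lemma tmul_add (n : N) (m m' : M) : tmul B A n (m + m') = tmul B A n m + tmul B A n m' := by
  simp [tmul, TensorProduct.tmul_add]

lemma add_tmul (n n' : N) (m : M) : tmul B A (n + n') m = tmul B A n m + tmul B A n' m := by
  simp [tmul, TensorProduct.add_tmul]

lemma tmul_zero (n : N) : tmul B A n (0 : M) = 0 := by
  simp [tmul]

lemma zero_tmul (m : M) : tmul B A (0 : N) m = 0 := by
  simp [tmul]

lemma op_smul_tmul (n : N) (a : A) (m : M) :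
    tmul B A (MulOpposite.op a • n) m = tmul B A n (a • m) :=
  (Submodule.Quotient.eq _).2 (Submodule.subset_span ⟨n, a, m, rfl⟩)

lemma smul_tmul (b : B) (n : N) (m : M) : tmul B A (b • n) m = b • tmul B A n m := rfl

variable {B A} in
@[elab_as_elim]
lemma induction_on {p : BalancedTensor B A N M → Prop} (t : BalancedTensor B A N M)
    (h0 : p 0) (htmul : ∀ n m, p (tmul B A n m)) (hadd : ∀ x y, p x → p y → p (x + y)) : p t := by
  obtain ⟨x, rfl⟩ := Submodule.Quotient.mk_surjective _ t
  induction x using TensorProduct.induction_on with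
  | zero => exact h0
  | tmul n m => exact htmul n m
  | add x y hx hy => exact hadd _ _ hx hy

/-- The map out of `N ⊗_A M` defined by a balanced biadditive map which is linear in the first
variable. -/
def lift {P : Type*} [AddCommGroup P] [Module B P] (f : N →ₗ[B] M →+ P)
    (hf : ∀ (n : N) (a : A) (m : M), f (MulOpposite.op a • n) m = f n (a • m)) :
    BalancedTensor B A N M →ₗ[B] P :=
  Submodule.liftQ _
    (TensorProduct.AlgebraTensorModule.lift
      { toFun := fun n => (f n).toIntLinearMap
        map_add' := fun n n' => by ext; simp
        map_smul' := fun b n => by ext; simp })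
    (Submodule.span_le.2 (by
      rintro _ ⟨n, a, m, rfl⟩
      simp [hf]))

variable {B A} in
lemma map_map (f : N →ₗ[B] N')
    (hf : ∀ (a : A) (n : N), f (MulOpposite.op a • n) = MulOpposite.op a • f n)
    (g : M →ₗ[A] M') (f' : N' →ₗ[B] N'')
    (hf' : ∀ (a : A) (n : N'), f' (MulOpposite.op a • n) = MulOpposite.op a • f' n)
    (g' : M' →ₗ[A] M'') (t : BalancedTensor B A N M) :
    map B A f' hf' g' (map B A f hf g t) =
      map B A (f' ∘ₗ f) (fun a n => by simp [hf, hf']) (g' ∘ₗ g) t := by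
  induction t using induction_on with
  | h0 => simp
  | htmul n m => rfl
  | hadd x y hx hy => simp only [map_add, hx, hy]

variable {B A} in
lemma map_surjective {f : N →ₗ[B] N'}
    {hf : ∀ (a : A) (n : N), f (MulOpposite.op a • n) = MulOpposite.op a • f n}
    {g : M →ₗ[A] M'} (h : Function.Surjective f) (h' : Function.Surjective g) :
    Function.Surjective (map B A f hf g) := fun t => by
  induction t using induction_on with
  | h0 => exact ⟨0, map_zero _⟩
  | htmul n m =>
    obtain ⟨n, rfl⟩ := h n
    obtain ⟨m, rfl⟩ := h' m
    exact ⟨tmul B A n m, rfl⟩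
  | hadd x y hx hy =>
    obtain ⟨x, rfl⟩ := hx
    obtain ⟨y, rfl⟩ := hy
    exact ⟨x + y, map_add _ _ _⟩

variable {B A} in
-- Balancing relations lift along surjections because their generators do; this reduces right
-- exactness over `A` to right exactness over `ℤ`.
lemma exists_relation_of_surjective {f : N →ₗ[B] N'}
    (hf : ∀ (a : A) (n : N), f (MulOpposite.op a • n) = MulOpposite.op a • f n)
    {g : M →ₗ[A] M'} (h : Function.Surjective f) (h' : Function.Surjective g)
    {x : N' ⊗[ℤ] M'} (hx : x ∈ balancedRelations B A N' M') :
    ∃ r ∈ balancedRelations B A N M,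
      TensorProduct.AlgebraTensorModule.map f g.toAddMonoidHom.toIntLinearMap r = x := by
  induction hx using Submodule.span_induction with
  | mem x hx =>
    obtain ⟨n, a, m, rfl⟩ := hx
    obtain ⟨n, rfl⟩ := h n
    obtain ⟨m, rfl⟩ := h' m
    exact ⟨_, Submodule.subset_span ⟨n, a, m, rfl⟩, by simp [hf]⟩
  | zero => exact ⟨0, Submodule.zero_mem _, map_zero _⟩
  | add x y _ _ hx hy =>
    obtain ⟨r, hr, rfl⟩ := hx
    obtain ⟨s, hs, rfl⟩ := hy
    exact ⟨r + s, Submodule.add_mem _ hr hs, map_add _ _ _⟩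
  | smul b x _ hx =>
    obtain ⟨r, hr, rfl⟩ := hx
    exact ⟨b • r, Submodule.smul_mem _ _ hr, map_smul _ _ _⟩

variable {B A} in
/-- Right exactness in the first variable. -/
lemma exists_map_eq_of_exact_left {f : N →ₗ[B] N'}
    (hf : ∀ (a : A) (n : N), f (MulOpposite.op a • n) = MulOpposite.op a • f n)
    {g : N' →ₗ[B] N''}
    (hg : ∀ (a : A) (n : N'), g (MulOpposite.op a • n) = MulOpposite.op a • g n)
    (h : ∀ n, g n = 0 → ∃ n', f n' = n) (hs : Function.Surjective g)
    (hfg : ∀ n, g (f n) = 0)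
    (t : BalancedTensor B A N' M) (ht : map B A g hg (LinearMap.id : M →ₗ[A] M) t = 0) :
    ∃ s, map B A f hf (LinearMap.id : M →ₗ[A] M) s = t := by
  obtain ⟨x, rfl⟩ := Submodule.Quotient.mk_surjective _ t
  obtain ⟨r, hr, hrx⟩ := exists_relation_of_surjective hg (g := (LinearMap.id : M →ₗ[A] M)) hs
    Function.surjective_id ((Submodule.Quotient.mk_eq_zero _).1 ht)
  have hex : Function.Exact f.toAddMonoidHom.toIntLinearMap g.toAddMonoidHom.toIntLinearMap :=
    fun n => ⟨fun hn => h n hn, by rintro ⟨n, rfl⟩; exact hfg n⟩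
  -- Corrected by the lifted relation `r`, the representative `x` dies already in the tensor product
  -- over `ℤ`.
  obtain ⟨y, hy⟩ := (rTensor_exact M hex hs (x - r)).1 (by
    rw [map_sub, sub_eq_zero]
    exact hrx.symm)
  refine ⟨Submodule.Quotient.mk y, ?_⟩
  refine (Submodule.Quotient.eq _).2 ?_
  have hy' : TensorProduct.AlgebraTensorModule.map f
    (LinearMap.id : M →ₗ[A] M).toAddMonoidHom.toIntLinearMap y = x - r := hy
  rw [hy']
  simpa using hr

variable {B A} in
/-- Right exactness in the second variable. -/
lemma exists_map_eq_of_exact_right {f : M →ₗ[A] M'} {g : M' →ₗ[A] M''}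
    (h : ∀ n, g n = 0 → ∃ n', f n' = n) (hs : Function.Surjective g)
    (hfg : ∀ n, g (f n) = 0)
    (t : BalancedTensor B A N M')
    (ht : map B A (LinearMap.id : N →ₗ[B] N) (fun _ _ => rfl) g t = 0) :
    ∃ s, map B A (LinearMap.id : N →ₗ[B] N) (fun _ _ => rfl) f s = t := by
  obtain ⟨x, rfl⟩ := Submodule.Quotient.mk_surjective _ t
  obtain ⟨r, hr, hrx⟩ := exists_relation_of_surjective (f := (LinearMap.id : N →ₗ[B] N))
    (fun _ _ => rfl) Function.surjective_id hs ((Submodule.Quotient.mk_eq_zero _).1 ht)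
  have hex : Function.Exact f.toAddMonoidHom.toIntLinearMap g.toAddMonoidHom.toIntLinearMap :=
    fun n => ⟨fun hn => h n hn, by rintro ⟨n, rfl⟩; exact hfg n⟩
  obtain ⟨y, hy⟩ := (lTensor_exact N hex hs (x - r)).1 (by
    rw [map_sub, sub_eq_zero]
    exact hrx.symm)
  refine ⟨Submodule.Quotient.mk y, ?_⟩
  refine (Submodule.Quotient.eq _).2 ?_
  have hy' : TensorProduct.AlgebraTensorModule.map (LinearMap.id : N →ₗ[B] N)
    f.toAddMonoidHom.toIntLinearMap y = x - r := hy
  rw [hy']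
  simpa using hr

/-- The underlying abelian group of `N ⊗_A M` does not depend on the action of `B`. -/
def ofInt : BalancedTensor ℤ A N M →ₗ[ℤ] BalancedTensor B A N M :=
  lift ℤ A
    (AddMonoidHom.toIntLinearMap
      { toFun := fun n =>
          { toFun := fun m => tmul B A n m
            map_zero' := tmul_zero B A n
            map_add' := tmul_add B A n }
        map_zero' := by ext m; exact zero_tmul B A m
        map_add' := fun n n' => by ext m; exact add_tmul B A n n' m })
    (fun n a m => op_smul_tmul B A n a m)

lemma smul_mem_balancedRelations_int [SMulCommClass B Aᵐᵒᵖ N] (b : B) {x : N ⊗[ℤ] M}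
    (hx : x ∈ balancedRelations ℤ A N M) : b • x ∈ balancedRelations ℤ A N M := by
  induction hx using Submodule.span_induction with
  | mem x hx =>
    obtain ⟨n, a, m, rfl⟩ := hx
    refine Submodule.subset_span ⟨b • n, a, m, ?_⟩
    rw [smul_sub, TensorProduct.smul_tmul', TensorProduct.smul_tmul', smul_comm b]
  | zero => rw [smul_zero]; exact Submodule.zero_mem _
  | add x y _ _ hx hy => rw [smul_add]; exact Submodule.add_mem _ hx hy
  | smul c x _ hx => rw [smul_comm]; exact Submodule.smul_mem _ _ hx

/-- As the two actions on `N` commute, the additive span of the relations is already stable under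
`B`. -/
lemma mem_balancedRelations_int [SMulCommClass B Aᵐᵒᵖ N] {x : N ⊗[ℤ] M}
    (hx : x ∈ balancedRelations B A N M) : x ∈ balancedRelations ℤ A N M := by
  induction hx using Submodule.span_induction with
  | mem x hx => exact Submodule.subset_span hx
  | zero => exact Submodule.zero_mem _
  | add x y _ _ hx hy => exact Submodule.add_mem _ hx hy
  | smul b x _ hx => exact smul_mem_balancedRelations_int B A b hx

lemma ofInt_bijective [SMulCommClass B Aᵐᵒᵖ N] :
    Function.Bijective (ofInt B A : BalancedTensor ℤ A N M →ₗ[ℤ] BalancedTensor B A N M) := by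
  have key (x : N ⊗[ℤ] M) : ofInt B A (Submodule.Quotient.mk x) = Submodule.Quotient.mk x := by
    induction x using TensorProduct.induction_on with
    | zero => simp
    | tmul n m => rfl
    | add x y hx hy => rw [Submodule.Quotient.mk_add, map_add, hx, hy, Submodule.Quotient.mk_add]
  constructor
  · refine (injective_iff_map_eq_zero _).2 fun t ht => ?_
    obtain ⟨x, rfl⟩ := Submodule.Quotient.mk_surjective _ t
    rw [key, Submodule.Quotient.mk_eq_zero] at ht
    exact (Submodule.Quotient.mk_eq_zero _).2 (mem_balancedRelations_int B A ht)
  · intro t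
    obtain ⟨x, rfl⟩ := Submodule.Quotient.mk_surjective _ t
    exact ⟨Submodule.Quotient.mk x, key x⟩

lemma ofInt_map (f : N →ₗ[B] N')
    (hf : ∀ (a : A) (n : N), f (MulOpposite.op a • n) = MulOpposite.op a • f n)
    (g : M →ₗ[A] M') (t : BalancedTensor ℤ A N M) :
    ofInt B A (map ℤ A f.toAddMonoidHom.toIntLinearMap hf g t) = map B A f hf g (ofInt B A t) := by
  induction t using induction_on with
  | h0 => simp
  | htmul n m => rfl
  | hadd x y hx hy => simp only [map_add, hx, hy]

end

end BalancedTensor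

/-! ### Flat modules -/

namespace BalancedTensor

variable {A : Type u} [Ring A]

section

variable {N N' N'' : Type u} [AddCommGroup N] [Module Aᵐᵒᵖ N] [AddCommGroup N'] [Module Aᵐᵒᵖ N']
  [AddCommGroup N''] [Module Aᵐᵒᵖ N''] {M M' M'' : Type u} [AddCommGroup M] [Module A M]
  [AddCommGroup M'] [Module A M'] [AddCommGroup M''] [Module A M'']

/-- The map `f ⊗ M` for a map `f` of right modules. -/
abbrev mapL (f : N →ₗ[Aᵐᵒᵖ] N') (M : Type u) [AddCommGroup M] [Module A M] :
    BalancedTensor ℤ A N M →ₗ[ℤ] BalancedTensor ℤ A N' M :=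
  map ℤ A f.toAddMonoidHom.toIntLinearMap (fun a n => f.map_smul (MulOpposite.op a) n)
    (LinearMap.id : M →ₗ[A] M)

/-- The map `N ⊗ g` for a map `g` of left modules. -/
abbrev mapR (N : Type u) [AddCommGroup N] [Module Aᵐᵒᵖ N] (g : M →ₗ[A] M') :
    BalancedTensor ℤ A N M →ₗ[ℤ] BalancedTensor ℤ A N M' :=
  map ℤ A LinearMap.id (fun _ _ => rfl) g

lemma mapL_exact_of_surjective {f : N →ₗ[Aᵐᵒᵖ] N'} {g : N' →ₗ[Aᵐᵒᵖ] N''}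
    (h : Function.Exact f g) (hs : Function.Surjective g) (t : BalancedTensor ℤ A N' M)
    (ht : mapL g M t = 0) : ∃ s, mapL f M s = t :=
  exists_map_eq_of_exact_left (B := ℤ) (f := f.toAddMonoidHom.toIntLinearMap)
    (fun a n => f.map_smul (MulOpposite.op a) n) (g := g.toAddMonoidHom.toIntLinearMap)
    (fun a n => g.map_smul (MulOpposite.op a) n) (fun n => (h n).1) hs h.apply_apply_eq_zero t ht

lemma mapR_exact_of_surjective {f : M →ₗ[A] M'} {g : M' →ₗ[A] M''}
    (h : Function.Exact f g) (hs : Function.Surjective g) (t : BalancedTensor ℤ A N M')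
    (ht : mapR N g t = 0) : ∃ s, mapR N f s = t :=
  exists_map_eq_of_exact_right (fun n => (h n).1) hs h.apply_apply_eq_zero t ht

lemma mapL_mapL (f : N →ₗ[Aᵐᵒᵖ] N') (g : N' →ₗ[Aᵐᵒᵖ] N'') (t : BalancedTensor ℤ A N M) :
    mapL g M (mapL f M t) = mapL (g ∘ₗ f) M t := map_map ..

lemma mapR_mapR (f : M →ₗ[A] M') (g : M' →ₗ[A] M'') (t : BalancedTensor ℤ A N M) :
    mapR N g (mapR N f t) = mapR N (g ∘ₗ f) t := map_map ..

lemma mapL_mapR (f : N →ₗ[Aᵐᵒᵖ] N') (g : M →ₗ[A] M') (t : BalancedTensor ℤ A N M) :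
    mapL f M' (mapR N g t) = mapR N' g (mapL f M t) := by
  induction t using induction_on with
  | h0 => simp only [map_zero]
  | htmul n m => rfl
  | hadd x y hx hy => simp only [map_add, hx, hy]

end

end BalancedTensor

open BalancedTensor

section Flat

variable {A : Type u} [Ring A]

lemma IsFlat.mapL_injective {M : ModuleCat.{u} A} (hM : IsFlat M) {N N' : Type u}
    [AddCommGroup N] [AddCommGroup N'] [Module Aᵐᵒᵖ N] [Module Aᵐᵒᵖ N'] {f : N →ₗ[Aᵐᵒᵖ] N'}
    (hf : Function.Injective f) : Function.Injective (mapL f M) := hM N N' f hf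

/-- Factor `g` through its image: right exactness handles the surjection, flatness the inclusion. -/
lemma IsFlat.mapL_exact {M : ModuleCat.{u} A} (hM : IsFlat M) {N N' N'' : Type u}
    [AddCommGroup N] [AddCommGroup N'] [AddCommGroup N''] [Module Aᵐᵒᵖ N] [Module Aᵐᵒᵖ N']
    [Module Aᵐᵒᵖ N''] {f : N →ₗ[Aᵐᵒᵖ] N'} {g : N' →ₗ[Aᵐᵒᵖ] N''} (h : Function.Exact f g)
    (t : BalancedTensor ℤ A N' M) (ht : mapL g M t = 0) : ∃ s, mapL f M s = t := by
  refine mapL_exact_of_surjective (g := g.rangeRestrict)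
    (fun n => by rw [← h n]; simp [Subtype.ext_iff]) g.surjective_rangeRestrict t ?_
  refine hM.mapL_injective (f := (LinearMap.range g).subtype) Subtype.val_injective ?_
  rw [map_zero, mapL_mapL]
  exact ht

/-- The coordinates of an element of `N ⊗_A M`, for an additive balanced family of maps. -/
def coordsOfSection {M : ModuleCat.{u} A} (s : M →ₗ[A] (M →₀ A)) (N : Type u) [AddCommGroup N]
    [Module Aᵐᵒᵖ N] : BalancedTensor ℤ A N M →ₗ[ℤ] (M →₀ N) :=
  lift ℤ A
    (AddMonoidHom.toIntLinearMap
      { toFun := fun n =>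
          { toFun := fun m => (s m).mapRange (fun a => MulOpposite.op a • n) (by simp)
            map_zero' := by ext; simp
            map_add' := fun m m' => by ext; simp [add_smul] }
        map_zero' := by ext; simp
        map_add' := fun n n' => by ext; simp })
    (fun n a m => by ext; simp [mul_smul])

lemma coordsOfSection_tmul {M : ModuleCat.{u} A} (s : M →ₗ[A] (M →₀ A)) (N : Type u)
    [AddCommGroup N] [Module Aᵐᵒᵖ N] (n : N) (m x : M) :
    coordsOfSection s N (tmul ℤ A n m) x = MulOpposite.op (s m x) • n := rfl

/-- A section `s` of the canonical surjection from a free module gives coordinates embedding `N ⊗_A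
P` into the finitely supported functions `P →₀ N`, naturally in `N`; there injectivity is checked
coordinatewise. -/
lemma isFlat_of_projective (P : ModuleCat.{u} A) [Projective P] : IsFlat P := by
  have : Module.Projective A P := (IsProjective.iff_projective P).2 inferInstance
  obtain ⟨s, hs⟩ := this.out
  have hinj (N : Type u) [AddCommGroup N] [Module Aᵐᵒᵖ N] :
      Function.Injective (coordsOfSection s N) := by
    have key (t : BalancedTensor ℤ A N P) :
        (coordsOfSection s N t).sum (fun x n => tmul ℤ A n x) = t := by
      induction t using BalancedTensor.induction_on with
      | h0 => simp
      | htmul n m =>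
        have h1 : coordsOfSection s N (tmul ℤ A n m) =
          (s m).mapRange (fun a => MulOpposite.op a • n) (by simp) := rfl
        rw [h1, Finsupp.sum_mapRange_index (h := fun x n => tmul ℤ A n x) (fun x => zero_tmul ..)]
        conv_rhs => rw [← hs m, Finsupp.linearCombination_apply, Finsupp.sum]
        let T : P →+ BalancedTensor ℤ A N P :=
          { toFun := fun m => tmul ℤ A n m, map_zero' := tmul_zero ..
            map_add' := fun _ _ => tmul_add .. }
        change _ = T _
        rw [map_sum, Finsupp.sum]
        exact Finset.sum_congr rfl fun x _ => op_smul_tmul ..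
      | hadd x y hx hy =>
        rw [map_add, Finsupp.sum_add_index' (h := fun x n => tmul ℤ A n x) (fun _ => zero_tmul ..)
          (fun _ _ _ => add_tmul ..), hx, hy]
    exact fun x y h => by rw [← key x, h, key y]
  intro N N' _ _ _ _ f hf
  have hcomm (t : BalancedTensor ℤ A N P) : coordsOfSection s N' (mapL f P t) =
      (coordsOfSection s N t).mapRange f (map_zero f) := by
    induction t using BalancedTensor.induction_on with
    | h0 => simp
    | htmul n m =>
      ext x
      rw [Finsupp.mapRange_apply, coordsOfSection_tmul, map_smul]
      rfl
    | hadd x y hx hy => rw [map_add, map_add, map_add, hx, hy, Finsupp.mapRange_add (map_add f)]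
  intro x y hxy
  refine hinj N (Finsupp.mapRange_injective f (map_zero f) hf ?_)
  rw [← hcomm, ← hcomm]
  exact congrArg _ hxy

/-- The coordinates of an element of `P ⊗_A M`, for the free right module `P` on `N`. -/
def coordsOfFree (N : Type u) (M : Type u) [AddCommGroup M] [Module A M] :
    BalancedTensor ℤ A (N →₀ Aᵐᵒᵖ) M →ₗ[ℤ] (N →₀ M) :=
  lift ℤ A
    (AddMonoidHom.toIntLinearMap
      { toFun := fun n =>
          { toFun := fun m => n.mapRange (fun a => a.unop • m) (by simp)
            map_zero' := by ext; simp
            map_add' := fun m m' => by ext; simp }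
        map_zero' := by ext; simp
        map_add' := fun n n' => by ext; simp [add_smul] })
    (fun n a m => by ext; simp [mul_smul])

lemma coordsOfFree_injective (N : Type u) (M : Type u) [AddCommGroup M] [Module A M] :
    Function.Injective (coordsOfFree (A := A) N M) := by
  have key (t : BalancedTensor ℤ A (N →₀ Aᵐᵒᵖ) M) :
      (coordsOfFree N M t).sum (fun x m => tmul ℤ A (Finsupp.single x 1) m) = t := by
    induction t using BalancedTensor.induction_on with
    | h0 => simp
    | htmul n m =>
      have h1 : coordsOfFree N M (tmul ℤ A n m) =
        n.mapRange (fun a => a.unop • m) (by simp) := rfl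
      rw [h1, Finsupp.sum_mapRange_index (h := fun x m => tmul ℤ A (Finsupp.single x 1) m)
        (fun x => tmul_zero ..)]
      conv_rhs => rw [← Finsupp.sum_single n, Finsupp.sum]
      let T : (N →₀ Aᵐᵒᵖ) →+ BalancedTensor ℤ A (N →₀ Aᵐᵒᵖ) M :=
        { toFun := fun n => tmul ℤ A n m, map_zero' := zero_tmul ..
          map_add' := fun _ _ => add_tmul .. }
      change _ = T _
      rw [map_sum, Finsupp.sum]
      refine Finset.sum_congr rfl fun x _ => ?_
      rw [← op_smul_tmul]
      simp [T]
    | hadd x y hx hy =>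
      rw [map_add, Finsupp.sum_add_index' (h := fun x m => tmul ℤ A (Finsupp.single x 1) m)
        (fun _ => tmul_zero ..) (fun _ _ _ => tmul_add ..), hx, hy]
  exact fun x y h => by rw [← key x, h, key y]

lemma mapR_injective_of_free (N : Type u) {M M' : Type u} [AddCommGroup M] [Module A M]
    [AddCommGroup M'] [Module A M'] {g : M →ₗ[A] M'} (hg : Function.Injective g) :
    Function.Injective (mapR (N →₀ Aᵐᵒᵖ) g) := by
  have hcomm (t : BalancedTensor ℤ A (N →₀ Aᵐᵒᵖ) M) :
      coordsOfFree N M' (mapR _ g t) = (coordsOfFree N M t).mapRange g (map_zero g) := by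
    induction t using BalancedTensor.induction_on with
    | h0 => simp
    | htmul n m => ext x; exact (map_smul g _ _).symm
    | hadd x y hx hy => rw [map_add, map_add, map_add, hx, hy, Finsupp.mapRange_add (map_add g)]
  intro x y hxy
  refine coordsOfFree_injective N M (Finsupp.mapRange_injective g (map_zero g) hg ?_)
  rw [← hcomm, ← hcomm, hxy]

lemma mapR_zero {N M M' : Type u} [AddCommGroup N] [Module Aᵐᵒᵖ N] [AddCommGroup M] [Module A M]
    [AddCommGroup M'] [Module A M'] (t : BalancedTensor ℤ A N M) :
    mapR N (0 : M →ₗ[A] M') t = 0 := by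
  induction t using BalancedTensor.induction_on with
  | h0 => rw [map_zero]
  | htmul n m => exact tmul_zero ..
  | hadd x y hx hy => rw [map_add, hx, hy, add_zero]

lemma mapL_zero {N N' M : Type u} [AddCommGroup N] [Module Aᵐᵒᵖ N] [AddCommGroup N']
    [Module Aᵐᵒᵖ N'] [AddCommGroup M] [Module A M] (t : BalancedTensor ℤ A N M) :
    mapL (0 : N →ₗ[Aᵐᵒᵖ] N') M t = 0 := by
  induction t using BalancedTensor.induction_on with
  | h0 => rw [map_zero]
  | htmul n m => exact zero_tmul ..
  | hadd x y hx hy => rw [map_add, hx, hy, add_zero]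

lemma mapL_surjective {N N' M : Type u} [AddCommGroup N] [Module Aᵐᵒᵖ N] [AddCommGroup N']
    [Module Aᵐᵒᵖ N'] [AddCommGroup M] [Module A M] {f : N →ₗ[Aᵐᵒᵖ] N'}
    (hf : Function.Surjective f) : Function.Surjective (mapL f M) :=
  map_surjective (f := f.toAddMonoidHom.toIntLinearMap) (g := (LinearMap.id : M →ₗ[A] M)) hf
    Function.surjective_id

/-- This is the symmetry of `Tor₁(N, F) = 0`, as a diagram chase: lift an element of the kernel to
`P ⊗ K`; its image in `P ⊗ X` comes from `R ⊗ X`. -/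
lemma IsFlat.mapR_injective_of_presentation {F : ModuleCat.{u} A} (hF : IsFlat F)
    {R P N : Type u} [AddCommGroup N] [Module Aᵐᵒᵖ N] [AddCommGroup P] [Module Aᵐᵒᵖ P]
    [AddCommGroup R] [Module Aᵐᵒᵖ R] {j : R →ₗ[Aᵐᵒᵖ] P} {π : P →ₗ[Aᵐᵒᵖ] N}
    (hj : Function.Injective j) (hjπ : Function.Exact j π) (hπ : Function.Surjective π)
    {K X : Type u} [AddCommGroup K] [Module A K] [AddCommGroup X] [Module A X]
    {i : K →ₗ[A] X} {p : X →ₗ[A] F} (hi : Function.Injective (mapR P i))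
    (hip : Function.Exact i p) (hp : Function.Surjective p) :
    Function.Injective (mapR N i) := by
  refine (injective_iff_map_eq_zero _).2 fun t ht => ?_
  obtain ⟨t', rfl⟩ := mapL_surjective hπ t
  rw [← mapL_mapR] at ht
  obtain ⟨r, hr⟩ := mapL_exact_of_surjective hjπ hπ _ ht
  -- Flatness of `F` enters here: `R ⊗ F` embeds into `P ⊗ F`, so `r` comes from `R ⊗ K`.
  have hr0 : mapR _ p r = 0 := by
    refine hF.mapL_injective hj ?_
    rw [mapL_mapR, hr, mapR_mapR, map_zero,
      show p ∘ₗ i = 0 from LinearMap.ext hip.apply_apply_eq_zero, mapR_zero]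
  obtain ⟨r', rfl⟩ := mapR_exact_of_surjective hip hp r hr0
  rw [mapL_mapR] at hr
  rw [← hi hr, mapL_mapL, show π ∘ₗ j = 0 from LinearMap.ext hjπ.apply_apply_eq_zero, mapL_zero]

/-- Tensor products preserve short exact sequences ending with a flat module. -/
lemma IsFlat.mapR_injective {F : ModuleCat.{u} A} (hF : IsFlat F) (N : Type u) [AddCommGroup N]
    [Module Aᵐᵒᵖ N] {K X : Type u} [AddCommGroup K] [Module A K] [AddCommGroup X] [Module A X]
    {i : K →ₗ[A] X} {p : X →ₗ[A] F} (hi : Function.Injective i) (hip : Function.Exact i p)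
    (hp : Function.Surjective p) : Function.Injective (mapR N i) := by
  obtain ⟨π, hπ⟩ : ∃ π : (N →₀ Aᵐᵒᵖ) →ₗ[Aᵐᵒᵖ] N, Function.Surjective π :=
    ⟨Finsupp.linearCombination _ id, Finsupp.linearCombination_id_surjective _ _⟩
  obtain ⟨R, _, _, j, hj, hjπ⟩ : ∃ (R : Type u) (_ : AddCommGroup R) (_ : Module Aᵐᵒᵖ R)
      (j : R →ₗ[Aᵐᵒᵖ] (N →₀ Aᵐᵒᵖ)), Function.Injective j ∧ Function.Exact j π :=
    ⟨LinearMap.ker π, inferInstance, inferInstance, (LinearMap.ker π).subtype,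
      Subtype.val_injective, LinearMap.exact_subtype_ker_map π⟩
  exact hF.mapR_injective_of_presentation hj hjπ hπ (mapR_injective_of_free N hi) hip hp

/-- Since `F` is flat, `- ⊗ K` embeds into `- ⊗ X`, and `X` is flat. Thus syzygies of flat modules
are flat. -/
lemma IsFlat.of_exact {K X F : ModuleCat.{u} A} (hX : IsFlat X) (hF : IsFlat F)
    {i : K →ₗ[A] X} {p : X →ₗ[A] F} (hi : Function.Injective i) (hip : Function.Exact i p)
    (hp : Function.Surjective p) : IsFlat K := by
  intro N N' _ _ _ _ f hf
  have h : Function.Injective (mapR N' i ∘ mapL f K) := by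
    have : mapR N' i ∘ mapL f K = mapL f X ∘ mapR N i := funext fun t => (mapL_mapR f i t).symm
    rw [this]
    exact (hX.mapL_injective hf).comp (hF.mapR_injective N hi hip hp)
  exact h.of_comp

end Flat

section Curry

variable {k : Type v} [Field k] {A B : Type u} [Ring A] [Ring B] [Algebra k A] [Algebra k B]

attribute [local instance] leftAction rightAction

instance (N : ModuleCat.{u} (B ⊗[k] Aᵐᵒᵖ)) : SMulCommClass B Aᵐᵒᵖ N where
  smul_comm b a x := by
    change ((b ⊗ₜ[k] (1 : Aᵐᵒᵖ) : B ⊗[k] Aᵐᵒᵖ) • (((1 : B) ⊗ₜ[k] a : B ⊗[k] Aᵐᵒᵖ) • x : N) : N) =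
      (((1 : B) ⊗ₜ[k] a : B ⊗[k] Aᵐᵒᵖ) • ((b ⊗ₜ[k] (1 : Aᵐᵒᵖ) : B ⊗[k] Aᵐᵒᵖ) • x : N) : N)
    rw [smul_smul, smul_smul]
    simp

variable {N N' : ModuleCat.{u} (B ⊗[k] Aᵐᵒᵖ)} {M M' : ModuleCat.{u} A} {P P' : ModuleCat.{u} B}

/-- The pure tensor `y ⊗ x` as an element of the value of `tensorFunctor`. -/
def pureTensor (y : N) (x : M) : (((tensorFunctor k A B).obj N).obj M : Type u) :=
  tmul B A y x

/-- The map `y ↦ f (y ⊗ x)`. -/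
def curryAt (f : ((tensorFunctor k A B).obj N).obj M ⟶ P) (x : M) :
    (resLeft k B Aᵐᵒᵖ).obj N ⟶ P :=
  ModuleCat.ofHom (X := (resLeft k B Aᵐᵒᵖ).obj N)
    { toFun := fun (y : N) => f.hom (pureTensor y x)
      map_add' := fun (y y' : N) =>
        (congrArg f.hom (add_tmul B A y y' x)).trans (map_add f.hom _ _)
      map_smul' := fun b (y : N) => map_smul f.hom b (pureTensor y x) }

lemma curryAt_add (f : ((tensorFunctor k A B).obj N).obj M ⟶ P) (x x' : M) :
    curryAt f (x + x') = curryAt f x + curryAt f x' := by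
  ext (y : N)
  exact (congrArg f.hom (tmul_add B A y x x')).trans (map_add f.hom _ _)

lemma curryAt_smul (f : ((tensorFunctor k A B).obj N).obj M ⟶ P) (a : A) (x : M) :
    curryAt f (a • x) = (actNat k B Aᵐᵒᵖ (MulOpposite.op a)).app N ≫ curryAt f x := by
  ext (y : N)
  exact congrArg f.hom (op_smul_tmul B A y a x).symm

lemma add_curryAt (f g : ((tensorFunctor k A B).obj N).obj M ⟶ P) (x : M) :
    curryAt (f + g) x = curryAt f x + curryAt g x := rfl

lemma zero_curryAt (x : M) :
    curryAt (0 : ((tensorFunctor k A B).obj N).obj M ⟶ P) x = 0 := rfl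

lemma units_smul_curryAt (c : ℤˣ) (f : ((tensorFunctor k A B).obj N).obj M ⟶ P) (x : M) :
    curryAt (c • f) x = c • curryAt f x := by
  obtain rfl | rfl := Int.units_eq_one_or c
  · rw [one_smul, one_smul]
  · rw [Units.neg_smul, Units.neg_smul, one_smul, one_smul]; rfl

lemma curryAt_comp (f : ((tensorFunctor k A B).obj N).obj M ⟶ P) (g : P ⟶ P') (x : M) :
    curryAt (f ≫ g) x = curryAt f x ≫ g := rfl

lemma curryAt_map_app (h : N' ⟶ N) (f : ((tensorFunctor k A B).obj N).obj M ⟶ P) (x : M) :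
    curryAt (((tensorFunctor k A B).map h).app M ≫ f) x =
      (resLeft k B Aᵐᵒᵖ).map h ≫ curryAt f x := rfl

lemma curryAt_obj_map (g : M' ⟶ M) (f : ((tensorFunctor k A B).obj N).obj M ⟶ P) (x : M') :
    curryAt (((tensorFunctor k A B).obj N).map g ≫ f) x = curryAt f (g.hom x) := rfl

lemma tensor_hom_ext {f g : ((tensorFunctor k A B).obj N).obj M ⟶ P}
    (h : ∀ x, curryAt f x = curryAt g x) : f = g := by
  ext1
  exact BalancedTensor.hom_ext fun y x => congrArg (fun φ => φ.hom y) (h x)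

/-- The map `N ⊗_A M ⟶ P` defined by a family of maps `N ⟶ P` which is linear in `M`. -/
def uncurry (φ : M → ((resLeft k B Aᵐᵒᵖ).obj N ⟶ P)) (hadd : ∀ x x', φ (x + x') = φ x + φ x')
    (hsmul : ∀ (a : A) x, φ (a • x) =
      (actNat k B Aᵐᵒᵖ (MulOpposite.op a)).app N ≫ φ x) :
    ((tensorFunctor k A B).obj N).obj M ⟶ P :=
  ModuleCat.ofHom (lift B A
    { toFun := fun (y : N) => AddMonoidHom.mk' (fun x => (φ x).hom y) fun x x' => by
        rw [hadd]; rfl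
      map_add' := fun y y' => by ext x; exact (φ x).hom.map_add y y'
      map_smul' := fun b y => by ext x; exact (φ x).hom.map_smul b y }
    (fun y a x => by
      change (φ x).hom _ = (φ (a • x)).hom _
      rw [hsmul]; rfl))

lemma curryAt_uncurry (φ : M → ((resLeft k B Aᵐᵒᵖ).obj N ⟶ P))
    (hadd : ∀ x x', φ (x + x') = φ x + φ x')
    (hsmul : ∀ (a : A) x, φ (a • x) =
      (actNat k B Aᵐᵒᵖ (MulOpposite.op a)).app N ≫ φ x) (x : M) :
    curryAt (uncurry φ hadd hsmul) x = φ x := rfl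

end Curry

/-! ### The complex of left `A`-modules `Hom_B(X, J)` -/

section HomComplex

variable {k : Type v} [Field k] {A B : Type u} [Ring A] [Ring B] [Algebra k A] [Algebra k B]

/-- The degree `n` part of `Hom_B(X, J)`, where `X` is a complex of `B`-left-`A`-right-modules. -/
def HomCochain (X : CochainComplex (ModuleCat.{u} (B ⊗[k] Aᵐᵒᵖ)) ℤ)
    (J : CochainComplex (ModuleCat.{u} B) ℤ) (n : ℤ) : Type u :=
  Cochain (resLeftComplex k B Aᵐᵒᵖ X) J n

namespace HomCochain

variable {X X' : CochainComplex (ModuleCat.{u} (B ⊗[k] Aᵐᵒᵖ)) ℤ}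
  {J : CochainComplex (ModuleCat.{u} B) ℤ} {n : ℤ}

instance : AddCommGroup (HomCochain X J n) :=
  inferInstanceAs (AddCommGroup (Cochain (resLeftComplex k B Aᵐᵒᵖ X) J n))

/-- The component `X^p ⟶ J^q`. -/
def v (z : HomCochain X J n) (p q : ℤ) (hpq : p + n = q) :
    (resLeft k B Aᵐᵒᵖ).obj (X.X p) ⟶ J.X q := Cochain.v z p q hpq

/-- The element of `Hom_B(X, J)` with given components. -/
def mk (f : ∀ (p q : ℤ), p + n = q → ((resLeft k B Aᵐᵒᵖ).obj (X.X p) ⟶ J.X q)) :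
    HomCochain X J n := Cochain.mk f

lemma mk_v (f : ∀ (p q : ℤ), p + n = q → ((resLeft k B Aᵐᵒᵖ).obj (X.X p) ⟶ J.X q))
    (p q : ℤ) (hpq : p + n = q) : (mk f).v p q hpq = f p q hpq := rfl

@[ext]
lemma ext {z z' : HomCochain X J n} (h : ∀ p q hpq, z.v p q hpq = z'.v p q hpq) : z = z' :=
  Cochain.ext _ _ h

lemma add_v (z z' : HomCochain X J n) (p q : ℤ) (hpq : p + n = q) :
    (z + z').v p q hpq = z.v p q hpq + z'.v p q hpq := rfl

lemma zero_v (p q : ℤ) (hpq : p + n = q) : (0 : HomCochain X J n).v p q hpq = 0 := rfl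

instance : SMul A (HomCochain X J n) where
  smul a z := Cochain.comp (Cochain.ofHom (actHom k B Aᵐᵒᵖ X (MulOpposite.op a))) z (zero_add n)

lemma smul_v (a : A) (z : HomCochain X J n) (p q : ℤ) (hpq : p + n = q) :
    (a • z).v p q hpq = (actNat k B Aᵐᵒᵖ (MulOpposite.op a)).app (X.X p) ≫ z.v p q hpq :=
  Cochain.zero_cochain_comp_v _ _ _ _ _

instance : Module A (HomCochain X J n) where
  one_smul z := by
    ext1 p q h; rw [smul_v, MulOpposite.op_one, actNat_one_app, Category.id_comp]
  mul_smul s t z := by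
    ext1 p q h
    rw [smul_v, smul_v, smul_v, MulOpposite.op_mul, actNat_mul_app, Category.assoc]
  smul_zero s := by ext1 p q h; rw [smul_v, zero_v, comp_zero]
  smul_add s z z' := by
    ext1 p q h; rw [smul_v, add_v, add_v, smul_v, smul_v, Preadditive.comp_add]
  add_smul s t z := by
    ext1 p q h
    rw [smul_v, add_v, smul_v, smul_v, MulOpposite.op_add, actNat_add_app, Preadditive.add_comp]
  zero_smul z := by
    ext1 p q h
    rw [smul_v, zero_v, MulOpposite.op_zero, EndCochain.actNat_zero_app, zero_comp]

/-- The differential of `Hom_B(X, J)`. -/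
def diff (X : CochainComplex (ModuleCat.{u} (B ⊗[k] Aᵐᵒᵖ)) ℤ)
    (J : CochainComplex (ModuleCat.{u} B) ℤ) (n m : ℤ) : HomCochain X J n →ₗ[A] HomCochain X J m where
  toFun z := δ n m z
  map_add' _ _ := δ_add _ _ _ _
  map_smul' _ _ := δ_ofHom_comp _ _ _

end HomCochain

/-- The complex of left `A`-modules `Hom_B(X, J)`. -/
def homComplex (X : CochainComplex (ModuleCat.{u} (B ⊗[k] Aᵐᵒᵖ)) ℤ)
    (J : CochainComplex (ModuleCat.{u} B) ℤ) : CochainComplex (ModuleCat.{u} A) ℤ where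
  X n := ModuleCat.of A (HomCochain X J n)
  d n m := ModuleCat.ofHom (HomCochain.diff X J n m)
  shape n m h := by
    refine ModuleCat.hom_ext (LinearMap.ext fun z => ?_)
    exact δ_shape n m h (z : Cochain (resLeftComplex k B Aᵐᵒᵖ X) J n)
  d_comp_d' n m l _ _ := by
    refine ModuleCat.hom_ext (LinearMap.ext fun z => ?_)
    exact δ_δ n m l (z : Cochain (resLeftComplex k B Aᵐᵒᵖ X) J n)

lemma homComplex_d_v {X : CochainComplex (ModuleCat.{u} (B ⊗[k] Aᵐᵒᵖ)) ℤ}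
    {J : CochainComplex (ModuleCat.{u} B) ℤ} {r s : ℤ} (hrs : r + 1 = s)
    (w : (homComplex X J).X r) (p p' p₁ p₂ : ℤ) (hp : p + s = p') (hp₁ : p₁ = p' - 1)
    (hp₂ : p + 1 = p₂) :
    HomCochain.v (((homComplex X J).d r s).hom w) p p' hp =
      HomCochain.v w p p₁ (by lia) ≫ J.d p₁ p' +
        s.negOnePow • (resLeft k B Aᵐᵒᵖ).map (X.d p p₂) ≫ HomCochain.v w p₂ p' (by lia) :=
  δ_v r s hrs (F := resLeftComplex k B Aᵐᵒᵖ X) (G := J) w p p' hp p₁ p₂ hp₁ hp₂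

/-- Precomposition with a morphism of complexes. -/
def homComplexMap {X X' : CochainComplex (ModuleCat.{u} (B ⊗[k] Aᵐᵒᵖ)) ℤ} (s : X' ⟶ X)
    (J : CochainComplex (ModuleCat.{u} B) ℤ) : homComplex X J ⟶ homComplex X' J where
  f n := ModuleCat.ofHom (X := HomCochain X J n) (Y := HomCochain X' J n)
    { toFun := fun z =>
        (Cochain.ofHom (((resLeft k B Aᵐᵒᵖ).mapHomologicalComplex _).map s)).comp z (zero_add n)
      map_add' := fun z z' => Cochain.comp_add _ _ _ _
      map_smul' := fun a z => by
        have h : ((resLeft k B Aᵐᵒᵖ).mapHomologicalComplex _).map s ≫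
            actHom k B Aᵐᵒᵖ X (MulOpposite.op a) = actHom k B Aᵐᵒᵖ X' (MulOpposite.op a) ≫
              ((resLeft k B Aᵐᵒᵖ).mapHomologicalComplex _).map s :=
          (NatTrans.mapHomologicalComplex (actNat k B Aᵐᵒᵖ (MulOpposite.op a)) _).naturality s
        refine (Cochain.comp_assoc_of_first_is_zero_cochain _ _ _ _).symm.trans ?_
        rw [← Cochain.ofHom_comp, h, Cochain.ofHom_comp]
        exact Cochain.comp_assoc_of_first_is_zero_cochain _ _ _ _ }
  comm' n m _ := by
    refine ModuleCat.hom_ext (LinearMap.ext fun z => ?_)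
    exact δ_ofHom_comp _ (z : Cochain (resLeftComplex k B Aᵐᵒᵖ X) J n) _

end HomComplex

/-! ### The adjunction between tensor products and homomorphisms -/

section Adjunction

variable {k : Type v} [Field k] {A B : Type u} [Ring A] [Ring B] [Algebra k A] [Algebra k B]
  (X : CochainComplex (ModuleCat.{u} (B ⊗[k] Aᵐᵒᵖ)) ℤ) (Q : CochainComplex (ModuleCat.{u} A) ℤ)
  (J : CochainComplex (ModuleCat.{u} B) ℤ)

/-- The total tensor product `X ⊗_A Q`. -/
abbrev totalTensor : CochainComplex (ModuleCat.{u} B) ℤ :=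
  HomologicalComplex.mapBifunctor X Q (tensorFunctor k A B) (ComplexShape.up ℤ)

/-- The inclusion of the summand `X^p ⊗_A Q^q`. -/
abbrev ιTensor (p q j : ℤ) (h : p + q = j) :
    ((tensorFunctor k A B).obj (X.X p)).obj (Q.X q) ⟶ (totalTensor X Q).X j :=
  HomologicalComplex.ιMapBifunctor X Q (tensorFunctor k A B) (ComplexShape.up ℤ) p q j h

lemma ιTensor_d (p q j j' p' q' : ℤ) (h : p + q = j) (hj : j + 1 = j') (hp : p + 1 = p')
    (hq : q + 1 = q') :
    ιTensor X Q p q j h ≫ (totalTensor X Q).d j j' =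
      ((tensorFunctor k A B).map (X.d p p')).app (Q.X q) ≫ ιTensor X Q p' q j' (by lia) +
      p.negOnePow • (((tensorFunctor k A B).obj (X.X p)).map (Q.d q q') ≫
        ιTensor X Q p q' j' (by lia)) := by
  rw [HomologicalComplex.mapBifunctor.d_eq, Preadditive.comp_add,
    HomologicalComplex.mapBifunctor.ι_D₁, HomologicalComplex.mapBifunctor.ι_D₂,
    HomologicalComplex.mapBifunctor.d₁_eq _ _ _ _ hp q j' (by change p' + q = j'; lia),
    HomologicalComplex.mapBifunctor.d₂_eq _ _ _ _ p hq j' (by change p + q' = j'; lia)]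
  simp [ComplexShape.ε_up_ℤ]

variable {X Q J}

/-- The map on cochains corresponding to the adjunction between `X ⊗_A -` and `Hom_B(X, -)`. -/
def curryCochain {n : ℤ} (z : Cochain (totalTensor X Q) J n) : Cochain Q (homComplex X J) n :=
  Cochain.mk fun q r hqr => ModuleCat.ofHom (Y := HomCochain X J r)
    { toFun := fun x => HomCochain.mk fun p p' hpp' =>
        -- The Koszul sign `(-1)^(pq)` makes currying commute with the differentials.
        (p * q).negOnePow • curryAt (ιTensor X Q p q (p + q) rfl ≫ z.v (p + q) p' (by lia)) x
      map_add' := fun x x' => by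
        refine HomCochain.ext fun p p' h => ?_
        rw [HomCochain.add_v, HomCochain.mk_v, HomCochain.mk_v, HomCochain.mk_v, curryAt_add,
          smul_add]
      map_smul' := fun a x => by
        refine HomCochain.ext fun p p' h => ?_
        rw [RingHom.id_apply, HomCochain.smul_v, HomCochain.mk_v, HomCochain.mk_v, curryAt_smul,
          Linear.comp_units_smul] }

lemma curryCochain_v {n : ℤ} (z : Cochain (totalTensor X Q) J n) (q r : ℤ) (hqr : q + n = r)
    (x : Q.X q) (p p' j : ℤ) (h : p + r = p') (hj : p + q = j) :
    HomCochain.v (((curryCochain z).v q r hqr).hom x) p p' h =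
      (p * q).negOnePow • curryAt (ιTensor X Q p q j hj ≫ z.v j p' (by lia)) x := by
  subst hj
  rfl

lemma hom_cochain_ext {n : ℤ} {c c' : Cochain Q (homComplex X J) n}
    (h : ∀ (q r : ℤ) (hqr : q + n = r) (x : Q.X q) (p p' : ℤ) (hp : p + r = p'),
      HomCochain.v ((c.v q r hqr).hom x) p p' hp = HomCochain.v ((c'.v q r hqr).hom x) p p' hp) :
    c = c' := by
  refine Cochain.ext _ _ fun q r hqr => ModuleCat.hom_ext (LinearMap.ext fun x => ?_)
  exact HomCochain.ext fun p p' hp => h q r hqr x p p' hp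

lemma curryCochain_injective {n : ℤ} :
    Function.Injective (curryCochain : Cochain (totalTensor X Q) J n → _) := fun z z' h => by
  refine Cochain.ext _ _ fun j j' hj => ?_
  refine HomologicalComplex.mapBifunctor.hom_ext fun p q (hpq : p + q = j) => ?_
  refine tensor_hom_ext fun x => ?_
  have := congrArg (fun c : Cochain Q (homComplex X J) n =>
    HomCochain.v ((c.v q (q + n) rfl).hom x) p j' (by lia)) h
  simp only [curryCochain_v _ _ _ _ _ _ _ j _ hpq] at this
  exact smul_left_cancel _ this

lemma curryCochain_surjective {n : ℤ} :
    Function.Surjective (curryCochain : Cochain (totalTensor X Q) J n → _) := fun c => by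
  refine ⟨Cochain.mk fun j j' hj => HomologicalComplex.mapBifunctorDesc
    fun p q (hpq : p + q = j) => (p * q).negOnePow •
      uncurry (fun x => HomCochain.v ((c.v q (q + n) rfl).hom x) p j' (by lia))
        (fun x x' => by rw [map_add]; rfl)
        (fun a x => by rw [map_smul]; exact HomCochain.smul_v _ _ _ _ _), ?_⟩
  refine hom_cochain_ext fun q r hqr x p p' hp => ?_
  subst hqr
  rw [curryCochain_v _ _ _ _ _ _ _ _ _ rfl, Cochain.mk_v]
  rw [HomologicalComplex.ι_mapBifunctorDesc, units_smul_curryAt, curryAt_uncurry, smul_smul,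
    Int.units_mul_self, one_smul]

/-- Both sides consist of a term each for the differentials of `J`, `X` and `Q`; only the signs need
comparing, using `r = q + m` and `(-1)^(2q) = 1`. -/
lemma δ_curryCochain {n m : ℤ} (hnm : n + 1 = m) (z : Cochain (totalTensor X Q) J n) :
    δ n m (curryCochain z) = curryCochain (δ n m z) := by
  refine hom_cochain_ext fun q r hqr x p p' hp => ?_
  rw [curryCochain_v _ _ _ _ _ _ _ _ _ rfl, δ_v n m hnm _ q r hqr (r - 1) (q + 1) (by lia) rfl,
    δ_v n m hnm _ (p + q) p' (by lia) (p' - 1) (p + q + 1) (by lia) rfl]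
  change HomCochain.v (((homComplex X J).d (r - 1) r).hom
      (((curryCochain z).v q (r - 1) (by lia)).hom x)) p p' hp +
    m.negOnePow • HomCochain.v (((curryCochain z).v (q + 1) r (by lia)).hom
      ((Q.d q (q + 1)).hom x)) p p' hp = _
  rw [homComplex_d_v (by lia) _ p p' (p' - 1) (p + 1) hp rfl rfl,
    curryCochain_v _ _ _ _ _ _ _ (p + q) _ rfl,
    curryCochain_v _ _ _ _ _ _ _ (p + q + 1) _ (by lia),
    curryCochain_v _ _ _ _ _ _ _ (p + q + 1) _ (by lia)]
  have h : ιTensor X Q p q (p + q) rfl ≫ (totalTensor X Q).d (p + q) (p + q + 1) ≫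
      z.v (p + q + 1) p' (by lia) =
      ((tensorFunctor k A B).map (X.d p (p + 1))).app (Q.X q) ≫
        ιTensor X Q (p + 1) q (p + q + 1) (by lia) ≫ z.v (p + q + 1) p' (by lia) +
      p.negOnePow • (((tensorFunctor k A B).obj (X.X p)).map (Q.d q (q + 1)) ≫
        ιTensor X Q p (q + 1) (p + q + 1) (by lia) ≫ z.v (p + q + 1) p' (by lia)) := by
    rw [← Category.assoc, ιTensor_d X Q p q (p + q) (p + q + 1) (p + 1) (q + 1) rfl rfl rfl rfl,
      Preadditive.add_comp, Linear.units_smul_comp, Category.assoc, Category.assoc]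
  simp only [Preadditive.comp_add, Linear.comp_units_smul, h, add_curryAt,
    units_smul_curryAt, curryAt_map_app, curryAt_obj_map]
  rw [← Category.assoc, curryAt_comp]
  obtain rfl : r = q + m := by lia
  simp only [Linear.units_smul_comp, smul_add, smul_smul, mul_add, add_mul,
    one_mul, mul_one, Int.negOnePow_add]
  have hq := Int.units_mul_self q.negOnePow
  rw [add_assoc]
  congr 2
  · congr 1
    rw [← mul_one ((p * q).negOnePow * m.negOnePow), ← hq]
    ac_rfl
  · congr 1
    ac_rfl

end Adjunction

/-! ### Consequences of the adjunction for cohomology -/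

section HomComplexLemmas

variable {k : Type v} [Field k] {A B : Type u} [Ring A] [Ring B] [Algebra k A] [Algebra k B]
  {X X' : CochainComplex (ModuleCat.{u} (B ⊗[k] Aᵐᵒᵖ)) ℤ} {Q : CochainComplex (ModuleCat.{u} A) ℤ}
  {J : CochainComplex (ModuleCat.{u} B) ℤ}

lemma curryCochain_zero {n : ℤ} : curryCochain (0 : Cochain (totalTensor X Q) J n) = 0 := by
  refine hom_cochain_ext fun q r hqr x p p' hp => ?_
  rw [curryCochain_v _ _ _ _ _ _ _ _ _ rfl, Cochain.zero_v, comp_zero, zero_curryAt, smul_zero]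
  rfl

variable (X Q J) in
-- Currying is a bijection of cochains compatible with `δ`, so cocycles and coboundaries correspond.
lemma homVanish_totalTensor_iff (n : ℤ) :
    HomVanish (totalTensor X Q) J n ↔ HomVanish Q (homComplex X J) n := by
  constructor
  · intro h c hc
    obtain ⟨z, rfl⟩ := curryCochain_surjective c
    rw [δ_curryCochain rfl, ← curryCochain_zero] at hc
    obtain ⟨w, rfl⟩ := h z (curryCochain_injective hc)
    exact ⟨curryCochain w, δ_curryCochain (by lia) w⟩
  · intro h z hz
    obtain ⟨c, hc⟩ := h (curryCochain z) (by rw [δ_curryCochain rfl, hz, curryCochain_zero])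
    obtain ⟨w, rfl⟩ := curryCochain_surjective c
    rw [δ_curryCochain (by lia)] at hc
    exact ⟨w, curryCochain_injective hc⟩

variable (k A B) in
instance quasiIso_resLeft_map (s : X' ⟶ X) [hs : QuasiIso s] :
    QuasiIso (((resLeft k B Aᵐᵒᵖ).mapHomologicalComplex _).map s) :=
  (quasiIso_iff_elements _).2 ((quasiIso_iff_elements s).1 hs)

lemma quasiIso_homComplexMap (s : X' ⟶ X) [QuasiIso s] [J.IsKInjective] :
    QuasiIso (homComplexMap s J) := by
  refine (quasiIso_iff_elements _).2 fun n => ⟨?_, ?_⟩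
  · rintro (z : Cochain (resLeftComplex k B Aᵐᵒᵖ X) J n) hz ⟨w, hw⟩
    exact exists_δ_eq_of_quasiIso (((resLeft k B Aᵐᵒᵖ).mapHomologicalComplex _).map s) n z hz w hw
  · rintro (z : Cochain (resLeftComplex k B Aᵐᵒᵖ X') J n) hz
    obtain ⟨y, w, hy, hw⟩ := exists_extension_of_quasiIso
      (((resLeft k B Aᵐᵒᵖ).mapHomologicalComplex _).map s) n z hz
    exact ⟨y, w, hy, hw⟩

end HomComplexLemmas

/-! ### Injective bimodules are injective as left modules -/

section Restriction

variable (k : Type v) [Field k] (R S : Type u) [Ring R] [Ring S] [Algebra k R] [Algebra k S]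

/-- The `R ⊗[k] S`-module structure on `X ⊗[k] S`, for an `R`-module `X`. -/
abbrev inducedModule (X : Type u) [AddCommGroup X] [Module R X] [Module k X]
    [IsScalarTower k R X] : Module (R ⊗[k] S) (X ⊗[k] S) :=
  Module.compHom (X ⊗[k] S)
    ((Module.endTensorEndAlgHom (R := k) (S := k) (A := k) (M := X) (N := S)).comp
      (Algebra.TensorProduct.map (Algebra.lsmul k k X) (Algebra.lmul k S))).toRingHom

/-- Restriction to `R` is right adjoint to `X ↦ X ⊗[k] S`, which preserves monomorphisms because `k`
is a field. Concretely, `f` transposes to `x ⊗ s ↦ s f(x)`, this map extends to `Y ⊗[k] S`, and the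
extension is restricted along `y ↦ y ⊗ 1`. -/
lemma injective_resLeft (I : ModuleCat.{u} (R ⊗[k] S)) [Injective I] :
    Injective ((resLeft k R S).obj I) := by
  refine ⟨fun {X Y} f i _ => ?_⟩
  let _ : Module k X := Module.compHom X (algebraMap k R)
  let _ : Module k Y := Module.compHom Y (algebraMap k R)
  have : IsScalarTower k R X :=
    ⟨fun c r x => by
      change _ = algebraMap k R c • (r • x)
      rw [Algebra.smul_def, mul_smul]⟩
  have : IsScalarTower k R Y :=
    ⟨fun c r x => by
      change _ = algebraMap k R c • (r • x)
      rw [Algebra.smul_def, mul_smul]⟩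
  let _ : Module k I := Module.compHom I (algebraMap k (R ⊗[k] S))
  let _ := inducedModule k R S X
  let _ := inducedModule k R S Y
  have hX (r : R) (s t : S) (x : X) :
      (r ⊗ₜ[k] s : R ⊗[k] S) • (x ⊗ₜ[k] t : X ⊗[k] S) = (r • x) ⊗ₜ[k] (s * t) := rfl
  have hY (r : R) (s t : S) (x : Y) :
      (r ⊗ₜ[k] s : R ⊗[k] S) • (x ⊗ₜ[k] t : Y ⊗[k] S) = (r • x) ⊗ₜ[k] (s * t) := rfl
  have hk (c : k) (y : I) : c • y = ((algebraMap k R c) ⊗ₜ[k] (1 : S) : R ⊗[k] S) • y := rfl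
  have hk' (c : k) : ((algebraMap k R c) ⊗ₜ[k] (1 : S) : R ⊗[k] S) = 1 ⊗ₜ algebraMap k S c := by
    simp [Algebra.algebraMap_eq_smul_one, TensorProduct.smul_tmul]
  let ik : X →ₗ[k] Y :=
    { toFun := i.hom
      map_add' := i.hom.map_add
      map_smul' := fun c x => i.hom.map_smul (algebraMap k R c) x }
  let F : X ⊗[k] S →ₗ[R ⊗[k] S] Y ⊗[k] S :=
    { toFun := ik.rTensor S
      map_add' := map_add _
      map_smul' := fun a x => by
        induction a using TensorProduct.induction_on with
        | zero => simp
        | add a b ha hb => rw [add_smul, map_add, ha, hb, RingHom.id_apply, RingHom.id_apply,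
            RingHom.id_apply, add_smul]
        | tmul r s =>
          induction x using TensorProduct.induction_on with
          | zero => simp
          | add a b ha hb => rw [smul_add, map_add, ha, hb, map_add, smul_add]
          | tmul x t =>
            rw [hX, LinearMap.rTensor_tmul, LinearMap.rTensor_tmul]
            exact congrArg (· ⊗ₜ[k] (s * t)) (i.hom.map_smul r x) }
  have hF : Function.Injective F := Module.Flat.rTensor_preserves_injective_linearMap ik
    ((ModuleCat.mono_iff_injective i).1 inferInstance)
  let f' (x : X) : I := f.hom x
  have hf' (r : R) (x : X) : f' (r • x) = (r ⊗ₜ[k] (1 : S) : R ⊗[k] S) • f' x := f.hom.map_smul r x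
  have hf'' (x y : X) : f' (x + y) = f' x + f' y := f.hom.map_add x y
  let g₀ : X ⊗[k] S →ₗ[k] I := TensorProduct.lift
    { toFun := fun x =>
        { toFun := fun s => ((1 : R) ⊗ₜ[k] s : R ⊗[k] S) • f' x
          map_add' := fun s t => by rw [TensorProduct.tmul_add, add_smul]
          map_smul' := fun c s => by
            rw [RingHom.id_apply, hk, smul_smul, hk', Algebra.TensorProduct.tmul_mul_tmul, one_mul,
              Algebra.smul_def] }
      map_add' := fun x y => by ext s; simp [hf'']
      map_smul' := fun c x => by
        ext s
        change ((1 : R) ⊗ₜ[k] s : R ⊗[k] S) • f' (algebraMap k R c • x) =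
          c • ((1 : R) ⊗ₜ[k] s : R ⊗[k] S) • f' x
        rw [hf', hk, smul_smul, smul_smul]
        simp }
  have hg₀ (x : X) (s : S) : g₀ (x ⊗ₜ s) = ((1 : R) ⊗ₜ[k] s : R ⊗[k] S) • f' x := rfl
  let g : X ⊗[k] S →ₗ[R ⊗[k] S] I :=
    { toFun := g₀
      map_add' := map_add _
      map_smul' := fun a x => by
        induction a using TensorProduct.induction_on with
        | zero => simp
        | add a b ha hb => rw [add_smul, map_add, ha, hb, RingHom.id_apply, RingHom.id_apply,
            RingHom.id_apply, add_smul]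
        | tmul r s =>
          induction x using TensorProduct.induction_on with
          | zero => simp
          | add a b ha hb => rw [smul_add, map_add, ha, hb, map_add, smul_add]
          | tmul x t =>
            rw [hX, hg₀, hg₀, hf', RingHom.id_apply, smul_smul, smul_smul]
            simp }
  have : Mono (ModuleCat.ofHom F) := (ModuleCat.mono_iff_injective _).2 hF
  have hfac (x : X) : (Injective.factorThru (ModuleCat.ofHom g) (ModuleCat.ofHom F)).hom
      (i.hom x ⊗ₜ[k] (1 : S)) = f' x := by
    have h := congrArg (fun φ => φ.hom (x ⊗ₜ[k] (1 : S)))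
      (Injective.comp_factorThru (ModuleCat.ofHom g) (ModuleCat.ofHom F))
    refine h.trans ((hg₀ x 1).trans ?_)
    exact one_smul (R ⊗[k] S) (f' x)
  refine ⟨ModuleCat.ofHom (Y := (resLeft k R S).obj I)
    { toFun := fun y => (Injective.factorThru (ModuleCat.ofHom g) (ModuleCat.ofHom F)).hom
        (y ⊗ₜ[k] (1 : S))
      map_add' := fun y y' =>
        (congrArg _ (TensorProduct.add_tmul y y' (1 : S))).trans (map_add _ _ _)
      map_smul' := fun r y => ?_ }, ?_⟩
  · have h := hY r 1 1 y
    rw [mul_one] at h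
    exact (congrArg _ h.symm).trans (map_smul _ _ _)
  · ext x
    exact hfac x

end Restriction

/-! ### Tensor evaluation -/

section TensorEvaluation

variable {A B : Type u} [Ring A] [Ring B]
  (X X' Y : Type u) [AddCommGroup X] [Module B X] [AddCommGroup X'] [Module B X']
  [AddCommGroup Y] [Module B Y] [Module Aᵐᵒᵖ Y] [SMulCommClass B Aᵐᵒᵖ Y]
  (N : Type u) [AddCommGroup N] [Module A N]

/-- The map `Hom_B(X, Y) ⊗_A N → Hom_B(X, Y ⊗_A N)`. -/
def tensorEval : BalancedTensor ℤ A (X →ₗ[B] Y) N →ₗ[ℤ] (X →ₗ[B] BalancedTensor B A Y N) :=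
  lift ℤ A
    (AddMonoidHom.toIntLinearMap
      { toFun := fun f =>
          { toFun := fun n =>
              { toFun := fun x => tmul B A (f x) n
                map_add' := fun x y => by rw [map_add, add_tmul]
                map_smul' := fun b x => by rw [map_smul, smul_tmul]; rfl }
            map_zero' := by ext x; exact tmul_zero ..
            map_add' := fun n n' => by ext x; exact tmul_add .. }
        map_zero' := by ext n x; exact zero_tmul ..
        map_add' := fun f g => by ext n x; exact add_tmul .. })
    (fun f a n => by ext x; exact op_smul_tmul ..)

variable {X X' Y N}

variable (A Y) in
/-- Precomposition as a map of right `A`-modules. -/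
def precomp (g : X →ₗ[B] X') : (X' →ₗ[B] Y) →ₗ[Aᵐᵒᵖ] (X →ₗ[B] Y) where
  toFun f := f ∘ₗ g
  map_add' _ _ := rfl
  map_smul' _ _ := rfl

lemma tensorEval_precomp (g : X →ₗ[B] X') (t : BalancedTensor ℤ A (X' →ₗ[B] Y) N) :
    tensorEval X Y N (mapL (precomp A Y g) N t) = tensorEval X' Y N t ∘ₗ g := by
  induction t using BalancedTensor.induction_on with
  | h0 => simp
  | htmul f n => rfl
  | hadd x y hx hy => rw [map_add, map_add, hx, hy, map_add]; rfl

lemma mapL_id {N₁ : Type u} [AddCommGroup N₁] [Module Aᵐᵒᵖ N₁] (t : BalancedTensor ℤ A N₁ N) :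
    mapL (LinearMap.id : N₁ →ₗ[Aᵐᵒᵖ] N₁) N t = t := by
  induction t using BalancedTensor.induction_on with
  | h0 => simp
  | htmul f n => rfl
  | hadd x y hx hy => rw [map_add, hx, hy]

variable (A Y) in
/-- The value at the `i`-th basis vector. -/
def evalAt {m : ℕ} (i : Fin m) : ((Fin m → B) →ₗ[B] Y) →ₗ[Aᵐᵒᵖ] Y where
  toFun f := f (Pi.single i 1)
  map_add' _ _ := rfl
  map_smul' _ _ := rfl

variable (A Y) in
/-- The homomorphism which maps the `i`-th basis vector to a given element, and the other ones
to zero. -/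
def coeval {m : ℕ} (i : Fin m) : Y →ₗ[Aᵐᵒᵖ] ((Fin m → B) →ₗ[B] Y) where
  toFun y := (LinearMap.toSpanSingleton B Y y) ∘ₗ LinearMap.proj i
  map_add' y y' := by ext; simp
  map_smul' a y := by ext; simp [smul_comm]

lemma sum_mapL {N₁ N₂ : Type u} [AddCommGroup N₁] [Module Aᵐᵒᵖ N₁] [AddCommGroup N₂]
    [Module Aᵐᵒᵖ N₂] {ι : Type*} (s : Finset ι) (f : ι → N₁ →ₗ[Aᵐᵒᵖ] N₂)
    (t : BalancedTensor ℤ A N₁ N) : ∑ i ∈ s, mapL (f i) N t = mapL (∑ i ∈ s, f i) N t := by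
  induction t using BalancedTensor.induction_on with
  | h0 => simp
  | htmul y n =>
    classical
    induction s using Finset.induction_on with
    | empty => rw [Finset.sum_empty, Finset.sum_empty, mapL_zero]
    | insert i s hi h => rw [Finset.sum_insert hi, Finset.sum_insert hi, h]; exact (add_tmul ..).symm
  | hadd x y hx hy => rw [map_add, ← hx, ← hy, ← Finset.sum_add_distrib]; simp only [map_add]

lemma tensorEval_single {m : ℕ} (i : Fin m) (t : BalancedTensor ℤ A ((Fin m → B) →ₗ[B] Y) N) :
    tensorEval _ Y N t (Pi.single i 1) = ofInt B A (mapL (evalAt A Y i) N t) := by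
  induction t using BalancedTensor.induction_on with
  | h0 => simp
  | htmul f n => rfl
  | hadd x y hx hy => rw [map_add, map_add, map_add, ← hx, ← hy]; rfl

/-- For `X = B^m` both sides are `m` copies of `Y ⊗_A N`; `evalAt` and `coeval` are the projections
and inclusions of the summands. -/
lemma tensorEval_bijective_of_free (m : ℕ) :
    Function.Bijective (tensorEval (A := A) (B := B) (Fin m → B) Y N) := by
  constructor
  · refine (injective_iff_map_eq_zero _).2 fun t ht => ?_
    have h1 (i : Fin m) : mapL (evalAt A Y i) N t = 0 := by
      refine (ofInt_bijective B A).1 ?_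
      rw [← tensorEval_single, ht, map_zero]
      rfl
    have h2 : ∑ i, mapL (coeval A Y i) N (mapL (evalAt A Y i) N t) = t := by
      simp only [mapL_mapL]
      rw [sum_mapL]
      have : ∑ i : Fin m, coeval A Y i ∘ₗ evalAt A Y i =
          (LinearMap.id : ((Fin m → B) →ₗ[B] Y) →ₗ[Aᵐᵒᵖ] _) := by
        refine LinearMap.ext fun f => LinearMap.pi_ext' fun j => LinearMap.ext_ring ?_
        simp [coeval, evalAt, LinearMap.sum_apply, Pi.single_apply]
      rw [this, mapL_id]
    rw [← h2]
    simp [h1]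
  · intro g
    choose s hs using fun i => (ofInt_bijective B A (N := Y) (M := N)).2 (g (Pi.single i 1))
    refine ⟨∑ i, mapL (coeval A Y i) N (s i), ?_⟩
    refine LinearMap.pi_ext' fun j => LinearMap.ext_ring ?_
    change tensorEval _ Y N _ (Pi.single j 1) = g (Pi.single j 1)
    rw [tensorEval_single, map_sum, map_sum, ← hs j, Finset.sum_eq_single j]
    · have : evalAt (B := B) A Y j ∘ₗ coeval (B := B) A Y j = LinearMap.id := by
        ext y; simp [coeval, evalAt]
      rw [mapL_mapL, this, mapL_id]
    · intro i _ hij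
      have : evalAt (B := B) A Y j ∘ₗ coeval (B := B) A Y i = 0 := by
        ext y; simp [coeval, evalAt, hij]
      rw [mapL_mapL, this, mapL_zero, map_zero]
    · simp

lemma precomp_injective {g : X →ₗ[B] X'} (hg : Function.Surjective g) :
    Function.Injective (precomp A Y g) := fun f f' h =>
  LinearMap.ext fun x => by
    obtain ⟨x, rfl⟩ := hg x
    exact LinearMap.congr_fun h x

/-- A surjection `B^m → X` embeds `Hom_B(X, Y)` into `Hom_B(B^m, Y)`, and flatness preserves the
embedding, which reduces to the free case. -/
lemma tensorEval_injective {F : ModuleCat.{u} A} (hF : IsFlat F) [Module.Finite B X] :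
    Function.Injective (tensorEval (A := A) (B := B) X Y F) := by
  refine (injective_iff_map_eq_zero _).2 fun t ht => ?_
  obtain ⟨m, π, hπ⟩ := Module.Finite.exists_fin' B X
  refine hF.mapL_injective (precomp_injective hπ) (((tensorEval_bijective_of_free (A := A) (B := B) (Y := Y) m).1 ?_).trans
    (map_zero _).symm)
  rw [tensorEval_precomp, ht, map_zero]
  rfl

/-- As `B` is noetherian, `X` has a finite presentation `B^n → B^m → X`. Left exactness of `Hom_B(-,
Y)`, preserved by the flat module `F`, reduces surjectivity to the free case. -/
lemma tensorEval_bijective {F : ModuleCat.{u} A} (hF : IsFlat F) [IsNoetherianRing B]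
    [Module.Finite B X] : Function.Bijective (tensorEval (A := A) (B := B) X Y F) := by
  refine ⟨tensorEval_injective hF, fun g => ?_⟩
  obtain ⟨m, π, hπ⟩ := Module.Finite.exists_fin' B X
  obtain ⟨n, ρ, hρ⟩ := Module.Finite.exists_fin' B (LinearMap.ker π)
  have hex : Function.Exact (precomp (B := B) A Y π) (precomp (B := B) A Y ((LinearMap.ker π).subtype ∘ₗ ρ)) := by
    intro f
    constructor
    · intro hf
      have hker : LinearMap.ker π ≤ LinearMap.ker f := fun x hx => by
        obtain ⟨z, hz⟩ := hρ ⟨x, hx⟩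
        have := LinearMap.congr_fun hf z
        change f (ρ z : Fin m → B) = 0 at this
        rwa [hz] at this
      exact ⟨(LinearMap.ker π).liftQ f hker ∘ₗ (π.quotKerEquivOfSurjective hπ).symm.toLinearMap,
        LinearMap.ext fun x => by
          change (LinearMap.ker π).liftQ f hker ((π.quotKerEquivOfSurjective hπ).symm (π x)) = f x
          rw [← LinearMap.quotKerEquivOfSurjective_apply_mk π hπ, LinearEquiv.symm_apply_apply]
          rfl⟩
    · rintro ⟨f, rfl⟩
      exact LinearMap.ext fun x => (congrArg f (ρ x).2).trans (map_zero f)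
  obtain ⟨t, ht⟩ := (tensorEval_bijective_of_free (A := A) (Y := Y) (N := F) m).2 (g ∘ₗ π)
  obtain ⟨t', rfl⟩ := hF.mapL_exact hex t ((tensorEval_bijective_of_free (A := A) (B := B) (Y := Y) n).1 (by
    rw [tensorEval_precomp, ht, map_zero]
    exact LinearMap.ext fun x => (congrArg g (ρ x).2).trans (map_zero g)))
  rw [tensorEval_precomp] at ht
  refine ⟨t', LinearMap.ext fun x => ?_⟩
  obtain ⟨x, rfl⟩ := hπ x
  exact LinearMap.congr_fun ht x

variable (Y) in
/-- The tensor product of an injective module with a flat module is injective. -/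
lemma injective_balancedTensor {F : ModuleCat.{u} A} (hF : IsFlat F) [IsNoetherianRing B]
    (hY : Module.Injective B Y) : Module.Injective B (BalancedTensor B A Y F) := by
  refine Module.Baer.injective fun 𝔞 g => ?_
  -- By Baer's criterion it suffices to extend from a left ideal. It is finitely generated, so the
  -- map comes from `Hom_B(𝔞, Y) ⊗ F`, onto which `Hom_B(B, Y) ⊗ F` surjects.
  obtain ⟨t, rfl⟩ := (tensorEval_bijective hF).2 g
  have hs : Function.Surjective (precomp (B := B) A Y 𝔞.subtype) := fun f => by
    obtain ⟨f', hf'⟩ := hY.out 𝔞.subtype Subtype.val_injective f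
    exact ⟨f', LinearMap.ext hf'⟩
  obtain ⟨t', rfl⟩ := mapL_surjective hs t
  refine ⟨tensorEval _ _ _ t', fun x hx => ?_⟩
  rw [tensorEval_precomp]
  rfl

end TensorEvaluation

/-! ### Quasi-isomorphic bounded subcomplexes with finitely generated terms -/

section FiniteSubcomplex

variable {R : Type u} [Ring R]

lemma exists_fg_map_eq {M N : Type*} [AddCommGroup M] [Module R M] [AddCommGroup N] [Module R N]
    (f : M →ₗ[R] N) {W : Submodule R N} (hW : W.FG) (h : W ≤ LinearMap.range f) :
    ∃ G : Submodule R M, G.FG ∧ G.map f = W := by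
  classical
  obtain ⟨s, rfl⟩ := hW
  obtain ⟨s', -, rfl⟩ := Finset.subset_set_image_iff (s := Set.univ) (f := f) (t := s) |>.1
    (fun x hx => by
      obtain ⟨y, rfl⟩ := h (Submodule.subset_span hx)
      exact ⟨y, trivial, rfl⟩)
  exact ⟨Submodule.span R s', ⟨s', rfl⟩, by rw [Submodule.map_span, Finset.coe_image]⟩

/-- The complex formed by a family of submodules stable under the differentials. -/
def subcomplex (K : CochainComplex (ModuleCat.{u} R) ℤ) (X : ∀ p, Submodule R (K.X p))
    (hX : ∀ p q, ∀ x ∈ X p, (K.d p q).hom x ∈ X q) : CochainComplex (ModuleCat.{u} R) ℤ where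
  X p := ModuleCat.of R (X p)
  d p q := ModuleCat.ofHom ((K.d p q).hom.restrict (hX p q))
  shape p q h := by
    refine ModuleCat.hom_ext (LinearMap.ext fun (x : X p) => Subtype.ext ?_)
    exact congrArg (fun f => f.hom x.1) (K.shape p q h)
  d_comp_d' p q r _ _ := by
    refine ModuleCat.hom_ext (LinearMap.ext fun (x : X p) => Subtype.ext ?_)
    exact congrArg (fun f => f.hom x.1) (K.d_comp_d p q r)

/-- The inclusion of a subcomplex. -/
def subcomplexι (K : CochainComplex (ModuleCat.{u} R) ℤ) (X : ∀ p, Submodule R (K.X p))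
    (hX : ∀ p q, ∀ x ∈ X p, (K.d p q).hom x ∈ X q) : subcomplex K X hX ⟶ K where
  f p := ModuleCat.ofHom (X p).subtype
  comm' _ _ _ := rfl

variable [IsNoetherianRing R] (K : CochainComplex (ModuleCat.{u} R) ℤ)

/-- Descending construction, one degree at a time below `b`: `X q` is spanned by cocycles
representing generators of the cohomology and by preimages of generators of the boundaries lying in
`X (q + 1)`. Noetherianity keeps those boundaries finitely generated. The last two conditions give
injectivity and surjectivity of the inclusion on cohomology. -/
lemma exists_finite_submodules (b : ℤ)
    (hfin : ∀ p, ∃ G : Submodule R (K.X p), G.FG ∧ G ≤ LinearMap.ker (K.d p (p + 1)).hom ∧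
      LinearMap.ker (K.d p (p + 1)).hom ≤ G ⊔ LinearMap.range (K.d (p - 1) p).hom)
    (hb : ∀ p, b < p →
      LinearMap.ker (K.d p (p + 1)).hom ≤ LinearMap.range (K.d (p - 1) p).hom) (n : ℕ) :
    ∃ X : ∀ p, Submodule R (K.X p), (∀ p, (X p).FG) ∧ (∀ p, b < p → X p = ⊥) ∧
      ∀ p, b - n < p →
        (X p).map (K.d p (p + 1)).hom = X (p + 1) ⊓ LinearMap.range (K.d p (p + 1)).hom ∧
        LinearMap.ker (K.d p (p + 1)).hom ≤ X p ⊔ LinearMap.range (K.d (p - 1) p).hom := by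
  induction n with
  | zero =>
    refine ⟨fun p => ⊥, fun p => Submodule.fg_bot, fun p _ => rfl, fun p hp => ⟨?_, ?_⟩⟩
    · rw [Submodule.map_bot, bot_inf_eq]
    · exact (hb p (by simpa using hp)).trans le_sup_right
  | succ n ih =>
    obtain ⟨X, hfg, hbot, hX⟩ := ih
    obtain ⟨q, hq⟩ : ∃ q : ℤ, q = b - n := ⟨_, rfl⟩
    obtain ⟨G, hG, hGle, hker⟩ := hfin q
    have hW : (X (q + 1) ⊓ LinearMap.range (K.d q (q + 1)).hom).FG := by
      have := isNoetherian_of_fg_of_noetherian _ (hfg (q + 1))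
      exact isNoetherian_submodule.1 this _ inf_le_left
    obtain ⟨G', hG', hmap⟩ := exists_fg_map_eq _ hW inf_le_right
    refine ⟨Function.update X q (G ⊔ G'), fun p => ?_, fun p hp => ?_, fun p hp => ?_⟩
    · obtain rfl | h := eq_or_ne p q
      · rw [Function.update_self]; exact hG.sup hG'
      · rw [Function.update_of_ne h]; exact hfg p
    · rw [Function.update_of_ne (by lia)]; exact hbot p hp
    · rw [Function.update_of_ne (show p + 1 ≠ q by push_cast at hp; lia)]
      obtain rfl | h := eq_or_ne p q
      · rw [Function.update_self]
        refine ⟨?_, hker.trans (sup_le_sup_right le_sup_left _)⟩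
        rw [Submodule.map_sup, hmap, (LinearMap.le_ker_iff_map (f := (K.d p (p + 1)).hom)).1 hGle,
          bot_sup_eq]
      · rw [Function.update_of_ne h]
        exact hX p (by push_cast at hp; lia)

lemma exists_finite_subcomplex (a b : ℤ) [K.IsStrictlyGE a]
    (hfin : ∀ p, ∃ G : Submodule R (K.X p), G.FG ∧ G ≤ LinearMap.ker (K.d p (p + 1)).hom ∧
      LinearMap.ker (K.d p (p + 1)).hom ≤ G ⊔ LinearMap.range (K.d (p - 1) p).hom)
    (hb : ∀ p, b < p →
      LinearMap.ker (K.d p (p + 1)).hom ≤ LinearMap.range (K.d (p - 1) p).hom) :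
    ∃ (X : CochainComplex (ModuleCat.{u} R) ℤ) (j : X ⟶ K), QuasiIso j ∧
      (∀ p, Module.Finite R (X.X p)) ∧ ∀ p, p < a ∨ b < p → Subsingleton (X.X p) := by
  -- After `b - a + 1` steps every degree at least `a` has been treated; below `a` the complex `K`
  -- vanishes.
  obtain ⟨X, hfg, hbot, hX⟩ := exists_finite_submodules K b hfin hb (b - a + 1).toNat
  have hsub (p : ℤ) (hp : p < a) : Subsingleton (K.X p) :=
    ModuleCat.subsingleton_of_isZero (K.isZero_of_isStrictlyGE a p hp)
  have hX' (p : ℤ) :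
      (X p).map (K.d p (p + 1)).hom = X (p + 1) ⊓ LinearMap.range (K.d p (p + 1)).hom ∧
        LinearMap.ker (K.d p (p + 1)).hom ≤ X p ⊔ LinearMap.range (K.d (p - 1) p).hom := by
    by_cases hp : p < a
    · have := hsub p hp
      have hr : LinearMap.range (K.d p (p + 1)).hom = ⊥ := by
        rw [LinearMap.range_eq_bot]
        exact LinearMap.ext fun x => by rw [Subsingleton.elim x 0, map_zero, map_zero]
      rw [hr, inf_bot_eq]
      exact ⟨le_bot_iff.1 (hr ▸ LinearMap.map_le_range), fun x _ => by
        rw [Subsingleton.elim x 0]; exact zero_mem _⟩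
    · exact hX p (by lia)
  have hd : ∀ p q, ∀ x ∈ X p, (K.d p q).hom x ∈ X q := fun p q x hx => by
    by_cases h : p + 1 = q
    · subst h
      exact ((hX' p).1 ▸ Submodule.mem_map_of_mem hx :
        _ ∈ X (p + 1) ⊓ LinearMap.range (K.d p (p + 1)).hom).1
    · rw [K.shape p q h]
      exact zero_mem _
  refine ⟨subcomplex K X hd, subcomplexι K X hd, (quasiIso_iff_elements _).2 fun n => ⟨?_, ?_⟩,
    fun p => Module.Finite.iff_fg.2 (hfg p), ?_⟩
  · rintro ⟨x, hx⟩ - ⟨y, hy⟩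
    have key (p q : ℤ) (hpq : p + 1 = q) :
        X q ⊓ LinearMap.range (K.d p q).hom ≤ (X p).map (K.d p q).hom := by
      subst hpq
      exact (hX' p).1.ge
    obtain ⟨x', hx', h⟩ := key (n - 1) n (by lia) ⟨hx, y, hy⟩
    exact ⟨⟨x', hx'⟩, Subtype.ext h⟩
  · intro x hx
    obtain ⟨g, hg, _, ⟨y, rfl⟩, h⟩ := Submodule.mem_sup.1 ((hX' n).2 hx)
    refine ⟨⟨g, hg⟩, y, Subtype.ext ?_, h.symm⟩
    change (K.d n (n + 1)).hom g = 0
    have hy : (K.d n (n + 1)).hom ((K.d (n - 1) n).hom y) = 0 :=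
      congrArg (fun f => f.hom y) (K.d_comp_d (n - 1) n (n + 1))
    have := congrArg (K.d n (n + 1)).hom h
    rwa [map_add, hy, add_zero, show (K.d n (n + 1)).hom x = 0 from hx] at this
  · rintro p (hp | hp)
    · have := hsub p hp
      exact inferInstanceAs (Subsingleton (X p))
    · change Subsingleton (X p)
      rw [hbot p hp]
      infer_instance

end FiniteSubcomplex

/-! ### Finitely generated cohomology represented by cocycles -/

section FiniteHomology

variable {k : Type v} [Field k] {R S : Type u} [Ring R] [Ring S] [Algebra k R] [Algebra k S]
  (I : CochainComplex (ModuleCat.{u} (R ⊗[k] S)) ℤ)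

lemma exists_fg_cocycles (p : ℤ) [h : Module.Finite R ((resLeft k R S).obj (I.homology p))] :
    ∃ G : Submodule R ((resLeftComplex k R S I).X p), G.FG ∧
      G ≤ LinearMap.ker ((resLeftComplex k R S I).d p (p + 1)).hom ∧
      LinearMap.ker ((resLeftComplex k R S I).d p (p + 1)).hom ≤
        G ⊔ LinearMap.range ((resLeftComplex k R S I).d (p - 1) p).hom := by
  obtain ⟨G, hG, hmap⟩ := exists_fg_map_eq ((resLeft k R S).map (I.homologyπ p)).hom
    (Module.finite_def.1 h) (fun y _ => homologyπ_surjective I p y)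
  have hG' (y : (resLeft k R S).obj (I.homology p)) :
      y ∈ G.map ((resLeft k R S).map (I.homologyπ p)).hom := hmap ▸ Submodule.mem_top
  refine ⟨G.map ((resLeft k R S).map (I.iCycles p)).hom, hG.map _, ?_, fun x hx => ?_⟩
  · rintro _ ⟨c, -, rfl⟩
    exact d_iCycles_apply I p (p + 1) c
  · obtain ⟨c, rfl⟩ := exists_cycle I (j := p + 1) (by simp) x hx
    obtain ⟨(g : I.cycles p), hg, hgc⟩ := hG' (I.homologyπ p c)
    obtain ⟨y, hy⟩ := (homologyπ_eq_zero_iff I (i := p - 1) (j := p) (by simp) (c - g)).1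
      ((map_sub _ _ _).trans (sub_eq_zero.2 hgc.symm))
    refine Submodule.mem_sup.2 ⟨_, Submodule.mem_map_of_mem hg, _, ⟨y, rfl⟩, ?_⟩
    refine (congrArg (I.iCycles p g + ·) (hy.trans (map_sub _ _ _))).trans ?_
    exact add_sub_cancel _ _

end FiniteHomology

/-! ### Quasi-isomorphisms from a module in degree zero -/

section SingleElements

variable {R : Type u} [Ring R]

lemma quasiIso_mkHomFromSingle_iff {P : ModuleCat.{v} R} {C : CochainComplex (ModuleCat.{v} R) ℤ}
    (f : P ⟶ C.X 0) (hf : ∀ j, (ComplexShape.up ℤ).Rel 0 j → f ≫ C.d 0 j = 0) :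
    QuasiIso (HomologicalComplex.mkHomFromSingle f hf) ↔
      (∀ x : P, (∃ y, C.d (-1) 0 y = f x) → x = 0) ∧
      (∀ x : C.X 0, C.d 0 1 x = 0 → ∃ (p : P) (y : C.X (-1)), x = f p + C.d (-1) 0 y) ∧
      ∀ n ≠ 0, ∀ x : C.X n, C.d n (n + 1) x = 0 → ∃ y, C.d (n - 1) n y = x := by
  rw [quasiIso_iff_elements]
  let e := HomologicalComplex.singleObjXSelf (ComplexShape.up ℤ) 0 P
  have he (x) : (HomologicalComplex.mkHomFromSingle f hf).f 0 x = f (e.hom x) := by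
    rw [HomologicalComplex.mkHomFromSingle_f]; rfl
  have hsub (n : ℤ) (hn : n ≠ 0) : Subsingleton
      (((HomologicalComplex.single (ModuleCat.{v} R) (ComplexShape.up ℤ) 0).obj P).X n) :=
    ModuleCat.subsingleton_of_isZero (HomologicalComplex.isZero_single_obj_X _ _ _ _ hn)
  have hd (m n : ℤ) :
      ((HomologicalComplex.single (ModuleCat.{v} R) (ComplexShape.up ℤ) 0).obj P).d m n = 0 := rfl
  constructor
  · intro h
    refine ⟨fun x ⟨y, hy⟩ => ?_, fun x hx => ?_, fun n hn x hx => ?_⟩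
    · obtain ⟨z, hz⟩ := (h 0).1 (e.inv x) (by rw [hd]; rfl) ⟨y, by rw [he]; simpa using hy⟩
      have := congrArg e.hom hz
      rw [hd] at this
      simpa using this.symm
    · obtain ⟨z, y, -, h⟩ := (h 0).2 x hx
      exact ⟨e.hom z, y, by rw [h, he]; rfl⟩
    · obtain ⟨z, y, -, h⟩ := (h n).2 x hx
      have := hsub n hn
      exact ⟨y, by rw [h, Subsingleton.elim z 0, map_zero, zero_add]⟩
  · rintro ⟨h1, h2, h3⟩ n
    obtain rfl | hn := eq_or_ne n 0
    · refine ⟨fun x _ ⟨y, hy⟩ => ⟨0, ?_⟩, fun x hx => ?_⟩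
      · have := h1 (e.hom x) ⟨y, hy.trans (he x)⟩
        have hx : x = 0 := by
          rw [← map_zero e.inv.hom, ← this]
          simp
        rw [hx, map_zero]
      · obtain ⟨p, y, h⟩ := h2 x hx
        exact ⟨e.inv.hom p, y, by rw [hd]; rfl, by rw [h, he]; simp⟩
    · have := hsub n hn
      refine ⟨fun x _ _ => ⟨0, Subsingleton.elim _ _⟩, fun x hx => ?_⟩
      obtain ⟨y, rfl⟩ := h3 n hn x hx
      exact ⟨0, y, map_zero _, by rw [map_zero, zero_add]⟩

end SingleElements

/-! ### Maps from a group to the cocycles of degree zero -/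

section Augmentation

variable {R : Type u} [Ring R] {K K' L : CochainComplex (ModuleCat.{u} R) ℤ}
  {P : Type*} [AddCommGroup P]

/-- `α` takes values in cocycles and identifies `P` with the cohomology of `Hom(K, L)`. -/
structure IsAug (α : P → Cochain K L 0) : Prop where
  cocycle : ∀ x, δ 0 1 (α x) = 0
  injective : ∀ x (w : Cochain K L (-1)), δ (-1) 0 w = α x → x = 0
  surjective : ∀ z : Cochain K L 0, δ 0 1 z = 0 → ∃ x w, z = α x + δ (-1) 0 w
  homVanish : ∀ n, n ≠ 0 → HomVanish K L n

lemma homVanish_iff_of_quasiIso_left [L.IsKInjective] (s : K' ⟶ K) [QuasiIso s] (n : ℤ) :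
    HomVanish K L n ↔ HomVanish K' L n := by
  constructor
  · intro h z hz
    obtain ⟨y, w, hy, rfl⟩ := exists_extension_of_quasiIso s n z hz
    obtain ⟨v, rfl⟩ := h y hy
    exact ⟨(Cochain.ofHom s).comp v (zero_add _) + w, by rw [δ_add, δ_ofHom_comp]⟩
  · intro h z hz
    obtain ⟨w, hw⟩ := h ((Cochain.ofHom s).comp z (zero_add n))
      (by rw [δ_ofHom_comp, hz, Cochain.comp_zero])
    exact exists_δ_eq_of_quasiIso s n z hz w hw

/-- `Hom(-, L)` sends quasi-isomorphisms to quasi-isomorphisms for K-injective `L`. This allows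
passing to a source with finitely generated terms and back. -/
lemma IsAug.iff_of_quasiIso [L.IsKInjective] (s : K' ⟶ K) [QuasiIso s] {α : P → Cochain K L 0}
    {α' : P → Cochain K' L 0} (hα : ∀ x, δ 0 1 (α x) = 0)
    (h : ∀ x, α' x = (Cochain.ofHom s).comp (α x) (zero_add 0)) : IsAug α ↔ IsAug α' := by
  constructor
  · intro H
    refine ⟨fun x => by rw [h, δ_ofHom_comp, hα, Cochain.comp_zero], fun x w hw => ?_,
      fun z hz => ?_, fun n hn => (homVanish_iff_of_quasiIso_left s n).1 (H.homVanish n hn)⟩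
    · obtain ⟨y, hy⟩ := exists_δ_eq_of_quasiIso s 0 (α x) (hα x) w (hw.trans (h x))
      exact H.injective x y hy
    · obtain ⟨y, w, hy, rfl⟩ := exists_extension_of_quasiIso s 0 z hz
      obtain ⟨x, v, rfl⟩ := H.surjective y hy
      let w' : Cochain K' L (-1) := w
      refine ⟨x, (Cochain.ofHom s).comp v (zero_add (-1)) + w', ?_⟩
      rw [h, δ_add, δ_ofHom_comp, Cochain.comp_add, add_assoc]
      rfl
  · intro H
    refine ⟨hα, fun x w hw => H.injective x ((Cochain.ofHom s).comp w (zero_add _)) ?_,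
      fun z hz => ?_, fun n hn => (homVanish_iff_of_quasiIso_left s n).2 (H.homVanish n hn)⟩
    · rw [δ_ofHom_comp, hw, h]
    · obtain ⟨x, w, hw⟩ := H.surjective ((Cochain.ofHom s).comp z (zero_add 0))
        (by rw [δ_ofHom_comp, hz, Cochain.comp_zero])
      obtain ⟨y, hy⟩ := exists_δ_eq_of_quasiIso s 0 (z - α x)
        ((δ_sub _ _ _ _).trans (by rw [show δ 0 (0 + 1) (α x) = 0 from hα x, sub_zero]; exact hz)) w
        (by rw [Cochain.comp_sub, hw, h, add_sub_cancel_left]; rfl)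
      exact ⟨x, y, by rw [← sub_eq_iff_eq_add']; exact hy.symm⟩

end Augmentation

/-! ### The complexes `I ⊗_A N` and `Hom_B(X, I) ⊗_A N` -/

section TensorComplex

variable {k : Type v} [Field k] {A B : Type u} [Ring A] [Ring B] [Algebra k A] [Algebra k B]

instance (N : ModuleCat.{u} A) : ((tensorFunctor k A B).flip.obj N).Additive where
  map_add {_ _ f g} := congrArg (fun φ => φ.app N) ((tensorFunctor k A B).map_add (f := f) (g := g))

/-- The complex `I ⊗_A N`. -/
abbrev tensorComplex (I : CochainComplex (ModuleCat.{u} (B ⊗[k] Aᵐᵒᵖ)) ℤ) (N : ModuleCat.{u} A) :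
    CochainComplex (ModuleCat.{u} B) ℤ :=
  (((tensorFunctor k A B).flip.obj N).mapHomologicalComplex _).obj I

variable (I : CochainComplex (ModuleCat.{u} (B ⊗[k] Aᵐᵒᵖ)) ℤ) {N : ModuleCat.{u} A}

/-- The map `y ↦ y ⊗ x`. -/
def insertHom (x : N) : resLeftComplex k B Aᵐᵒᵖ I ⟶ tensorComplex I N where
  f p := curryAt (𝟙 (((tensorFunctor k A B).obj (I.X p)).obj N)) x
  comm' _ _ _ := rfl

lemma insertHom_add (x x' : N) : insertHom I (x + x') = insertHom I x + insertHom I x' := by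
  ext1 p
  exact curryAt_add _ x x'

lemma insertHom_smul (a : A) (x : N) :
    insertHom I (a • x) = actHom k B Aᵐᵒᵖ I (MulOpposite.op a) ≫ insertHom I x := by
  ext1 p
  exact curryAt_smul _ a x

end TensorComplex

/-! ### Tensor evaluation for complexes -/

section RightCochain

variable {k : Type v} [Field k] {A B : Type u} [Ring A] [Ring B] [Algebra k A] [Algebra k B]

/-- The degree `n` part of the complex of right `A`-modules `Hom_B(X, I)`, where `I` is a complex
of `B`-left-`A`-right-modules. -/
def RightCochain (X : CochainComplex (ModuleCat.{u} B) ℤ)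
    (I : CochainComplex (ModuleCat.{u} (B ⊗[k] Aᵐᵒᵖ)) ℤ) (n : ℤ) : Type u :=
  Cochain X (resLeftComplex k B Aᵐᵒᵖ I) n

namespace RightCochain

variable {X : CochainComplex (ModuleCat.{u} B) ℤ}
    {I : CochainComplex (ModuleCat.{u} (B ⊗[k] Aᵐᵒᵖ)) ℤ} {n : ℤ}

instance : AddCommGroup (RightCochain X I n) :=
  inferInstanceAs (AddCommGroup (Cochain X (resLeftComplex k B Aᵐᵒᵖ I) n))

/-- The component `X^p ⟶ I^q`. -/
def v (z : RightCochain X I n) (p q : ℤ) (hpq : p + n = q) :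
    X.X p ⟶ (resLeft k B Aᵐᵒᵖ).obj (I.X q) := Cochain.v z p q hpq

@[ext]
lemma ext {z z' : RightCochain X I n} (h : ∀ p q hpq, z.v p q hpq = z'.v p q hpq) : z = z' :=
  Cochain.ext _ _ h

lemma add_v (z z' : RightCochain X I n) (p q : ℤ) (hpq : p + n = q) :
    (z + z').v p q hpq = z.v p q hpq + z'.v p q hpq := rfl

lemma zero_v (p q : ℤ) (hpq : p + n = q) : (0 : RightCochain X I n).v p q hpq = 0 := rfl

instance : SMul Aᵐᵒᵖ (RightCochain X I n) where
  smul a z := Cochain.comp z (Cochain.ofHom (actHom k B Aᵐᵒᵖ I a)) (add_zero n)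

lemma smul_v (a : Aᵐᵒᵖ) (z : RightCochain X I n) (p q : ℤ) (hpq : p + n = q) :
    (a • z).v p q hpq = z.v p q hpq ≫ (actNat k B Aᵐᵒᵖ a).app (I.X q) :=
  Cochain.comp_zero_cochain_v _ _ _ _ _

instance : Module Aᵐᵒᵖ (RightCochain X I n) where
  one_smul z := by ext1 p q h; rw [smul_v, actNat_one_app, Category.comp_id]
  mul_smul s t z := by
    ext1 p q h; rw [smul_v, smul_v, smul_v, actNat_mul_app, Category.assoc]
  smul_zero s := by ext1 p q h; rw [smul_v, zero_v, zero_comp]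
  smul_add s z z' := by
    ext1 p q h; rw [smul_v, add_v, add_v, smul_v, smul_v, Preadditive.add_comp]
  add_smul s t z := by
    ext1 p q h; rw [smul_v, add_v, smul_v, smul_v, actNat_add_app, Preadditive.comp_add]
  zero_smul z := by ext1 p q h; rw [smul_v, zero_v, EndCochain.actNat_zero_app, comp_zero]

variable (X I) in
/-- The differential of `Hom_B(X, I)`. -/
def diff (n m : ℤ) : RightCochain X I n →ₗ[Aᵐᵒᵖ] RightCochain X I m where
  toFun z := δ n m z
  map_add' _ _ := δ_add _ _ _ _
  map_smul' _ _ := δ_comp_ofHom _ _ _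

attribute [local instance] leftAction rightAction

variable (X I) in
/-- The projection to a component. -/
def proj {n p q : ℤ} (hpq : p + n = q) :
    RightCochain X I n →ₗ[Aᵐᵒᵖ] (X.X p →ₗ[B] I.X q) where
  toFun z := (z.v p q hpq).hom
  map_add' _ _ := rfl
  map_smul' a z := congrArg (fun f => f.hom) (smul_v a z p q hpq)

/-- A `B`-linear map as a morphism to the underlying `B`-module of a bimodule. -/
def toHom {p q : ℤ} (f : X.X p →ₗ[B] I.X q) : X.X p ⟶ (resLeft k B Aᵐᵒᵖ).obj (I.X q) :=
  ModuleCat.ofHom (Y := (resLeft k B Aᵐᵒᵖ).obj (I.X q)) f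

/-- The cochain with a single component. -/
def single {p q : ℤ} (f : X.X p →ₗ[B] I.X q) (n : ℤ) : RightCochain X I n :=
  Cochain.single (L := resLeftComplex k B Aᵐᵒᵖ I) (toHom f) n

lemma single_v {p q : ℤ} (hpq : p + n = q) (f : X.X p →ₗ[B] I.X q) :
    (single f n).v p q hpq = toHom f :=
  Cochain.single_v _ _ _

lemma single_v_of_ne {p q p' q' : ℤ} (hpq' : p' + n = q') (h : p' ≠ p)
    (f : X.X p →ₗ[B] I.X q) : (single f n).v p' q' hpq' = 0 :=
  Cochain.single_v_eq_zero _ _ _ _ _ h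

variable (X I) in
/-- The inclusion of a component. -/
def incl {n p q : ℤ} (hpq : p + n = q) :
    (X.X p →ₗ[B] I.X q) →ₗ[Aᵐᵒᵖ] RightCochain X I n where
  toFun f := single f n
  map_add' f g := by
    refine RightCochain.ext fun p' q' h => ?_
    rw [add_v]
    obtain rfl | hp := eq_or_ne p' p
    · obtain rfl : q' = q := by lia
      rw [single_v, single_v, single_v]
      rfl
    · rw [single_v_of_ne _ hp, single_v_of_ne _ hp, single_v_of_ne _ hp, add_zero]
  map_smul' a f := by
    refine RightCochain.ext fun p' q' h => ?_
    rw [RingHom.id_apply, smul_v]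
    obtain rfl | hp := eq_or_ne p' p
    · obtain rfl : q' = q := by lia
      rw [single_v, single_v]
      rfl
    · rw [single_v_of_ne _ hp, single_v_of_ne _ hp, zero_comp]

lemma proj_incl {p q : ℤ} (hpq : p + n = q) :
    proj X I hpq ∘ₗ incl X I hpq = LinearMap.id :=
  LinearMap.ext fun f => congrArg (fun φ => φ.hom) (single_v hpq f)

lemma proj_incl_of_ne {p q p' q' : ℤ} (hpq : p + n = q) (hpq' : p' + n = q') (h : p' ≠ p) :
    proj X I hpq' ∘ₗ incl X I hpq = 0 :=
  LinearMap.ext fun f => congrArg (fun φ => φ.hom) (single_v_of_ne hpq' h f)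

lemma sum_incl_proj (a b : ℤ) (hX : ∀ p, p < a ∨ b < p → Subsingleton (X.X p)) :
    ∑ p ∈ Finset.Icc a b, incl X I (n := n) (p := p) rfl ∘ₗ proj X I rfl = LinearMap.id := by
  refine LinearMap.ext fun z => RightCochain.ext fun p q hpq => ?_
  subst hpq
  let ev : RightCochain X I n →+ (X.X p ⟶ (resLeft k B Aᵐᵒᵖ).obj (I.X (p + n))) :=
    AddMonoidHom.mk' (fun z => z.v p _ rfl) fun _ _ => rfl
  change ev ((∑ p' ∈ Finset.Icc a b, incl X I (n := n) (p := p') rfl ∘ₗ proj X I rfl) z) = ev z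
  rw [LinearMap.sum_apply, map_sum]
  have h0 (p' : ℤ) (h : p ≠ p') : ev ((incl X I (n := n) (p := p') rfl ∘ₗ proj X I rfl) z) = 0 :=
    single_v_of_ne rfl h _
  have h1 : ev ((incl X I (n := n) (p := p) rfl ∘ₗ proj X I rfl) z) = ev z := single_v rfl _
  by_cases hp : p ∈ Finset.Icc a b
  · rw [Finset.sum_eq_single_of_mem p hp fun p' _ h => h0 p' h.symm, h1]
  · have := hX p (by simp only [Finset.mem_Icc] at hp; lia)
    have (f : X.X p ⟶ (resLeft k B Aᵐᵒᵖ).obj (I.X (p + n))) : f = 0 := by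
      ext x
      rw [Subsingleton.elim x 0, map_zero, map_zero]
    rw [this (ev z), this (∑ _ ∈ _, _)]

variable {N : ModuleCat.{u} A}

/-- The cochain `y ↦ z y ⊗ x`. -/
def tensorRight (z : RightCochain X I n) (x : N) : Cochain X (tensorComplex I N) n :=
  Cochain.comp (G := resLeftComplex k B Aᵐᵒᵖ I) z (Cochain.ofHom (insertHom I x)) (add_zero n)

lemma tensorRight_add (z : RightCochain X I n) (x x' : N) :
    tensorRight z (x + x') = tensorRight z x + tensorRight z x' := by
  unfold tensorRight
  rw [insertHom_add, Cochain.ofHom_add]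
  exact Cochain.comp_add _ _ _ _

lemma add_tensorRight (z z' : RightCochain X I n) (x : N) :
    tensorRight (z + z') x = tensorRight z x + tensorRight z' x :=
  Cochain.add_comp (F := X) (G := resLeftComplex k B Aᵐᵒᵖ I) z z' _ _

lemma tensorRight_v (z : RightCochain X I n) (x : N) (p q : ℤ) (hpq : p + n = q) :
    (tensorRight z x).v p q hpq = z.v p q hpq ≫ (insertHom I x).f q :=
  Cochain.comp_zero_cochain_v (G := resLeftComplex k B Aᵐᵒᵖ I) _ _ _ _ _

lemma δ_tensorRight (m : ℤ) (z : RightCochain X I n) (x : N) :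
    δ n m (tensorRight z x) = tensorRight (diff X I n m z) x :=
  δ_comp_ofHom (G := resLeftComplex k B Aᵐᵒᵖ I) z _ _

lemma op_smul_tensorRight (a : A) (z : RightCochain X I n) (x : N) :
    tensorRight (MulOpposite.op a • z) x = tensorRight z (a • x) := by
  unfold tensorRight
  rw [insertHom_smul, Cochain.ofHom_comp]
  exact Cochain.comp_assoc_of_third_is_zero_cochain _ _ _ _

variable (X I N) in
/-- The map `Hom_B(X, I) ⊗_A N → Hom_B(X, I ⊗_A N)`. -/
def tensorMap (n : ℤ) :
    BalancedTensor ℤ A (RightCochain X I n) N →ₗ[ℤ] Cochain X (tensorComplex I N) n :=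
  lift ℤ A
    (AddMonoidHom.toIntLinearMap
      (AddMonoidHom.mk' (fun z => AddMonoidHom.mk' (tensorRight z) (tensorRight_add z))
        fun z z' => by ext1 x; exact add_tensorRight z z' x))
    (fun z a x => op_smul_tensorRight a z x)

lemma tensorMap_tmul (z : RightCochain X I n) (x : N) :
    tensorMap X I N n (tmul ℤ A z x) = tensorRight z x := rfl

lemma tensorMap_diff (n m : ℤ) (t : BalancedTensor ℤ A (RightCochain X I n) N) :
    tensorMap X I N m (mapL (diff X I n m) N t) = δ n m (tensorMap X I N n t) := by
  induction t using BalancedTensor.induction_on with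
  | h0 => simp
  | htmul z x => exact (δ_tensorRight _ _ _).symm
  | hadd x y hx hy => rw [map_add, map_add, hx, hy, map_add, δ_add]

lemma tensorMap_v {p q : ℤ} (hpq : p + n = q) (t : BalancedTensor ℤ A (RightCochain X I n) N) :
    ((tensorMap X I N n t).v p q hpq).hom = tensorEval _ _ _ (mapL (proj X I hpq) N t) := by
  induction t using BalancedTensor.induction_on with
  | h0 => rw [map_zero, map_zero, map_zero]; rfl
  | htmul z x =>
    rw [tensorMap_tmul, tensorRight_v]
    rfl
  | hadd x y hx hy => rw [map_add, Cochain.add_v, map_add, map_add, ← hx, ← hy]; rfl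

/-- Boundedness of `X` makes the product of the `Hom_B(X^p, I^(p+n))` a finite direct sum, so it
commutes with `- ⊗_A N`; each summand is handled by tensor evaluation. -/
lemma tensorMap_bijective [IsNoetherianRing B] (hN : IsFlat N) [∀ p, Module.Finite B (X.X p)]
    {a b : ℤ} (hX : ∀ p, p < a ∨ b < p → Subsingleton (X.X p)) (n : ℤ) :
    Function.Bijective (tensorMap X I N n) := by
  have hsum (t : BalancedTensor ℤ A (RightCochain X I n) N) :
      ∑ p ∈ Finset.Icc a b, mapL (incl X I (n := n) (p := p) rfl) N
        (mapL (proj X I rfl) N t) = t := by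
    simp only [mapL_mapL]
    rw [sum_mapL, sum_incl_proj a b hX, mapL_id]
  constructor
  · refine (injective_iff_map_eq_zero _).2 fun t ht => ?_
    rw [← hsum t]
    refine Finset.sum_eq_zero fun p _ => ?_
    have h0 : mapL (proj X I (n := n) (p := p) rfl) N t = 0 := by
      refine (tensorEval_injective (B := B) hN) ?_
      rw [← tensorMap_v rfl t, ht, map_zero]
      rfl
    rw [h0, map_zero]
  · intro z
    choose s hs using fun p => (tensorEval_bijective (B := B) hN (X := X.X p) (Y := I.X (p + n))).2
      (z.v p (p + n) rfl).hom
    refine ⟨∑ p ∈ Finset.Icc a b, mapL (incl X I rfl) N (s p), Cochain.ext _ _ fun p q hpq => ?_⟩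
    subst hpq
    by_cases hp : p ∈ Finset.Icc a b
    · refine ModuleCat.hom_ext ?_
      rw [tensorMap_v, map_sum, Finset.sum_eq_single_of_mem p hp, mapL_mapL, proj_incl, mapL_id, hs]
      intro p' _ h
      rw [mapL_mapL, proj_incl_of_ne _ _ h.symm, mapL_zero]
    · have := hX p (by simp only [Finset.mem_Icc] at hp; lia)
      ext x
      rw [Subsingleton.elim x 0, map_zero, map_zero]

lemma diff_diff (n m l : ℤ) (z : RightCochain X I n) :
    diff X I m l (diff X I n m z) = 0 :=
  δ_δ (F := X) (G := resLeftComplex k B Aᵐᵒᵖ I) n m l z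

/-- A morphism to `I`, as a cochain of degree `0`. -/
def ofHom (j : X ⟶ resLeftComplex k B Aᵐᵒᵖ I) : RightCochain X I 0 := Cochain.ofHom j

/-- A morphism to `I` followed by the right multiplications by elements of `A`. -/
def multiplications (j : X ⟶ resLeftComplex k B Aᵐᵒᵖ I) : A →ₗ[Aᵐᵒᵖ] RightCochain X I 0 where
  toFun a := MulOpposite.op a • ofHom j
  map_add' a a' := by rw [MulOpposite.op_add, add_smul]
  map_smul' c a := by
    rw [RingHom.id_apply, ← mul_smul]
    rfl

lemma multiplications_apply (j : X ⟶ resLeftComplex k B Aᵐᵒᵖ I) (a : A) :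
    multiplications j a = MulOpposite.op a • ofHom j := rfl

lemma tensorMap_multiplications (j : X ⟶ resLeftComplex k B Aᵐᵒᵖ I) (x : N) :
    tensorMap X I N 0 (mapL (multiplications j) N (tmul ℤ A 1 x)) =
      (Cochain.ofHom j).comp (Cochain.ofHom (insertHom I x)) (add_zero 0) := by
  change tensorRight (multiplications j 1) x = _
  rw [multiplications_apply, MulOpposite.op_one, one_smul]
  rfl

lemma exists_eq_one_tmul (t : BalancedTensor ℤ A A N) : ∃ x : N, t = tmul ℤ A (1 : A) x := by
  induction t using BalancedTensor.induction_on with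
  | h0 => exact ⟨0, (tmul_zero ..).symm⟩
  | htmul a x =>
    exact ⟨a • x, by rw [← op_smul_tmul, op_smul_eq_mul, one_mul]⟩
  | hadd s t hs ht =>
    obtain ⟨x, rfl⟩ := hs
    obtain ⟨y, rfl⟩ := ht
    exact ⟨x + y, (tmul_add ..).symm⟩

lemma eq_zero_of_one_tmul (x : N) (hx : tmul ℤ A (1 : A) x = 0) : x = 0 := by
  have h := congrArg (lift (P := N) ℤ A
    (AddMonoidHom.toIntLinearMap
      (AddMonoidHom.mk' (fun a : A => DistribSMul.toAddMonoidHom N a) fun a b => by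
        ext y; exact add_smul a b y))
    (fun a b y => mul_smul a b y)) hx
  exact (one_smul A x).symm.trans (h.trans (map_zero _))

/-- Through `tensorMap`, the complex `Hom_B(X, I ⊗_A N)` is `Hom_B(X, I) ⊗_A N`. Since `N` is flat,
its cohomology is `A ⊗_A N = N`, in degree zero. -/
lemma isAug_tensor [IsNoetherianRing B] (hN : IsFlat N) [∀ p, Module.Finite B (X.X p)]
    {a b : ℤ} (hX : ∀ p, p < a ∨ b < p → Subsingleton (X.X p))
    (j : X ⟶ resLeftComplex k B Aᵐᵒᵖ I)
    (H : IsAug (K := X) (L := resLeftComplex k B Aᵐᵒᵖ I) (fun a : A => multiplications j a)) :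
    IsAug (K := X) (L := tensorComplex I N) (fun x : N =>
      (Cochain.ofHom j).comp (Cochain.ofHom (insertHom I x)) (add_zero 0)) := by
  have hb := tensorMap_bijective (I := I) hN hX
  -- With `Q` the cokernel of the differential into degree zero, the hypothesis on `H⁰` becomes
  -- exactness of `0 → A → Q → Hom¹`, a form to which flatness applies directly.
  obtain ⟨Q, _, _, q, d', hq, hqs, hd'⟩ : ∃ (Q : Type u) (_ : AddCommGroup Q) (_ : Module Aᵐᵒᵖ Q)
      (q : RightCochain X I 0 →ₗ[Aᵐᵒᵖ] Q) (d' : Q →ₗ[Aᵐᵒᵖ] RightCochain X I 1),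
      Function.Exact (diff X I (-1) 0) q ∧ Function.Surjective q ∧ d' ∘ₗ q = diff X I 0 1 :=
    ⟨_ ⧸ LinearMap.range (diff X I (-1) 0), inferInstance, inferInstance, Submodule.mkQ _,
      Submodule.liftQ _ (diff X I 0 1) (by rintro _ ⟨w, rfl⟩; exact diff_diff _ _ _ w),
      LinearMap.exact_map_mkQ_range _, Submodule.mkQ_surjective _, Submodule.liftQ_mkQ _ _ _⟩
  have hd'' (z : RightCochain X I 0) : d' (q z) = diff X I 0 1 z := LinearMap.congr_fun hd' z
  have hinj : Function.Injective (q ∘ₗ multiplications j) := by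
    refine (injective_iff_map_eq_zero _).2 fun a ha => ?_
    obtain ⟨w, hw⟩ := (hq _).1 ha
    exact H.injective a w hw
  have hexact : Function.Exact (q ∘ₗ multiplications j) d' := by
    intro y
    obtain ⟨z, rfl⟩ := hqs y
    rw [hd'']
    constructor
    · intro hz
      obtain ⟨a, (w : RightCochain X I (-1)), hw⟩ := H.surjective z hz
      have : z = multiplications j a + diff X I (-1) 0 w := hw
      exact ⟨a, by rw [this, map_add, hq.apply_apply_eq_zero, add_zero]; rfl⟩
    · rintro ⟨a, ha⟩
      rw [← hd'', ← ha]
      exact (hd'' _).trans (H.cocycle a)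
  refine ⟨fun x => ?_, fun x w hw => ?_, fun z hz => ?_, fun n hn z hz => ?_⟩
  · rw [← Cochain.ofHom_comp, δ_ofHom]
  · obtain ⟨r, rfl⟩ := (hb (-1)).2 w
    rw [← tensorMap_diff, ← tensorMap_multiplications] at hw
    have h := congrArg (mapL q N) ((hb 0).1 hw)
    rw [mapL_mapL, mapL_mapL, hq.linearMap_comp_eq_zero, mapL_zero] at h
    exact eq_zero_of_one_tmul x (hN.mapL_injective hinj (h.symm.trans (map_zero _).symm))
  · obtain ⟨t, rfl⟩ := (hb 0).2 z
    rw [← tensorMap_diff] at hz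
    have ht := (hb 1).1 (hz.trans (map_zero _).symm)
    obtain ⟨s, hs⟩ := hN.mapL_exact hexact (mapL q N t) (by rw [mapL_mapL, hd', ht])
    obtain ⟨x, rfl⟩ := exists_eq_one_tmul s
    obtain ⟨r, hr⟩ := mapL_exact_of_surjective hq hqs
      (t - mapL (multiplications j) N (tmul ℤ A 1 x)) (by
        rw [map_sub, mapL_mapL, hs, sub_self])
    refine ⟨x, tensorMap X I N (-1) r, ?_⟩
    rw [← tensorMap_diff, hr, map_sub, tensorMap_multiplications, add_sub_cancel]
  · obtain ⟨t, rfl⟩ := (hb n).2 z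
    rw [← tensorMap_diff] at hz
    have ht := (hb (n + 1)).1 (hz.trans (map_zero _).symm)
    have hex : Function.Exact (diff X I (n - 1) n) (diff X I n (n + 1)) := fun y =>
      ⟨fun hy => H.homVanish n hn y hy, by rintro ⟨w, rfl⟩; exact diff_diff _ _ _ w⟩
    obtain ⟨s, rfl⟩ := hN.mapL_exact hex t ht
    exact ⟨_, (tensorMap_diff _ _ s).symm⟩

end RightCochain

end RightCochain

/-! ### The isomorphism of a flat module `N` with `RHom_B(D, D ⊗ᴸ_A N)` -/

section Duality

variable {k : Type v} [Field k] {A B : Type u} [Ring A] [Ring B] [Algebra k A] [Algebra k B]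
  (D I : CochainComplex (ModuleCat.{u} (B ⊗[k] Aᵐᵒᵖ)) ℤ)

attribute [local instance] leftAction rightAction in
lemma injective_tensorFunctor [IsNoetherianRing B] (Y : ModuleCat.{u} (B ⊗[k] Aᵐᵒᵖ))
    (hY : Injective ((resLeft k B Aᵐᵒᵖ).obj Y)) {N : ModuleCat.{u} A} (hN : IsFlat N) :
    Injective (((tensorFunctor k A B).obj Y).obj N) :=
  (Module.injective_iff_injective_object B _).1 (injective_balancedTensor Y hN
    ((Module.injective_iff_injective_object B _).2 hY))

lemma multiplications_id (a : A) : RightCochain.multiplications (𝟙 (resLeftComplex k B Aᵐᵒᵖ I)) a =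
    (EndCochain.homothety I (MulOpposite.op a) :
      Cochain (resLeftComplex k B Aᵐᵒᵖ I) (resLeftComplex k B Aᵐᵒᵖ I) 0) :=
  Cochain.id_comp (Cochain.ofHom (actHom k B Aᵐᵒᵖ I (MulOpposite.op a)))

variable (N : ModuleCat.{u} A) in
/-- The map `N ⟶ Hom_B(I, I ⊗_A N)`, `x ↦ (y ↦ y ⊗ x)`. -/
def insertLinear : N →ₗ[A] HomCochain I (tensorComplex I N) 0 where
  toFun x := Cochain.ofHom (insertHom I x)
  map_add' x y := by
    rw [insertHom_add, Cochain.ofHom_add]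
    rfl
  map_smul' a x := by
    rw [insertHom_smul, Cochain.ofHom_comp]
    rfl

variable {D I} in
-- The homothety hypothesis concerns `Hom_B(I, I)`. It is moved to a bounded finitely generated
-- subcomplex `X` of `I`, tensored there with `N`, and moved back to `I` and then to `D`. The return
-- is possible because `I ⊗_A N` is a bounded below complex of injective `B`-modules, hence
-- K-injective.
lemma exists_quasiIso_homComplex [IsNoetherianRing B] (ι : D ⟶ I) [QuasiIso ι] (a : ℤ)
    [I.IsStrictlyGE a] (hI : ∀ i, Injective (I.X i)) (h : QuasiIso (homothetyMap I))
    {a' b : ℤ} (hb : ∀ i, (i < a' ∨ b < i) → IsZero (D.homology i))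
    (hfin : ∀ i, Module.Finite B ((resLeft k B Aᵐᵒᵖ).obj (D.homology i)))
    {N : ModuleCat.{u} A} (hN : IsFlat N) :
    ∃ f : (HomologicalComplex.single _ (ComplexShape.up ℤ) 0).obj N ⟶
      homComplex D (tensorComplex I N), QuasiIso f := by
  have hinj (i : ℤ) : Injective ((resLeftComplex k B Aᵐᵒᵖ I).X i) :=
    injective_resLeft k B Aᵐᵒᵖ (I.X i)
  have : (resLeftComplex k B Aᵐᵒᵖ I).IsKInjective := isKInjective_of_injective _ a
  have (i : ℤ) : Injective ((tensorComplex I N).X i) :=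
    injective_tensorFunctor _ (hinj i) hN
  have : (tensorComplex I N).IsKInjective := isKInjective_of_injective _ a
  have (i : ℤ) : Module.Finite B ((resLeft k B Aᵐᵒᵖ).obj (I.homology i)) :=
    Module.Finite.equiv ((resLeft k B Aᵐᵒᵖ).mapIso (isoOfQuasiIsoAt ι i)).toLinearEquiv
  obtain ⟨X, j, hj, hXfin, hX⟩ := exists_finite_subcomplex (resLeftComplex k B Aᵐᵒᵖ I) a b
    (fun p => exists_fg_cocycles I p) (fun p hp x hx => by
      have hI0 : I.ExactAt p := (I.exactAt_iff_isZero_homology p).2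
        ((hb p (Or.inr hp)).of_iso (isoOfQuasiIsoAt ι p).symm)
      exact (exactAt_iff_elements I (i := p - 1) (k := p + 1) (by simp) (by simp)).1 hI0 x hx)
  have h1 := (quasiIso_mkHomFromSingle_iff _ _).1 h
  have H1 : IsAug (K := resLeftComplex k B Aᵐᵒᵖ I) (L := resLeftComplex k B Aᵐᵒᵖ I)
      (fun a : A => RightCochain.multiplications (𝟙 _) a) := by
    simp only [multiplications_id]
    refine ⟨fun x => δ_ofHom _, fun x w hw => ?_, fun z hz => ?_, fun n hn z hz =>
      h1.2.2 n hn z hz⟩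
    · exact MulOpposite.op_injective (h1.1 (MulOpposite.op x) ⟨w, hw⟩)
    · obtain ⟨(p : Aᵐᵒᵖ), y, h⟩ := h1.2.1 z hz
      exact ⟨p.unop, y, h⟩
  have H2 : IsAug (K := X) (L := resLeftComplex k B Aᵐᵒᵖ I)
      (fun a : A => RightCochain.multiplications j a) := by
    refine (IsAug.iff_of_quasiIso j H1.cocycle fun x => ?_).1 H1
    exact congrArg (Cochain.comp (Cochain.ofHom j) · (zero_add 0)) (Cochain.id_comp _).symm
  have H3 := RightCochain.isAug_tensor hN hX j H2
  have H4 : IsAug (K := resLeftComplex k B Aᵐᵒᵖ I) (L := tensorComplex I N)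
      (fun x : N => Cochain.ofHom (insertHom I x)) :=
    (IsAug.iff_of_quasiIso j (fun x => δ_ofHom _) fun x => rfl).2 H3
  have H5 : IsAug (K := resLeftComplex k B Aᵐᵒᵖ D) (L := tensorComplex I N)
      (fun x : N => (Cochain.ofHom (((resLeft k B Aᵐᵒᵖ).mapHomologicalComplex _).map ι)).comp
        (Cochain.ofHom (insertHom I x)) (zero_add 0)) :=
    (IsAug.iff_of_quasiIso _ H4.cocycle fun x => rfl).1 H4
  let f : N ⟶ (homComplex D (tensorComplex I N)).X 0 :=
    ModuleCat.ofHom (Y := HomCochain I (tensorComplex I N) 0) (insertLinear I N) ≫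
      (homComplexMap ι (tensorComplex I N)).f 0
  have hf (n : ℤ) (hn : (ComplexShape.up ℤ).Rel 0 n) :
      f ≫ (homComplex D (tensorComplex I N)).d 0 n = 0 := by
    obtain rfl : 1 = n := by simpa using hn
    exact ModuleCat.hom_ext (LinearMap.ext fun x => H5.cocycle x)
  refine ⟨HomologicalComplex.mkHomFromSingle f hf, (quasiIso_mkHomFromSingle_iff f hf).2
    ⟨fun x ⟨w, hw⟩ => H5.injective x w hw, fun z hz => H5.surjective z hz,
      fun n hn z hz => H5.homVanish n hn z hz⟩⟩

end Duality

/-! ### Exactness of tensor products with flat modules -/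

section FlatExact

variable {k : Type v} [Field k] {A B : Type u} [Ring A] [Ring B] [Algebra k A] [Algebra k B]

attribute [local instance] leftAction rightAction in
lemma preservesHomology_of_isFlat {N : ModuleCat.{u} A} (hN : IsFlat N) :
    ((tensorFunctor k A B).flip.obj N).PreservesHomology := by
  refine ((Functor.exact_tfae _).out 1 2).1 fun S hS => ?_
  rw [ShortComplex.moduleCat_exact_iff] at hS ⊢
  intro (t : BalancedTensor B A S.X₂ N) ht
  obtain ⟨t, rfl⟩ := (ofInt_bijective B A).2 t
  let f : S.X₁ →ₗ[Aᵐᵒᵖ] S.X₂ :=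
    { toFun := S.f.hom
      map_add' := map_add _
      map_smul' := fun a x => S.f.hom.map_smul ((1 : B) ⊗ₜ[k] a) x }
  let g : S.X₂ →ₗ[Aᵐᵒᵖ] S.X₃ :=
    { toFun := S.g.hom
      map_add' := map_add _
      map_smul' := fun a x => S.g.hom.map_smul ((1 : B) ⊗ₜ[k] a) x }
  have hfg : Function.Exact f g := fun y =>
    ⟨fun hy => hS y hy, by rintro ⟨x, rfl⟩; exact congrArg (fun φ => φ.hom x) S.zero⟩
  obtain ⟨s, rfl⟩ := hN.mapL_exact hfg t ((ofInt_bijective B A).1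
    (((ofInt_map B A
      { toFun := S.g.hom
        map_add' := map_add _
        map_smul' := fun b x => S.g.hom.map_smul (b ⊗ₜ[k] (1 : Aᵐᵒᵖ)) x } _ _ t).trans ht).trans
      (map_zero _).symm))
  exact ⟨ofInt B A s, (ofInt_map B A
      { toFun := S.f.hom
        map_add' := map_add _
        map_smul' := fun b x => S.f.hom.map_smul (b ⊗ₜ[k] (1 : Aᵐᵒᵖ)) x } _ _ s).symm⟩

/-- The functoriality of `I ⊗_A N` in `I`. -/
abbrev tensorComplexMap {I I' : CochainComplex (ModuleCat.{u} (B ⊗[k] Aᵐᵒᵖ)) ℤ} (s : I ⟶ I')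
    (N : ModuleCat.{u} A) : tensorComplex I N ⟶ tensorComplex I' N :=
  (((tensorFunctor k A B).flip.obj N).mapHomologicalComplex _).map s

lemma quasiIso_tensorComplexMap {I I' : CochainComplex (ModuleCat.{u} (B ⊗[k] Aᵐᵒᵖ)) ℤ} (s : I ⟶ I')
    [QuasiIso s] {N : ModuleCat.{u} A} (hN : IsFlat N) : QuasiIso (tensorComplexMap s N) := by
  have := preservesHomology_of_isFlat (k := k) (B := B) hN
  infer_instance

end FlatExact

/-! ### Truncation -/

section Truncation

variable {C : Type*} [Category* C] [Abelian C]

/-- Here `Z` is the object of `n`-cocycles. On it, the homotopy `h` writes the inclusion `i` as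
`e.inv ∘ e.hom ∘ i` minus `d ∘ h ∘ i`. The first term passes through the injective `J^n` and the
second through the injective `I^(n-1)`, so maps into `Z` extend. -/
lemma injective_cycles_of_homotopyEquiv {I J : CochainComplex C ℤ} (e : HomotopyEquiv I J) (n : ℤ)
    (hJ : IsZero (J.X (n + 1))) [Injective (J.X n)] [Injective (I.X (n - 1))] {Z : C}
    (i : Z ⟶ I.X n) [Mono i] (hi : i ≫ I.d n (n + 1) = 0)
    (hlift : ∀ {Y : C} (g : Y ⟶ I.X n), g ≫ I.d n (n + 1) = 0 → ∃ l, l ≫ i = g) :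
    Injective Z := by
  refine ⟨fun {X Y} f m _ => ?_⟩
  let h := e.homotopyHomInvId
  have hc : e.hom.f n ≫ e.inv.f n =
      I.d n (n + 1) ≫ h.hom (n + 1) n + h.hom n (n - 1) ≫ I.d (n - 1) n + 𝟙 _ := by
    have := h.comm n
    rwa [dNext_eq _ (show (ComplexShape.up ℤ).Rel n (n + 1) from rfl),
      prevD_eq _ (show (ComplexShape.up ℤ).Rel (n - 1) n by simp)] at this
  have hc' : i ≫ e.hom.f n ≫ e.inv.f n = i ≫ h.hom n (n - 1) ≫ I.d (n - 1) n + i := by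
    rw [hc, Preadditive.comp_add, Preadditive.comp_add, ← Category.assoc i (I.d n (n + 1)), hi,
      zero_comp, zero_add, Category.comp_id]
  -- The combined extension lands in the cocycles because `J^(n+1) = 0` and `d ∘ d = 0`.
  obtain ⟨l, hl⟩ := hlift (Injective.factorThru (f ≫ i ≫ e.hom.f n) m ≫ e.inv.f n -
    Injective.factorThru (f ≫ i ≫ h.hom n (n - 1)) m ≫ I.d (n - 1) n) (by
      rw [Preadditive.sub_comp, Category.assoc, Category.assoc, e.inv.comm, I.d_comp_d,
        hJ.eq_of_tgt (J.d n (n + 1)) 0, zero_comp, comp_zero, comp_zero, sub_zero])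
  refine ⟨l, ?_⟩
  rw [← cancel_mono i, Category.assoc, hl, Preadditive.comp_sub, Injective.comp_factorThru_assoc,
    Injective.comp_factorThru_assoc, Category.assoc, Category.assoc, Category.assoc, Category.assoc,
    hc', Preadditive.comp_add, add_sub_cancel_left]

end Truncation

/-! ### Truncation of complexes of modules -/

section TruncationModule

variable {R : Type u} [Ring R] (I : CochainComplex (ModuleCat.{u} R) ℤ) (d : ℤ)

open Classical in
/-- The submodules which form the truncation of a complex in degrees at most `d`. -/
def truncSubmodule (p : ℤ) : Submodule R (I.X p) :=
  if p < d then ⊤ else if p = d then LinearMap.ker (I.d p (p + 1)).hom else ⊥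

lemma truncSubmodule_of_lt {p : ℤ} (h : p < d) : truncSubmodule I d p = ⊤ := if_pos h

lemma truncSubmodule_self : truncSubmodule I d d = LinearMap.ker (I.d d (d + 1)).hom := by
  rw [truncSubmodule, if_neg (lt_irrefl d), if_pos rfl]

lemma truncSubmodule_of_gt {p : ℤ} (h : d < p) : truncSubmodule I d p = ⊥ := by
  rw [truncSubmodule, if_neg (by lia), if_neg (by lia)]

lemma d_mem_truncSubmodule (p q : ℤ) (x : I.X p) (hx : x ∈ truncSubmodule I d p) :
    (I.d p q).hom x ∈ truncSubmodule I d q := by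
  by_cases hpq : p + 1 = q
  · subst hpq
    obtain h | h | h := lt_trichotomy p d
    · obtain h | rfl := (show p + 1 ≤ d by lia).lt_or_eq
      · rw [truncSubmodule_of_lt I d h]; trivial
      · rw [truncSubmodule_self]
        exact congrArg (fun f => f.hom x) (I.d_comp_d p (p + 1) (p + 1 + 1))
    · subst h
      rw [truncSubmodule_self] at hx
      rw [show (I.d p (p + 1)).hom x = 0 from hx]
      exact zero_mem _
    · rw [truncSubmodule_of_gt I d h, Submodule.mem_bot] at hx
      rw [hx, map_zero]
      exact zero_mem _
  · rw [I.shape p q hpq]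
    exact zero_mem _

/-- The truncation in degrees at most `d`. -/
abbrev truncComplex : CochainComplex (ModuleCat.{u} R) ℤ :=
  subcomplex I (truncSubmodule I d) (d_mem_truncSubmodule I d)

/-- The inclusion of the truncation. -/
abbrev truncComplexι : truncComplex I d ⟶ I :=
  subcomplexι I (truncSubmodule I d) (d_mem_truncSubmodule I d)

instance (a : ℤ) [I.IsStrictlyGE a] : (truncComplex I d).IsStrictlyGE a := by
  rw [isStrictlyGE_iff]
  intro i hi
  have := ModuleCat.subsingleton_of_isZero (I.isZero_of_isStrictlyGE a i hi)
  exact ModuleCat.isZero_of_iff_subsingleton.2 (inferInstanceAs (Subsingleton (truncSubmodule I d i)))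

lemma isZero_truncComplex_X (p : ℤ) (h : d < p) : IsZero ((truncComplex I d).X p) := by
  refine ModuleCat.isZero_of_iff_subsingleton.2 ?_
  change Subsingleton (truncSubmodule I d p)
  rw [truncSubmodule_of_gt I d h]
  infer_instance

lemma quasiIso_truncComplexι (hI : ∀ p, d < p → I.ExactAt p) : QuasiIso (truncComplexι I d) := by
  refine (quasiIso_iff_elements _).2 fun n => ⟨?_, fun x hx => ?_⟩
  · rintro ⟨x, hx⟩ - ⟨y, rfl⟩
    obtain h | h := le_or_gt n d
    · exact ⟨⟨y, by rw [truncSubmodule_of_lt I d (by lia)]; trivial⟩, rfl⟩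
    · rw [truncSubmodule_of_gt I d h, Submodule.mem_bot] at hx
      exact ⟨0, Subtype.ext ((map_zero _).trans hx.symm)⟩
  · obtain h | h | h := lt_trichotomy n d
    · exact ⟨⟨x, by rw [truncSubmodule_of_lt I d h]; trivial⟩, 0, Subtype.ext hx, by simp; rfl⟩
    · subst h
      exact ⟨⟨x, by rw [truncSubmodule_self]; exact hx⟩, 0, Subtype.ext hx, by simp; rfl⟩
    · obtain ⟨y, rfl⟩ := (exactAt_iff_elements I (i := n - 1) (k := n + 1) (by simp) (by simp)).1
        (hI n h) x hx
      exact ⟨0, y, map_zero _, by rw [map_zero, zero_add]⟩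

end TruncationModule

/-! ### Comparison of injective resolutions and vanishing by degree -/

section HomotopyEquivalence

variable {C : Type*} [Category* C] [Abelian C]

lemma nonempty_homotopyEquiv {D I J : CochainComplex C ℤ} (ι : D ⟶ I) (ι' : D ⟶ J) [QuasiIso ι]
    [QuasiIso ι'] [I.IsKInjective] [J.IsKInjective] : Nonempty (HomotopyEquiv I J) := by
  obtain ⟨y, w, hy, hw⟩ := exists_extension_of_quasiIso ι 0 (Cochain.ofHom ι') (δ_ofHom _)
  obtain ⟨φ, rfl⟩ : ∃ φ : I ⟶ J, y = Cochain.ofHom φ :=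
    ⟨(Cocycle.mk y 1 rfl hy).homOf, (Cocycle.cochain_ofHom_homOf_eq_coe (Cocycle.mk y 1 rfl hy)).symm⟩
  rw [← Cochain.ofHom_comp, add_comm] at hw
  have h : Homotopy ι' (ι ≫ φ) := (Cochain.equivHomotopy _ _).symm ⟨w, hw⟩
  have : QuasiIso (ι ≫ φ) := by
    refine (quasiIso_iff _).2 fun i => ?_
    rw [quasiIsoAt_iff_isIso_homologyMap, ← h.homologyMap_eq]
    infer_instance
  have := quasiIso_of_comp_left ι φ
  obtain ⟨e, -⟩ := (IsKInjective.quasiIso_iff φ).1 this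
  exact ⟨e⟩

/-- Maps from a complex with cohomology in degrees at least `m` to a complex of injective objects
in degrees at most `d`. -/
lemma homVanish_of_exactAt {K L : CochainComplex C ℤ} (a m d n : ℤ) [L.IsStrictlyGE a]
    [L.IsStrictlyLE d] (hL : ∀ i, Injective (L.X i)) (hK : ∀ p, p < m → K.ExactAt p)
    (hn : d - m < n) : HomVanish K L n := by
  refine homVanish_of_extension n a fun p q hpq u hu => ?_
  -- If `q ≤ d`, then `p = q - n < m`, so `K` is exact at `p` and maps to the injective `L^q`
  -- extend; otherwise `L^q = 0`.
  obtain hq | hq := le_or_gt q d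
  · have h := (K.exactAt_iff' (p - 1) p (p + 1) (by simp) (by simp)).1 (hK p (by lia))
    exact ⟨h.descToInjective u hu, h.comp_descToInjective u hu⟩
  · exact ⟨0, (L.isZero_of_isStrictlyLE d q hq).eq_of_tgt _ _⟩

end HomotopyEquivalence

/-! ### Vanishing of maps into flat modules -/

section Vanishing

variable {k : Type v} [Field k] {A B : Type u} [Ring A] [Ring B] [Algebra k A] [Algebra k B]
  {D I : CochainComplex (ModuleCat.{u} (B ⊗[k] Aᵐᵒᵖ)) ℤ}

/-- Only degree `d` needs an argument: the term there is the module of cocycles, and over `B` the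
complex `I` is homotopy equivalent to one that stops at `d`. -/
lemma injective_truncComplex_X (hI : ∀ i, Injective ((resLeftComplex k B Aᵐᵒᵖ I).X i))
    {J : CochainComplex (ModuleCat.{u} B) ℤ} (hJ : ∀ i, Injective (J.X i)) (d : ℤ)
    [J.IsStrictlyLE d] (e : HomotopyEquiv (resLeftComplex k B Aᵐᵒᵖ I) J) (p : ℤ) :
    Injective ((resLeft k B Aᵐᵒᵖ).obj ((truncComplex I d).X p)) := by
  obtain h | rfl | h := lt_trichotomy p d
  · have : IsIso ((truncComplexι I d).f p) := by
      rw [ConcreteCategory.isIso_iff_bijective]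
      exact ⟨Subtype.val_injective, fun x =>
        ⟨⟨x, by rw [truncSubmodule_of_lt I d h]; trivial⟩, rfl⟩⟩
    exact Injective.of_iso ((resLeft k B Aᵐᵒᵖ).mapIso (asIso ((truncComplexι I d).f p))).symm (hI p)
  · let i : (resLeft k B Aᵐᵒᵖ).obj ((truncComplex I p).X p) ⟶ (resLeftComplex k B Aᵐᵒᵖ I).X p :=
      (resLeft k B Aᵐᵒᵖ).map ((truncComplexι I p).f p)
    have : Mono i := (ModuleCat.mono_iff_injective _).2 Subtype.val_injective
    refine injective_cycles_of_homotopyEquiv e p (J.isZero_of_isStrictlyLE p _ (by lia)) i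
      ?_ fun {Y} g hg => ?_
    · refine ModuleCat.hom_ext (LinearMap.ext fun x => ?_)
      exact (truncSubmodule_self I p).le x.2
    · have hmem (y : Y) : (show I.X p from g.hom y) ∈ truncSubmodule I p p := by
        rw [truncSubmodule_self]
        exact congrArg (fun φ => φ.hom y) hg
      refine ⟨ModuleCat.ofHom (Y := (resLeft k B Aᵐᵒᵖ).obj ((truncComplex I p).X p))
        { toFun := fun y => ⟨g.hom y, hmem y⟩
          map_add' := fun y y' => Subtype.ext (map_add g.hom y y')
          map_smul' := fun b y => Subtype.ext (map_smul g.hom b y) }, rfl⟩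
  · have := (resLeft k B Aᵐᵒᵖ).map_isZero (isZero_truncComplex_X I d p h)
    exact Injective.of_iso this.isoZero.symm inferInstance

variable [IsNoetherianRing B]

/-- An injective resolution `I` of a dualizing complex computes `RHom_B(D, D ⊗ᴸ_A N) ≅ N` for flat
`N`, and its truncations in degrees at least `id_B D` are injective over `B`. -/
lemma IsDualizingComplex.exists_resolutions (hD : IsDualizingComplex k A B D) :
    ∃ (I : CochainComplex (ModuleCat.{u} (B ⊗[k] Aᵐᵒᵖ)) ℤ) (a : ℤ) (ι : D ⟶ I),
      QuasiIso ι ∧ I.IsStrictlyGE a ∧ (∀ i, Injective ((resLeft k B Aᵐᵒᵖ).obj (I.X i))) ∧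
      (∀ N : ModuleCat.{u} A, IsFlat N →
        ∃ f : (HomologicalComplex.single _ (ComplexShape.up ℤ) 0).obj N ⟶
          homComplex D (tensorComplex I N), QuasiIso f) ∧
      ∀ d, InjDimLE (resLeftComplex k B Aᵐᵒᵖ D) d → QuasiIso (truncComplexι I d) ∧
        ∀ i, Injective ((resLeft k B Aᵐᵒᵖ).obj ((truncComplex I d).X i)) := by
  obtain ⟨I, ι, a, hι, hI, ha, h⟩ := hD.homothety_right
  obtain ⟨a', b, hb⟩ := hD.bounded
  have hinj (i : ℤ) : Injective ((resLeftComplex k B Aᵐᵒᵖ I).X i) :=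
    injective_resLeft k B Aᵐᵒᵖ (I.X i)
  refine ⟨I, a, ι, hι, ha, hinj, fun N hN =>
    exists_quasiIso_homComplex ι a hI h hb hD.finite_left hN, ?_⟩
  rintro d ⟨J, ι', a'', hι', hJ, hJa, hJd⟩
  have : (resLeftComplex k B Aᵐᵒᵖ I).IsKInjective := isKInjective_of_injective _ a
  have : J.IsKInjective := isKInjective_of_injective _ a''
  -- Over `B`, both `I` and the complex `J` that bounds the injective dimension are K-injective
  -- resolutions of `D`.
  obtain ⟨e⟩ := nonempty_homotopyEquiv
    (((resLeft k B Aᵐᵒᵖ).mapHomologicalComplex _).map ι) ι'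
  refine ⟨quasiIso_truncComplexι I d fun p hp => ?_, injective_truncComplex_X hinj hJ d e⟩
  have h1 : J.ExactAt p :=
    (J.exactAt_iff p).2 (ShortComplex.exact_of_isZero_X₂ _ (J.isZero_of_isStrictlyLE d p hp))
  have h2 := (exactAt_iff_of_quasiIsoAt ι' p).2 h1
  have h3 := (exactAt_iff_of_quasiIsoAt
    (((resLeft k B Aᵐᵒᵖ).mapHomologicalComplex _).map ι) p).1 h2
  rw [exactAt_iff_elements _ (i := p - 1) (k := p + 1) (by simp) (by simp)] at h3 ⊢
  exact h3

/-- Replace `N` by `Hom_B(D, I ⊗_A N)` along `f`, pass by adjunction to maps `D ⊗_A Q → I ⊗_A N`,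
and replace `I` by its truncation. The source is then exact below `m` and the target consists of
injectives in degrees at most `d`. -/
lemma homVanish_single {a m d n : ℤ} (ι : D ⟶ I) [QuasiIso ι] [I.IsStrictlyGE a]
    (hI : ∀ i, Injective ((resLeft k B Aᵐᵒᵖ).obj (I.X i)))
    (hq : QuasiIso (truncComplexι I d))
    (hT : ∀ i, Injective ((resLeft k B Aᵐᵒᵖ).obj ((truncComplex I d).X i)))
    {N : ModuleCat.{u} A} (hN : IsFlat N)
    (f : (HomologicalComplex.single _ (ComplexShape.up ℤ) 0).obj N ⟶
      homComplex D (tensorComplex I N)) [QuasiIso f]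
    (Q : CochainComplex (ModuleCat.{u} A) ℤ) [Q.IsKProjective]
    (hQ : ∀ p, p < m → (totalTensor D Q).ExactAt p) (hn : d - m < n) :
    HomVanish Q ((HomologicalComplex.single _ (ComplexShape.up ℤ) 0).obj N) n := by
  have hLE : (tensorComplex (truncComplex I d) N).IsStrictlyLE d := by
    rw [isStrictlyLE_iff]
    exact fun i hi => ((tensorFunctor k A B).flip.obj N).map_isZero (isZero_truncComplex_X I d i hi)
  have h1 (i : ℤ) : Injective ((tensorComplex (truncComplex I d) N).X i) :=
    injective_tensorFunctor _ (hT i) hN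
  have h2 (i : ℤ) : Injective ((tensorComplex I N).X i) := injective_tensorFunctor _ (hI i) hN
  have : (tensorComplex I N).IsKInjective := isKInjective_of_injective _ a
  have : (tensorComplex (truncComplex I d) N).IsKInjective := isKInjective_of_injective _ a
  have := quasiIso_tensorComplexMap (truncComplexι I d) hN
  rw [homVanish_iff_of_isKProjective f, ← homVanish_totalTensor_iff]
  exact (homVanish_of_exactAt a m d n h1 hQ hn).of_quasiIso
    (tensorComplexMap (truncComplexι I d) N)

end Vanishing

/-! ### Detection of exactness by maps to injective objects -/

section Detection

variable {C : Type*} [Category* C] [Abelian C]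

/-- Test with an injective object containing the cokernel of the incoming differential. The induced
map from `K^p` is a cocycle of degree `-p`; being a coboundary, it factors through the outgoing
differential, so cocycles vanish in that cokernel. -/
lemma exactAt_of_homVanish [EnoughInjectives C] (K : CochainComplex C ℤ) (p : ℤ)
    (h : ∀ J : C, Injective J → HomVanish K ((singleFunctor C 0).obj J) (-p)) : K.ExactAt p := by
  let q := cokernel.π (K.d (p - 1) p)
  let u : K.X p ⟶ Injective.under (cokernel (K.d (p - 1) p)) := q ≫ Injective.ι _
  have hu : K.d (p - 1) p ≫ u = 0 := by simp [u, q]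
  have hpp : p + -p = 0 := by lia
  obtain ⟨w, hw⟩ := h _ inferInstance (Cocycle.toSingleMk u hpp (p - 1) (by lia) hu).1
    (by exact (Cocycle.toSingleMk u hpp (p - 1) (by lia) hu).δ_eq_zero _)
  have hmem : Cocycle.toSingleMk u hpp (p - 1) (by lia) hu ∈ coboundaries K _ (-p) :=
    ⟨_, by lia, w, hw⟩
  rw [Cocycle.toSingleMk_mem_coboundaries_iff _ _ _ _ _ (p + 1) (by lia)] at hmem
  obtain ⟨v, hv⟩ := hmem
  rw [K.exactAt_iff' (p - 1) p (p + 1) (by simp) (by simp)]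
  rw [ShortComplex.exact_iff_kernel_ι_comp_cokernel_π_zero, ← cancel_mono (Injective.ι _), zero_comp,
    Category.assoc]
  change kernel.ι (K.d p (p + 1)) ≫ u = 0
  rw [← hv, kernel.condition_assoc, zero_comp]

end Detection

/-! ### `Ext` through cochains on a projective resolution -/

section ExtExtension

variable {C : Type*} [Category* C] [Abelian C] [HasExt.{w} C] {M : C} (R : ProjectiveResolution M)

lemma exists_extension_of_subsingleton_ext {E : C} (n : ℕ) [Subsingleton (Ext M E n)] (p : ℤ)
    (hp : p + n = 0) (u : R.cochainComplex.X p ⟶ E) (hu : R.cochainComplex.d (p - 1) p ≫ u = 0) :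
    ∃ v : R.cochainComplex.X (p + 1) ⟶ E, R.cochainComplex.d p (p + 1) ≫ v = u := by
  have : Subsingleton (CohomologyClass R.cochainComplex ((singleFunctor C 0).obj E) n) :=
    R.extEquivCohomologyClass.symm.subsingleton
  have h := (CohomologyClass.mk_eq_zero_iff
    (Cocycle.toSingleMk u hp (p - 1) (by lia) hu)).1 (Subsingleton.elim _ _)
  rwa [Cocycle.toSingleMk_mem_coboundaries_iff _ _ _ _ _ (p + 1) (by lia)] at h

lemma subsingleton_ext_of_homVanish {E : C} (n : ℕ)
    (h : HomVanish R.cochainComplex ((singleFunctor C 0).obj E) n) : Subsingleton (Ext M E n) := by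
  have : Subsingleton (CohomologyClass R.cochainComplex ((singleFunctor C 0).obj E) n) := by
    refine ⟨fun x y => ?_⟩
    suffices ∀ x : CohomologyClass R.cochainComplex ((singleFunctor C 0).obj E) n, x = 0 by
      rw [this x, this y]
    intro x
    obtain ⟨x, rfl⟩ := x.mk_surjective
    obtain ⟨w, hw⟩ := h x.1 (x.δ_eq_zero _)
    exact (CohomologyClass.mk_eq_zero_iff x).2 ⟨_, by lia, w, hw⟩
  exact R.extEquivCohomologyClass.subsingleton

end ExtExtension

/-! ### Extensions of flat modules by modules of homomorphisms to injective modules -/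

section FlatExt

variable {k : Type v} [Field k] {A B : Type u} [Ring A] [Ring B] [Algebra k A] [Algebra k B]
  (X : CochainComplex (ModuleCat.{u} (B ⊗[k] Aᵐᵒᵖ)) ℤ) {J : CochainComplex (ModuleCat.{u} B) ℤ}

attribute [local instance] leftAction rightAction in
lemma mono_tensorFunctor_map (Y : ModuleCat.{u} (B ⊗[k] Aᵐᵒᵖ)) {S : ShortComplex (ModuleCat.{u} A)}
    (hS : S.ShortExact) (hF : IsFlat S.X₃) : Mono (((tensorFunctor k A B).obj Y).map S.f) := by
  refine (ModuleCat.mono_iff_injective _).2 ?_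
  have h : Function.Injective (mapR Y S.f.hom) :=
    hF.mapR_injective Y ((ModuleCat.mono_iff_injective _).1 hS.mono_f)
      ((ShortComplex.ShortExact.moduleCat_exact_iff_function_exact _).1 hS.exact)
      ((ModuleCat.epi_iff_surjective _).1 hS.epi_g)
  intro (s : BalancedTensor B A Y S.X₁) (t : BalancedTensor B A Y S.X₁) hst
  obtain ⟨s, rfl⟩ := (ofInt_bijective B A).2 s
  obtain ⟨t, rfl⟩ := (ofInt_bijective B A).2 t
  refine congrArg _ (h ((ofInt_bijective B A).1 ?_))
  exact (ofInt_map B A LinearMap.id _ _ s).trans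
    (hst.trans (ofInt_map B A LinearMap.id _ _ t).symm)

/-- A map to `Hom_B(X, J)^r` is a family of maps from `X^p ⊗_A K` to `J^(p+r)`; each extends along
the monomorphism to `X^p ⊗_A P`, as the terms of `J` are injective. -/
lemma exists_extension_homComplex (hJ : ∀ i, Injective (J.X i)) {K P : ModuleCat.{u} A} (i : K ⟶ P)
    (hi : ∀ Y : ModuleCat.{u} (B ⊗[k] Aᵐᵒᵖ), Mono (((tensorFunctor k A B).obj Y).map i)) (r : ℤ)
    (g : K ⟶ (homComplex X J).X r) : ∃ g' : P ⟶ (homComplex X J).X r, i ≫ g' = g := by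
  let φ (p q : ℤ) (hpq : p + r = q) : ((tensorFunctor k A B).obj (X.X p)).obj K ⟶ J.X q :=
    uncurry (fun x => HomCochain.v (g.hom x) p q hpq) (fun x x' => by rw [map_add]; rfl)
      (fun a x => by rw [map_smul]; exact HomCochain.smul_v _ _ _ _ _)
  let ψ (p q : ℤ) (hpq : p + r = q) : ((tensorFunctor k A B).obj (X.X p)).obj P ⟶ J.X q :=
    have := hi (X.X p)
    Injective.factorThru (φ p q hpq) (((tensorFunctor k A B).obj (X.X p)).map i)
  have hψ (p q : ℤ) (hpq : p + r = q) : ((tensorFunctor k A B).obj (X.X p)).map i ≫ ψ p q hpq =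
      φ p q hpq :=
    have := hi (X.X p)
    Injective.comp_factorThru _ _
  refine ⟨ModuleCat.ofHom (Y := HomCochain X J r)
    { toFun := fun x => HomCochain.mk fun p q hpq => curryAt (ψ p q hpq) x
      map_add' := fun x x' => HomCochain.ext fun p q hpq => curryAt_add _ x x'
      map_smul' := fun a x => HomCochain.ext fun p q hpq => by
        rw [RingHom.id_apply, HomCochain.smul_v]
        exact curryAt_smul (ψ p q hpq) a x }, ?_⟩
  refine ModuleCat.hom_ext (LinearMap.ext fun x => HomCochain.ext fun p q hpq => ?_)
  change curryAt (ψ p q hpq) (i.hom x) = HomCochain.v (g.hom x) p q hpq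
  rw [← curryAt_obj_map, hψ]
  rfl

lemma exists_flat_presentation {F : ModuleCat.{u} A} (hF : IsFlat F) :
    ∃ S : ShortComplex (ModuleCat.{u} A), S.ShortExact ∧ S.X₃ = F ∧ Projective S.X₂ ∧ IsFlat S.X₁ := by
  let S := ShortComplex.mk (kernel.ι (Projective.π F)) (Projective.π F) (by simp)
  have hS : S.ShortExact := { exact := ShortComplex.exact_kernel _ }
  refine ⟨S, hS, rfl, inferInstanceAs (Projective (Projective.over F)), ?_⟩
  exact IsFlat.of_exact (isFlat_of_projective (Projective.over F)) hF
    ((ModuleCat.mono_iff_injective _).1 hS.mono_f)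
    ((ShortComplex.ShortExact.moduleCat_exact_iff_function_exact _).1 hS.exact)
    ((ModuleCat.epi_iff_surjective _).1 hS.epi_g)

/-- Morally `Ext^i(F, Hom_B(X^p, J^q)) = Hom_B(Tor_i(X^p, F), J^q)`, which is zero for `i > 0`. The
proof treats `Ext¹` directly and shifts dimension through flat syzygies. -/
lemma subsingleton_ext_homComplex (hJ : ∀ i, Injective (J.X i)) (r : ℤ) (q : ℕ)
    {F : ModuleCat.{u} A} (hF : IsFlat F) :
    Subsingleton (Ext F ((homComplex X J).X r) (q + 1)) := by
  induction q generalizing F with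
  | zero =>
    obtain ⟨S, hS, rfl, hP, -⟩ := exists_flat_presentation hF
    refine subsingleton_of_forall_eq 0 fun x => ?_
    obtain ⟨x, rfl⟩ := Ext.contravariant_sequence_exact₃ hS _ x
      (Ext.eq_zero_of_hasProjectiveDimensionLT _ 1 le_rfl) (n₀ := 0) rfl
    obtain ⟨g, rfl⟩ := Ext.homEquiv₀.symm.surjective x
    obtain ⟨g, rfl⟩ := exists_extension_homComplex X hJ S.f
      (fun Y => mono_tensorFunctor_map Y hS hF) r g
    rw [Ext.homEquiv₀_symm_apply, ← Ext.mk₀_comp_mk₀]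
    -- A class in `Ext¹` comes from a map on the syzygy; this map extends to the projective cover
    -- term, so its product with the extension class is zero.
    exact hS.extClass_comp_assoc _
  | succ q ih =>
    obtain ⟨S, hS, rfl, hP, hK⟩ := exists_flat_presentation hF
    have := ih hK
    refine subsingleton_of_forall_eq 0 fun x => ?_
    obtain ⟨x, rfl⟩ := Ext.contravariant_sequence_exact₃ hS _ x
      (Ext.eq_zero_of_hasProjectiveDimensionLT _ 1 (by lia)) (n₀ := q + 1) (by lia)
    rw [Subsingleton.elim x 0, Ext.comp_zero]

end FlatExt

/-! ### The cohomology of the derived tensor product is bounded below -/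

section LowerBound

variable {k : Type v} [Field k] {A B : Type u} [Ring A] [Ring B] [Algebra k A] [Algebra k B]

lemma isZero_homComplex_X (X : CochainComplex (ModuleCat.{u} (B ⊗[k] Aᵐᵒᵖ)) ℤ)
    (J : CochainComplex (ModuleCat.{u} B) ℤ) (r : ℤ)
    (h : ∀ p q, p + r = q → IsZero (X.X p) ∨ IsZero (J.X q)) : IsZero ((homComplex X J).X r) := by
  refine ModuleCat.isZero_of_iff_subsingleton.2 ⟨fun z z' => HomCochain.ext fun p q hpq => ?_⟩
  obtain h | h := h p q hpq
  · exact ((resLeft k B Aᵐᵒᵖ).map_isZero h).eq_of_src _ _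
  · exact h.eq_of_tgt _ _

/-- Exactness is tested by maps to an injective `J`. By adjunction and truncation these are maps
from `R` to `Hom_B(T, J)`, with `T` the truncation of `I`. That complex lives in degrees from `-d`
to `-a`, and its terms receive no `Ext` from `M` in degrees at least `n₀`. -/
lemma exactAt_totalTensor {D I : CochainComplex (ModuleCat.{u} (B ⊗[k] Aᵐᵒᵖ)) ℤ} {a d : ℤ}
    (ι : D ⟶ I) [QuasiIso ι] [I.IsStrictlyGE a] (hq : QuasiIso (truncComplexι I d))
    {M : ModuleCat.{u} A} (R : ProjectiveResolution M) (n₀ : ℕ)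
    (hM : ∀ (J : CochainComplex (ModuleCat.{u} B) ℤ), (∀ i, Injective (J.X i)) →
      ∀ (r : ℤ) (n : ℕ), n₀ ≤ n → Subsingleton (Ext M ((homComplex (truncComplex I d) J).X r) n))
    (p : ℤ) (hp : p ≤ a - n₀) : (totalTensor D R.cochainComplex).ExactAt p := by
  refine exactAt_of_homVanish _ p fun J _ => ?_
  let L : CochainComplex (ModuleCat.{u} B) ℤ := (singleFunctor _ 0).obj J
  have hL (i : ℤ) : Injective (L.X i) := by
    by_cases hi : i = 0
    · subst hi
      exact Injective.of_iso (HomologicalComplex.singleObjXSelf (ComplexShape.up ℤ) 0 J).symm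
        inferInstance
    · have := HomologicalComplex.isZero_single_obj_X (ComplexShape.up ℤ) 0 J i hi
      exact Injective.of_iso this.isoZero.symm inferInstance
  have : L.IsKInjective := isKInjective_of_injective L 0
  rw [homVanish_totalTensor_iff]
  have := quasiIso_homComplexMap (J := L) ι
  have := quasiIso_homComplexMap (J := L) (truncComplexι I d)
  refine (homVanish_iff_of_isKProjective (homComplexMap ι L) _).1
    ((homVanish_iff_of_isKProjective (homComplexMap (truncComplexι I d) L) _).2 ?_)
  have hz (r : ℤ) (hr : r < -d ∨ -a < r) : IsZero ((homComplex (truncComplex I d) L).X r) := by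
    refine isZero_homComplex_X _ _ _ fun i j hij => ?_
    by_cases hj : j = 0
    · left
      obtain h | h := hr
      · exact isZero_truncComplex_X I d i (by lia)
      · exact isZero_of_isStrictlyGE _ a i (by lia)
    · exact Or.inr (HomologicalComplex.isZero_single_obj_X (ComplexShape.up ℤ) 0 J j hj)
  have : (homComplex (truncComplex I d) L).IsStrictlyGE (-d) :=
    (isStrictlyGE_iff _ _).2 fun r hr => hz r (Or.inl hr)
  refine homVanish_of_extension _ (-d) fun i r hir u hu => ?_
  -- When `r ≤ -a`, the source degree is `i = r + p ≤ -n₀`, so extending `u` is governed by `Ext` of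
  -- degree `-i ≥ n₀`.
  obtain hr | hr := lt_or_ge (-a) r
  · exact ⟨0, (hz r (Or.inr hr)).eq_of_tgt _ _⟩
  · have := hM L hL r (-i).toNat (by lia)
    exact exists_extension_of_subsingleton_ext R (-i).toNat i (by lia) u hu

end LowerBound

/-! ### Finiteness of projective dimensions -/

section ProjectiveDimension

variable {A : Type u} [Ring A]

/-- Passing to a syzygy lowers `s` by one. At `s = 0`, the identity of the flat module lifts to the
projective in its presentation, since `Ext¹` into the flat kernel vanishes; so the module is
projective. -/
lemma hasProjectiveDimensionLT_of_isFlat (s : ℕ) {F : ModuleCat.{u} A} (hF : IsFlat F)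
    (h : ∀ N : ModuleCat.{u} A, IsFlat N → ∀ n, s + 1 ≤ n → Subsingleton (Ext F N n)) :
    HasProjectiveDimensionLT F (s + 1) := by
  induction s generalizing F with
  | zero =>
    obtain ⟨S, hS, rfl, hP, hK⟩ := exists_flat_presentation hF
    have := h S.X₁ hK 1 le_rfl
    obtain ⟨x, hx⟩ := Ext.covariant_sequence_exact₃ S.X₃ hS (Ext.mk₀ (𝟙 S.X₃)) (zero_add 1)
      (Subsingleton.elim _ _)
    obtain ⟨σ, rfl⟩ := Ext.homEquiv₀.symm.surjective x
    rw [Ext.homEquiv₀_symm_apply, Ext.mk₀_comp_mk₀] at hx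
    have hσ : σ ≫ S.g = 𝟙 S.X₃ := Ext.homEquiv₀.symm.injective hx
    exact (Retract.mk σ S.g hσ).hasProjectiveDimensionLT 1
  | succ s ih =>
    obtain ⟨S, hS, rfl, hP, hK⟩ := exists_flat_presentation hF
    refine hS.hasProjectiveDimensionLT_X₃ (s + 1) (ih hK fun N hN n hn => ?_)
      (hasProjectiveDimensionLT_of_ge _ 1 _ (by lia))
    have := h N hN (1 + n) (by lia)
    refine subsingleton_of_forall_eq 0 fun x => ?_
    obtain ⟨x, rfl⟩ := Ext.contravariant_sequence_exact₁ hS N x rfl (Subsingleton.elim _ _)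
    rw [Ext.eq_zero_of_hasProjectiveDimensionLT x 1 (by lia), Ext.comp_zero]

/-- `Ext^p(X, -)` is right exact when `Ext^(p+1)(X, -) = 0`, so its vanishing can be tested on
projective objects. -/
lemma hasProjectiveDimensionLT_of_subsingleton_ext {C : Type*} [Category* C] [Abelian C]
    [EnoughProjectives C] [HasExt.{w} C] {X : C} {p : ℕ} [HasProjectiveDimensionLT X (p + 1)]
    (h : ∀ P : C, Projective P → Subsingleton (Ext X P p)) : HasProjectiveDimensionLT X p := by
  refine HasProjectiveDimensionLT.mk fun i hi Y x => ?_
  obtain rfl | hi := hi.eq_or_lt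
  · have hS : (ShortComplex.mk (kernel.ι (Projective.π Y)) (Projective.π Y) (by simp)).ShortExact :=
      { exact := ShortComplex.exact_kernel _ }
    have := h (Projective.over Y) inferInstance
    obtain ⟨y, rfl⟩ := Ext.covariant_sequence_exact₃ X hS x rfl
      (Ext.eq_zero_of_hasProjectiveDimensionLT _ (p + 1) le_rfl)
    rw [Subsingleton.elim y 0, Ext.zero_comp]
  · exact Ext.eq_zero_of_hasProjectiveDimensionLT _ (p + 1) hi

/-- The opcycles of a resolution are its syzygies; exactness at `j + 1` is injectivity on the left.
-/
lemma shortExact_fromOpcycles {C : Type*} [Category* C] [Abelian C] (K : ChainComplex C ℕ) (j : ℕ)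
    (h : K.ExactAt (j + 1)) :
    (ShortComplex.mk (K.fromOpcycles (j + 1) j) (K.pOpcycles j) (by
      rw [← cancel_epi (K.pOpcycles (j + 1)), HomologicalComplex.p_fromOpcycles_assoc,
        HomologicalComplex.d_pOpcycles, comp_zero])).ShortExact where
  exact := by
    let S := ShortComplex.mk (K.d (j + 1) j) (K.pOpcycles j) (by simp)
    have hS : S.Exact := S.exact_of_g_is_cokernel (K.opcyclesIsCokernel (j + 1) j (by simp))
    let T := ShortComplex.mk (K.fromOpcycles (j + 1) j) (K.pOpcycles j) (by
      rw [← cancel_epi (K.pOpcycles (j + 1)), HomologicalComplex.p_fromOpcycles_assoc,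
        HomologicalComplex.d_pOpcycles, comp_zero])
    let φ : S ⟶ T := { τ₁ := K.pOpcycles (j + 1), τ₂ := 𝟙 (K.X j), τ₃ := 𝟙 (K.opcycles j) }
    have : Epi φ.τ₁ := inferInstanceAs (Epi (K.pOpcycles (j + 1)))
    have : IsIso φ.τ₂ := inferInstanceAs (IsIso (𝟙 (K.X j)))
    have : Mono φ.τ₃ := inferInstanceAs (Mono (𝟙 (K.opcycles j)))
    exact (ShortComplex.exact_iff_of_epi_of_isIso_of_mono φ).1 hS
  mono_f := Preadditive.mono_of_isZero_kernel' _ (K.homologyIsKernel (j + 1) j (by simp))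
    ((K.exactAt_iff_isZero_homology _).1 h)

/-- The syzygies of a finite flat resolution are treated from the far end, where they vanish, down
to the zeroth one, which is `M`. -/
lemma exists_hasProjectiveDimensionLT {M : ModuleCat.{u} A} (hM : HasFiniteFlatDimension M)
    (h : ∀ F : ModuleCat.{u} A, IsFlat F → ∃ n, HasProjectiveDimensionLT F n) :
    ∃ n, HasProjectiveDimensionLT M n := by
  obtain ⟨n, F, π, hπ, hF, hn⟩ := hM
  have key (i j : ℕ) (hij : n < i + j) : ∃ s, HasProjectiveDimensionLT (F.opcycles j) s := by
    induction i generalizing j with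
    | zero =>
      have : Epi (F.pOpcycles j) := inferInstance
      have h0 : IsZero (F.opcycles j) := ((hn j (by lia)).of_epi (F.pOpcycles j))
      exact ⟨0, h0.hasProjectiveDimensionLT_zero⟩
    | succ i ih =>
      obtain ⟨s, hs⟩ := ih (j + 1) (by lia)
      obtain ⟨t, ht⟩ := h _ (hF j)
      have hex : F.ExactAt (j + 1) := by
        have := (quasiIso_iff π).1 hπ (j + 1)
        rw [quasiIsoAt_iff_exactAt' _ _ (ChainComplex.exactAt_succ_single_obj _ _)] at this
        exact this
      exact ⟨max s t + 1, (shortExact_fromOpcycles F j hex).hasProjectiveDimensionLT_X₃ (max s t)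
        (hasProjectiveDimensionLT_of_ge _ s _ (by lia))
        (hasProjectiveDimensionLT_of_ge _ t _ (by lia))⟩
  obtain ⟨s, hs⟩ := key (n + 1) 0 (by lia)
  let e : F.opcycles 0 ≅ M := F.isoHomologyι₀.symm ≪≫ isoOfQuasiIsoAt π 0 ≪≫
    HomologicalComplex.singleObjHomologySelfIso (ComplexShape.down ℕ) 0 M
  exact ⟨s, hasProjectiveDimensionLT_of_iso e s⟩

end ProjectiveDimension

/-! ### Consequences for dualizing complexes -/

section Main

variable {k : Type v} [Field k] {A B : Type u} [Ring A] [Ring B] [Algebra k A] [Algebra k B]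
  [IsNoetherianRing B] {D : CochainComplex (ModuleCat.{u} (B ⊗[k] Aᵐᵒᵖ)) ℤ}

lemma IsDualizingComplex.subsingleton_ext (hD : IsDualizingComplex k A B D) {M N : ModuleCat.{u} A}
    (hN : IsFlat N) {m d : ℤ} (hd : InjDimLE (resLeftComplex k B Aᵐᵒᵖ D) d)
    (hm : ∀ i, i < m → (derivedTensor D M).ExactAt i) (n : ℕ) (hn : d - m < n) :
    Subsingleton (Ext M N n) := by
  obtain ⟨I, a, ι, _, _, hI, hf, hT⟩ := hD.exists_resolutions
  obtain ⟨f, _⟩ := hf N hN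
  exact subsingleton_ext_of_homVanish (projectiveResolution M) n
    (homVanish_single (a := a) ι hI (hT d hd).1 (hT d hd).2 hN f _ hm hn)

/-- The flat case serves to prove that flat modules have finite projective dimension; the other case
applies to `M` once its projective dimension is known to be finite. -/
lemma IsDualizingComplex.exists_exactAt (hD : IsDualizingComplex k A B D) {M : ModuleCat.{u} A}
    (hM : IsFlat M ∨ ∃ n, HasProjectiveDimensionLT M n) :
    ∃ c, ∀ i, i ≤ c → (derivedTensor D M).ExactAt i := by
  obtain ⟨I, a, ι, _, _, -, -, hT⟩ := hD.exists_resolutions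
  obtain ⟨d, hd⟩ := hD.injDim_left
  obtain hM | ⟨n, hM⟩ := hM
  · refine ⟨_, exactAt_totalTensor (a := a) ι (hT d hd).1 (projectiveResolution M) 1 fun J hJ r n hn => ?_⟩
    obtain ⟨n, rfl⟩ := Nat.exists_eq_add_of_le' hn
    exact subsingleton_ext_homComplex _ hJ r n hM
  · exact ⟨_, exactAt_totalTensor (a := a) ι (hT d hd).1 (projectiveResolution M) n fun J hJ r i hi =>
      HasProjectiveDimensionLT.subsingleton M n i hi _⟩

/-- The bound `c` depends on `F` but not on the flat module `N` mapped into, which is the uniformity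
that the splitting argument requires. -/
lemma IsDualizingComplex.exists_hasProjectiveDimensionLT (hD : IsDualizingComplex k A B D)
    {M : ModuleCat.{u} A} (hM : HasFiniteFlatDimension M) : ∃ n, HasProjectiveDimensionLT M n := by
  refine DualizingFlat.exists_hasProjectiveDimensionLT hM fun F hF => ?_
  obtain ⟨c, hc⟩ := hD.exists_exactAt (Or.inl hF)
  obtain ⟨d, hd⟩ := hD.injDim_left
  exact ⟨_, hasProjectiveDimensionLT_of_isFlat (d - c).toNat hF fun N hN n hn =>
    hD.subsingleton_ext hN hd (fun i hi => hc i hi.le) n (by lia)⟩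

/-- The bound `pd M ≤ id_B D - inf (D ⊗ᴸ_A M)`, in the form needed to show that both terms on the
right are finite. -/
lemma IsDualizingComplex.le_sub (hD : IsDualizingComplex k A B D) {M : ModuleCat.{u} A} {p : ℕ}
    [HasProjectiveDimensionLT M (p + 1)] (hp : ¬ HasProjectiveDimensionLT M p) {m d : ℤ}
    (hd : InjDimLE (resLeftComplex k B Aᵐᵒᵖ D) d)
    (hm : ∀ i, i < m → (derivedTensor D M).ExactAt i) : (p : ℤ) ≤ d - m := by
  by_contra! h
  exact hp (hasProjectiveDimensionLT_of_subsingleton_ext fun P _ =>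
    hD.subsingleton_ext (isFlat_of_projective P) hd hm p h)

end Main

end DualizingFlat

/-- If `A` is a right-noetherian `k`-algebra with a dualizing complex `D` over a left-noetherian
`k`-algebra `B` and `A`, then a left `A`-module of finite flat dimension has finite projective
dimension; if moreover `M ≠ 0`, then `inf {i | Hⁱ(D ⊗ᴸ_A M) ≠ 0}` and `id_B D` are integers `m`
and `d`, and `pd_A M ≤ -m + d`. -/
theorem mainTheorem1 {k : Type v} [Field k] {A B : Type u} [Ring A] [Ring B]
    [Algebra k A] [Algebra k B] [IsNoetherianRing Aᵐᵒᵖ] [IsNoetherianRing B]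
    (D : CochainComplex (ModuleCat.{u} (B ⊗[k] Aᵐᵒᵖ)) ℤ)
    (hD : DualizingFlat.IsDualizingComplex k A B D)
    (M : ModuleCat.{u} A) (hM : DualizingFlat.HasFiniteFlatDimension M) :
    projectiveDimension M < ⊤ ∧
    (¬ IsZero M → ∃ m d : ℤ,
      IsLeast {i : ℤ | ¬ IsZero ((DualizingFlat.derivedTensor D M).homology i)} m ∧
      IsLeast {n : ℤ | DualizingFlat.InjDimLE (DualizingFlat.resLeftComplex k B Aᵐᵒᵖ D) n} d ∧
      ∃ n : ℕ, (n : ℤ) = -m + d ∧ projectiveDimension M ≤ n) := by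
  have hfin := hD.exists_hasProjectiveDimensionLT hM
  refine ⟨lt_top_iff_ne_top.2 ((projectiveDimension_ne_top_iff M).2 ?_), fun h0 => ?_⟩
  · obtain ⟨n, hn⟩ := hfin
    exact ⟨n, hasProjectiveDimensionLT_of_ge M n _ n.le_succ⟩
  -- Here `p` is the exact projective dimension of `M`; it exists because `M` is nonzero and its
  -- projective dimension is finite.
  obtain ⟨p, hp', hp⟩ : ∃ p, HasProjectiveDimensionLT M (p + 1) ∧ ¬ HasProjectiveDimensionLT M p := by
    by_contra! h
    obtain ⟨n, hn⟩ := hfin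
    induction n with
    | zero => exact h0 (isZero_of_hasProjectiveDimensionLT_zero M)
    | succ n ih => exact ih (h n hn)
  obtain ⟨c, hc⟩ := hD.exists_exactAt (Or.inr ⟨p + 1, hp'⟩)
  have hex (i : ℤ) : (DualizingFlat.derivedTensor D M).ExactAt i ↔ IsZero ((DualizingFlat.derivedTensor D M).homology i) :=
    (DualizingFlat.derivedTensor D M).exactAt_iff_isZero_homology i
  -- Every bound `d` for the injective dimension satisfies `0 ≤ p ≤ d - c`, so a least one exists.
  obtain ⟨d, hd, hd'⟩ := Int.exists_least_of_bdd
    (P := DualizingFlat.InjDimLE (DualizingFlat.resLeftComplex k B Aᵐᵒᵖ D))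
    ⟨c, fun d hd => by have := hD.le_sub hp hd (fun i hi => hc i hi.le); lia⟩ hD.injDim_left
  obtain ⟨m, hm, hm'⟩ := Int.exists_least_of_bdd
    (P := fun i => ¬ IsZero ((DualizingFlat.derivedTensor D M).homology i))
    ⟨c, fun i hi => by
      by_contra! h
      -- Some cohomology is nonzero: otherwise `m = d + 1` would be allowed in the bound, giving `p
      -- ≤ -1`.
      exact hi ((hex i).1 (hc i h.le))⟩ (by
      by_contra! h
      have := hD.le_sub hp hd (m := d + 1) fun i _ => (hex i).2 (h i)
      lia)
  have hle := hD.le_sub hp hd (m := m) fun i hi => (hex i).2 (by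
    by_contra h
    exact absurd (hm' i h) (by lia))
  -- The conversion to a natural number loses nothing, as `0 ≤ p ≤ d - m`.
  refine ⟨m, d, ⟨hm, fun i hi => hm' i hi⟩, ⟨hd, fun i hi => hd' i hi⟩, (-m + d).toNat, by lia,
    (projectiveDimension_le_iff M _).2 (hasProjectiveDimensionLT_of_ge M (p + 1) _ (by lia))⟩
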